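/- **Setting.** Let $\mathbb{C}[x,\xi]$ be the superalgebra with even coordinate $x$ and odd coordinate $\xi$, $\xi^2=0$; a prime denotes $\partial_x$. Put $D=\partial_\xi+\xi\partial_x$ and $\overline D=\partial_\xi-\xi\partial_x$. Let $\mathcal K$ be the Lie superalgebra of polynomial contact vector fields on $\mathbb{R}^{1|1}$. It consists of the fields $\mathbb{X}(F)$, $F\in\mathbb{C}[x,\xi]$, where $$\mathbb{X}(f)=f\partial_x+\tfrac12 f'\,\xi\partial_\xi,\qquad \mathbb{X}(\xi f)=\tfrac12 f D\qquad (f\in\mathbb{C}[x]),$$ and $\mathbb{X}$ is linear. Let $\mathfrak{s}=\operatorname{span}\{\mathbb{X}(1),\mathbb{X}(\xi),\mathbb{X}(x),\mathbb{X}(\xi x),\mathbb{X}(x^2)\}\cong\mathfrak{osp}(1|2)$. For $\lambda\in\mathbb{C}$, the tensor density module $\mathbb{F}(\lambda)=\omega^\lambda\,\mathbb{C}[x,\xi]$ carries the action $$\pi_\lambda(\mathbb{X}(F))\,(\omega^\lambda G)=\omega^\lambda\bigl(\mathbb{X}(F)G+\lambda F'G\bigr).$$ Submodules are subsuperspaces,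 and $V^{m\Pi}$ denotes $V$ with its parity reversed if $m$ is odd and unchanged if $m$ is even. **Extensions.** Let $p_1,p_2,p_3\in\tfrac12\mathbb{Z}$. A $(\lambda;p_1,p_2,p_3)$ *extension* is a $\mathcal K$-module $W$ with a chain of submodules $W=W_0\supseteq W_1\supseteq W_2\supseteq W_3\supseteq W_4=0$ such that, for $r=0,1,2,3$, $W_r/W_{r+1}$ is equivalent, by an even equivalence, to $\mathbb{F}(\lambda+p_1+\cdots+p_r)^{2(p_1+\cdots+p_r)\Pi}$. It is *$\mathfrak{s}$-split* if, for a chain as above, each $W_{r+1}$ has an $\mathfrak{s}$-invariant complement in $W_r$. A module is *uniserial* if all of its subquotients are indecomposable. **Pseudodifferential operators.** For $z\in\mathbb{C}$ put $\overline D{}^{z}_{0}=e^{i\pi z/2}\partial_x^{z/2}$ and $\overline D{}^{z}_{1}=e^{i\pi(z-1)/2}\partial_x^{(z-1)/2}\,\overline D$; the lower index is taken modulo $2$. For $\nu,q,k\in\mathbb{C}$ and $\ell\in\mathbb{Z}/2$, let $\Psi^k_\ell(\nu,q)$ be the superspace of formal series $$T=\omega^{q}\sum_{j\ge0}G_j\,\overline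 D{}^{\,2k-j}_{\,\ell-j},\qquad G_j\in\mathbb{C}[x,\xi],$$ where the $j$-th term has parity $|G_j|+\ell-j$, regarded as symbols of operators from $\mathbb{F}(\nu)$ to $\mathbb{F}(\nu+q)$. They are composed by the generalized Leibniz rule, which is determined by $\overline D\circ F=(-1)^{|F|}F\,\overline D+\overline D(F)$ and $\partial_x^{w}\circ F=\sum_{i\ge0}\binom{w}{i}F^{(i)}\partial_x^{w-i}$. With the action $T\mapsto\pi_{\nu+q}(X)\circ T-(-1)^{|X||T|}\,T\circ\pi_\nu(X)$ of $X\in\mathcal K$, $\Psi^k_\ell(\nu,q)$ is a $\mathcal K$-module. **Proposition.** In each of the following cases there exists a uniserial $\mathfrak{s}$-split $(\lambda;p_1,p_2,p_3)$ extension. It is unique up to even equivalence. It is equivalent, by an even or an odd equivalence, to a subquotient of some $\Psi^k_\ell(\nu,q)$. (a) $(\lambda;\tfrac32,\tfrac32,\tfrac32)$ for every $\lambda\in\mathbb{C}$ with $-2\lambda\notin\{0,1,\dots,8\}$. (b) $(1;2,\tfrac32,\tfrac32)$ and $(-\tfrac{11}2;\tfrac32,\tfrac32,2)$. (c) $\bigl(\tfrac{-9\pm\sqrt{57}}4;2,2,\tfrac32\bigr)$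 and $\bigl(\tfrac{-11\pm\sqrt{57}}4;\tfrac32,2,2\bigr)$. (d) $\bigl(\tfrac{-11\pm\sqrt{89}}4;\tfrac52,\tfrac32,2\bigr)$ and $\bigl(\tfrac{-11\pm\sqrt{89}}4;2,\tfrac32,\tfrac52\bigr)$. (e) $\bigl(\tfrac{-11\pm\sqrt{73}}4;2,\tfrac52,\tfrac32\bigr)$ and $\bigl(\tfrac{-11\pm\sqrt{73}}4;\tfrac32,\tfrac52,2\bigr)$. (f) $(-7;2,2,2)$ and $(\tfrac32;2,2,2)$. (g) $\bigl(\tfrac{-11\pm\sqrt{105}}4;\tfrac52,2,2\bigr)$ and $\bigl(\tfrac{-13\pm\sqrt{105}}4;2,2,\tfrac52\bigr)$. In (c), (d), (e) and (g) both signs are meant. -/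

import Mathlib

open Polynomial

universe u

noncomputable section

namespace SuperLine

/-! ## The superline and its contact vector fields -/

/-- The superalgebra `ℂ[x, ξ]` with `ξ² = 0`: the element `f + ξ g` is `inl f + inr g`.
It is supercommutative and also commutative, so Mathlib's commutative ring structure is the
right product. -/
abbrev SPoly : Type := DualNumber ℂ[X]

/-- The parity endomorphism `ε(f + ξ g) = f - ξ g`. -/
def eps : SPoly →ₗ[ℂ] SPoly where
  toFun F := .inl F.fst - .inr F.snd
  map_add' F G := by ext <;> simp [sub_eq_add_neg, add_comm]
  map_smul' c F := by ext <;> simp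

/-- The even derivation `∂ₓ`. -/
def dx : SPoly →ₗ[ℂ] SPoly where
  toFun F := .inl (derivative F.fst) + .inr (derivative F.snd)
  map_add' F G := by ext <;> simp
  map_smul' c F := by ext <;> simp

/-- The odd derivation `∂_ξ`. -/
def dxi : SPoly →ₗ[ℂ] SPoly where
  toFun F := .inl F.snd
  map_add' F G := by ext <;> simp
  map_smul' c F := by ext <;> simp

/-- The odd coordinate `ξ`. -/
def xi : SPoly := .inr 1

/-- `D = ∂_ξ + ξ ∂ₓ`. -/
def opD : SPoly →ₗ[ℂ] SPoly := dxi + LinearMap.mulLeft ℂ xi ∘ₗ dx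

/-- `D̄ = ∂_ξ - ξ ∂ₓ`. -/
def opDbar : SPoly →ₗ[ℂ] SPoly := dxi - LinearMap.mulLeft ℂ xi ∘ₗ dx

/-- The even component `f` of `f + ξ g`. -/
def evenPart : SPoly →ₗ[ℂ] SPoly where
  toFun F := .inl F.fst
  map_add' F G := by ext <;> simp
  map_smul' c F := by ext <;> simp

/-- The odd component `ξ g` of `f + ξ g`. -/
def oddPart : SPoly →ₗ[ℂ] SPoly where
  toFun F := .inr F.snd
  map_add' F G := by ext <;> simp
  map_smul' c F := by ext <;> simp

@[simp] lemma eps_fst (F : SPoly) : (eps F).fst = F.fst := by simp [eps]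
@[simp] lemma eps_snd (F : SPoly) : (eps F).snd = -F.snd := by simp [eps]
@[simp] lemma dx_fst (F : SPoly) : (dx F).fst = derivative F.fst := by simp [dx]
@[simp] lemma dx_snd (F : SPoly) : (dx F).snd = derivative F.snd := by simp [dx]
@[simp] lemma opD_fst (F : SPoly) : (opD F).fst = F.snd := by simp [opD, dxi, xi]
@[simp] lemma opD_snd (F : SPoly) : (opD F).snd = derivative F.fst := by simp [opD, dxi, xi]
@[simp] lemma opDbar_fst (F : SPoly) : (opDbar F).fst = F.snd := by simp [opDbar, dxi, xi]
@[simp] lemma opDbar_snd (F : SPoly) : (opDbar F).snd = -derivative F.fst := by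
  simp [opDbar, dxi, xi]
@[simp] lemma evenPart_fst (F : SPoly) : (evenPart F).fst = F.fst := by simp [evenPart]
@[simp] lemma evenPart_snd (F : SPoly) : (evenPart F).snd = 0 := by simp [evenPart]
@[simp] lemma oddPart_fst (F : SPoly) : (oddPart F).fst = 0 := by simp [oddPart]
@[simp] lemma oddPart_snd (F : SPoly) : (oddPart F).snd = F.snd := by simp [oddPart]

/-- The contact vector field with contact Hamiltonian `F = f + ξ g`, as an operator on `ℂ[x, ξ]`:
`𝕏(f) = f ∂ₓ + ½ f' ξ ∂_ξ` and `𝕏(ξ g) = ½ g D`.  The map `𝕏` is injective, and its image is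
the Lie superalgebra `𝒦` of contact vector fields.  From here on an element of `𝒦` is
represented by its contact Hamiltonian. -/
def contactField : SPoly →ₗ[ℂ] SPoly →ₗ[ℂ] SPoly :=
  LinearMap.mk₂ ℂ
    (fun F G => .inl F.fst * dx G + (1 / 2 : ℂ) • (.inl (derivative F.fst) * (xi * dxi G))
      + (1 / 2 : ℂ) • (.inl F.snd * opD G))
    (fun F F' G => by
      simp only [TrivSqZeroExt.fst_add, TrivSqZeroExt.snd_add, TrivSqZeroExt.inl_add, map_add,
        add_mul, smul_add]; abel)
    (fun c F G => by
      simp only [TrivSqZeroExt.fst_smul, TrivSqZeroExt.snd_smul, TrivSqZeroExt.inl_smul,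
        derivative_smul, smul_mul_assoc, smul_add, smul_comm c (1 / 2 : ℂ)])
    (fun F G G' => by simp only [map_add, mul_add, smul_add]; abel)
    (fun c F G => by simp only [map_smul, mul_smul_comm, smul_add, smul_comm c (1 / 2 : ℂ)])

lemma contactField_apply (F G : SPoly) :
    contactField F G =
      .inl F.fst * dx G + (1 / 2 : ℂ) • (.inl (derivative F.fst) * (xi * dxi G))
      + (1 / 2 : ℂ) • (.inl F.snd * opD G) := rfl

/-- The contact bracket `{F, G} = F G' - F' G - ½ (-1)^{|G|} D(F) D(G)` of contact
Hamiltonians, which is the Lie superbracket of `𝒦`. -/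
def contactBracket (F G : SPoly) : SPoly :=
  F * dx G - dx F * G - (1 / 2 : ℂ) • (opD F * opD (eps G))

/-- The map `𝕏` carries the contact bracket to the superbracket of vector fields. -/
theorem contactField_bracket (F G H : SPoly) :
    contactField (contactBracket F G) H = contactField F (contactField G H)
      - contactField G (contactField (evenPart F) H)
      - contactField (eps G) (contactField (oddPart F) H) := by
  have h2 : 2 * (C (1 / 2) : ℂ[X]) = 1 := by rw [← C_ofNat, ← C_mul]; norm_num
  refine TrivSqZeroExt.ext ?_ ?_ <;>
  simp only [contactField_apply, contactBracket, xi, dxi] <;>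
  simp [smul_eq_C_mul, -one_div] <;> grind

/-- The conformal subalgebra `𝔰 = span {e₋₁, e₋₁⸝₂, e₀, e₁⸝₂, e₁}` of `𝒦`, a copy of `osp(1|2)`.
Here `e_{n-1} = 𝕏(xⁿ)` and `e_{n-1/2} = 2 𝕏(ξ xⁿ)`. -/
def conformal : Submodule ℂ SPoly :=
  Submodule.span ℂ {.inl 1, .inr 1, .inl X, .inr X, .inl (X ^ 2)}

/-! ## Modules of `𝒦` -/

/-- A complex superspace, given by its parity endomorphism `par = ε_V` (`+1` on the even part,
`-1` on the odd part), with a linear map `F ↦ act F` from `𝒦` to its endomorphisms, not yet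
subject to any condition. -/
structure SuperAction (V : Type*) [AddCommGroup V] [Module ℂ V] where
  par : V →ₗ[ℂ] V
  act : SPoly →ₗ[ℂ] V →ₗ[ℂ] V

namespace SuperAction

variable {V W : Type*} [AddCommGroup V] [Module ℂ V] [AddCommGroup W] [Module ℂ W]

/-- The action is a representation of the Lie superalgebra `𝒦`: it is even, and it carries the
bracket of homogeneous `X`, `Y` to `X Y - (-1)^{|X||Y|} Y X`.  For arbitrary `F` and `G` this is written by
splitting `F` into its components: only the odd one sees the sign `(-1)^{|G|}`. -/
structure IsRep (A : SuperAction V) : Prop where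
  par_par : ∀ v, A.par (A.par v) = v
  par_act : ∀ F v, A.par (A.act F v) = A.act (eps F) (A.par v)
  act_bracket : ∀ F G v, A.act (contactBracket F G) v =
    A.act F (A.act G v) - A.act G (A.act (evenPart F) v) - A.act (eps G) (A.act (oddPart F) v)

/-- `V^{mΠ}`: the same action on the same space, with parities reversed if `m` is odd. -/
def shift (A : SuperAction V) (m : ZMod 2) : SuperAction V where
  par := if m = 0 then A.par else -A.par
  act := A.act

/-- `U` is a subsuperspace invariant under the elements of `S`. -/
def InvariantUnder (A : SuperAction V) (S : Submodule ℂ SPoly) (U : Submodule ℂ V) : Prop :=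
  (∀ v ∈ U, A.par v ∈ U) ∧ ∀ F ∈ S, ∀ v ∈ U, A.act F v ∈ U

/-- `U` is a `𝒦`-invariant subsuperspace. -/
def Invariant (A : SuperAction V) (U : Submodule ℂ V) : Prop := A.InvariantUnder ⊤ U

/-- The action of `𝒦` on the subquotient `M / N` (or `M / (M ∩ N)`, in case `N ⊄ M`). -/
def subquotient (A : SuperAction V) (M N : Submodule ℂ V) (hM : A.Invariant M)
    (hN : A.Invariant N) : SuperAction (M ⧸ N.submoduleOf M) where
  par := Submodule.mapQ _ _ (A.par.restrict hM.1) (fun v hv => hN.1 _ hv)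
  act :=
    { toFun := fun F => Submodule.mapQ _ _ ((A.act F).restrict (hM.2 F trivial))
        (fun v hv => hN.2 F trivial _ hv)
      map_add' := fun F G => by
        ext v
        simp only [map_add]
        rfl
      map_smul' := fun c F => by
        ext v
        simp only [map_smul]
        rfl }

/-- There is an even `𝒦`-equivalence from `A` to `B`. -/
def EvenEquiv (A : SuperAction V) (B : SuperAction W) : Prop :=
  ∃ φ : V ≃ₗ[ℂ] W, (∀ v, φ (A.par v) = B.par (φ v)) ∧
    ∀ F v, φ (A.act F v) = B.act F (φ v)

/-- There is an odd `𝒦`-equivalence `φ` from `A` to `B`: it reverses parity, and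
`B(X) φ = (-1)^{|X|} φ A(X)`. -/
def OddEquiv (A : SuperAction V) (B : SuperAction W) : Prop :=
  ∃ φ : V ≃ₗ[ℂ] W, (∀ v, φ (A.par v) = -B.par (φ v)) ∧
    ∀ F v, φ (A.act F v) = B.act (eps F) (φ v)

/-- The module is not a direct sum of two non-zero submodules. -/
def Indecomposable (A : SuperAction V) : Prop :=
  ∀ U₁ U₂ : Submodule ℂ V, A.Invariant U₁ → A.Invariant U₂ → IsCompl U₁ U₂ → U₁ = ⊥ ∨ U₂ = ⊥

/-- A module is uniserial if all of its subquotients are indecomposable. -/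
def Uniserial (A : SuperAction V) : Prop :=
  ∀ (M N : Submodule ℂ V) (hM : A.Invariant M) (hN : A.Invariant N), N ≤ M →
    (A.subquotient M N hM hN).Indecomposable

/-- `A` is an `𝔰`-split extension of `B 0 → B 1 → ⋯ → B (n-1)`: it is a `𝒦`-module with an
invariant flag `W = W₀ ⊇ W₁ ⊇ ⋯ ⊇ Wₙ = 0` such that `W_r / W_{r+1}` is equivalent to `B r`,
and `W_{r+1}` has an `𝔰`-invariant complement in `W_r` for every `r`. -/
def IsSplitExtension (A : SuperAction V) {n : ℕ} (B : Fin n → SuperAction W) : Prop :=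
  A.IsRep ∧ ∃ (flag : Fin (n + 1) → Submodule ℂ V) (h : ∀ r, A.Invariant (flag r)),
    flag 0 = ⊤ ∧ flag (Fin.last n) = ⊥ ∧
    ∀ r : Fin n, flag r.succ ≤ flag r.castSucc ∧
      (A.subquotient (flag r.castSucc) (flag r.succ) (h _) (h _)).EvenEquiv (B r) ∧
      ∃ U : Submodule ℂ V, A.InvariantUnder conformal U ∧
        U ⊔ flag r.succ = flag r.castSucc ∧ U ⊓ flag r.succ = ⊥

end SuperAction

/-- The tensor density module `𝔽(lam) = ℂ[x, ξ] ω^lam`, where `𝕏(F)` acts by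
`ω^lam G ↦ ω^lam (𝕏(F) G + lam F' G)`. -/
def tensorDensity (lam : ℂ) : SuperAction SPoly where
  par := eps
  act := contactField + lam • (LinearMap.mul ℂ SPoly ∘ₗ dx)

lemma tensorDensity_act (lam : ℂ) (F G : SPoly) :
    (tensorDensity lam).act F G = contactField F G + lam • (dx F * G) := rfl

theorem tensorDensity_isRep (lam : ℂ) : (tensorDensity lam).IsRep where
  par_par v := by refine TrivSqZeroExt.ext ?_ ?_ <;> simp [tensorDensity]
  par_act F v := by
    refine TrivSqZeroExt.ext ?_ ?_ <;>
    simp [tensorDensity, contactField_apply, xi, dxi, smul_eq_C_mul] <;> ring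
  act_bracket F G v := by
    have h2 : 2 * (C (1 / 2) : ℂ[X]) = 1 := by rw [← C_ofNat, ← C_mul]; norm_num
    refine TrivSqZeroExt.ext ?_ ?_ <;>
    simp [tensorDensity_act, contactField_apply, contactBracket, xi, dxi, smul_eq_C_mul, -one_div]
      <;> grind

/-- The list `V₀, …, Vₙ` of composition modules of a `(lam; p₁, …, pₙ)` extension, where
`a = [2 p₁, …, 2 pₙ]`: `V_r` is `𝔽(lam + p₁ + ⋯ + p_r)`, with parity reversed if
`2 (p₁ + ⋯ + p_r)` is odd. -/
def densityChain (lam : ℂ) (a : List ℤ) (r : Fin (a.length + 1)) : SuperAction SPoly :=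
  (tensorDensity (lam + ((a.take r).sum : ℂ) / 2)).shift ((a.take r).sum : ZMod 2)

/-! ## Pseudodifferential operators

A formal series `ω^p ∑_{j ≥ 0} G_j D̄^{2k-j}_{ℓ-j}` with `G_j ∈ ℂ[x, ξ]` is represented by its
coefficient sequence `j ↦ G_j`.  The formal symbols are
`D̄^z_0 = e^{iπz/2} ∂ₓ^{z/2}` and `D̄^z_1 = e^{iπ(z-1)/2} ∂ₓ^{(z-1)/2} D̄`.  They satisfy
`D̄^z_m D̄^{z'}_{m'} = D̄^{z+z'}_{m+m'}` and `D̄^j_j = D̄^j` for `j ∈ ℕ`. -/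

/-- The generalized binomial symbol `z (z-1) ⋯ (z-n+1) / n!`. -/
def genBinom (z : ℂ) (n : ℕ) : ℂ := (∏ i ∈ Finset.range n, (z - i)) / n.factorial

/-- The coefficients of the generalized Leibniz rule: for a function `F`,
`D̄^z_m ∘ F = ∑_b (leibniz z m b F) D̄^{z-b}_{m-b}`.  For `m = 0` this is the rule
`∂ₓ^w ∘ F = ∑_i (w choose i) F^{(i)} ∂ₓ^{w-i}` at `w = z/2`, as `∂ₓ^{-i}` is `(-1)^i D̄^{-2i}_0`.
For `m = 1` use in addition `D̄ ∘ F = ε(F) D̄ + D̄(F)`. -/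
def leibniz (z : ℂ) (m : ZMod 2) (b : ℕ) : SPoly →ₗ[ℂ] SPoly :=
  if m = 0 then
    if Even b then ((-1) ^ (b / 2) * genBinom (z / 2) (b / 2)) • (dx ^ (b / 2) : Module.End ℂ SPoly)
    else 0
  else
    ((-1) ^ (b / 2) * genBinom ((z - 1) / 2) (b / 2)) •
      ((dx ^ (b / 2) : Module.End ℂ SPoly) ∘ₗ if Even b then eps else opDbar)

/-- Composition of the series `∑_i S_i D̄^{z-i}_{m-i}` with the series `∑_j T_j D̄^{z'-j}_{m'-j}`:
the result is `∑_n R_n D̄^{z+z'-n}_{m+m'-n}`, where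
`R_n = ∑_{i + b + j = n} S_i · leibniz (z-i) (m-i) b T_j`. -/
def comp (z : ℂ) (m : ZMod 2) : (ℕ → SPoly) →ₗ[ℂ] (ℕ → SPoly) →ₗ[ℂ] (ℕ → SPoly) :=
  LinearMap.mk₂ ℂ
    (fun S T n => ∑ ij ∈ Finset.HasAntidiagonal.antidiagonal n, ∑ bj ∈ Finset.HasAntidiagonal.antidiagonal ij.2,
      S ij.1 * leibniz (z - ij.1) (m - ij.1) bj.1 (T bj.2))
    (fun S S' T => by
      funext n; simp [add_mul, Finset.sum_add_distrib])
    (fun c S T => by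
      funext n; simp [Finset.smul_sum])
    (fun S T T' => by
      funext n; simp [mul_add, Finset.sum_add_distrib])
    (fun c S T => by
      funext n; simp [Finset.smul_sum])

lemma comp_apply (z : ℂ) (m : ZMod 2) (S T : ℕ → SPoly) (n : ℕ) :
    comp z m S T n = ∑ ij ∈ Finset.HasAntidiagonal.antidiagonal n, ∑ bj ∈ Finset.HasAntidiagonal.antidiagonal ij.2,
      S ij.1 * leibniz (z - ij.1) (m - ij.1) bj.1 (T bj.2) := rfl

/-- The action of `𝕏(F)` on `𝔽(lam)` is the differential operator
`-F D̄² + ½ D(F) D̄ + lam F'`; these are its coefficients in degrees `D̄²`, `D̄¹`, `D̄⁰`. -/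
def densityOp (lam : ℂ) : SPoly →ₗ[ℂ] (ℕ → SPoly) :=
  LinearMap.pi fun n =>
    match n with
    | 0 => -LinearMap.id
    | 1 => (1 / 2 : ℂ) • opD
    | 2 => lam • dx
    | _ => 0

lemma tensorDensity_act_eq (lam : ℂ) (F G : SPoly) :
    (tensorDensity lam).act F G = densityOp lam F 0 * opDbar (opDbar G)
      + densityOp lam F 1 * opDbar G + densityOp lam F 2 * G := by
  ext <;>
  simp [tensorDensity_act, contactField_apply, densityOp, xi, dxi, smul_eq_C_mul] <;> ring

/-- The parity endomorphism of `Ψ^k_ℓ`: the term `ω^p G D̄^{2k-j}_{ℓ-j}` has parity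
`|G| + ℓ - j`. -/
def psiPar (l : ZMod 2) : (ℕ → SPoly) →ₗ[ℂ] (ℕ → SPoly) :=
  LinearMap.pi fun j => (if l - j = 0 then eps else -eps) ∘ₗ LinearMap.proj j

/-- The supercommutator `π_{lam+p}(X) ∘ T - (-1)^{|X||T|} T ∘ π_lam(X)` of `T ∈ Ψ^k_ℓ(lam, p)` with
the action of `X = 𝕏(F)`, as an element `∑_n R_n D̄^{2k+2-n}_{ℓ-n}` of `Ψ^{k+1}_ℓ(lam, p)`. -/
def psiCommutator (lam p k : ℂ) (l : ZMod 2) :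
    SPoly →ₗ[ℂ] (ℕ → SPoly) →ₗ[ℂ] (ℕ → SPoly) :=
  comp 2 0 ∘ₗ densityOp (lam + p)
    - (comp (2 * k) l).flip ∘ₗ densityOp lam ∘ₗ evenPart
    - ((comp (2 * k) l ∘ₗ psiPar l).flip) ∘ₗ densityOp lam ∘ₗ oddPart

lemma psiCommutator_apply (lam p k : ℂ) (l : ZMod 2) (F : SPoly) (T : ℕ → SPoly) :
    psiCommutator lam p k l F T = comp 2 0 (densityOp (lam + p) F) T
      - comp (2 * k) l T (densityOp lam (evenPart F))
      - comp (2 * k) l (psiPar l T) (densityOp lam (oddPart F)) := rfl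

lemma leibniz_zero (z : ℂ) (m : ZMod 2) (F : SPoly) :
    leibniz z m 0 F = if m = 0 then F else eps F := by
  by_cases h : m = 0 <;> simp [leibniz, genBinom, h]

lemma leibniz_one (z : ℂ) (m : ZMod 2) (F : SPoly) :
    leibniz z m 1 F = if m = 0 then 0 else opDbar F := by
  by_cases h : m = 0 <;> simp [leibniz, genBinom, h]

lemma comp_zero (z : ℂ) (m : ZMod 2) (S T : ℕ → SPoly) :
    comp z m S T 0 = S 0 * leibniz z m 0 (T 0) := by
  simp [comp_apply]

lemma comp_one (z : ℂ) (m : ZMod 2) (S T : ℕ → SPoly) :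
    comp z m S T 1 = S 0 * (leibniz z m 0 (T 1) + leibniz z m 1 (T 0))
      + S 1 * leibniz (z - 1) (m - 1) 0 (T 0) := by
  have h1 : Finset.HasAntidiagonal.antidiagonal (1 : ℕ) = {(0, 1), (1, 0)} := rfl
  simp [comp_apply, h1, mul_add]

/-- The two leading coefficients of the supercommutator vanish, so that it lies in
`Ψ^k_ℓ(lam, p)`. -/
theorem psiCommutator_leading (lam p k : ℂ) (l : ZMod 2) (F : SPoly) (T : ℕ → SPoly) :
    psiCommutator lam p k l F T 0 = 0 ∧ psiCommutator lam p k l F T 1 = 0 := by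
  have h2 : 2 * (C (1 / 2) : ℂ[X]) = 1 := by rw [← C_ofNat, ← C_mul]; norm_num
  have hl : l = 0 ∨ l = 1 := by revert l; decide
  rcases hl with rfl | rfl
  all_goals
    constructor <;> refine TrivSqZeroExt.ext ?_ ?_ <;>
    simp only [psiCommutator_apply, Pi.sub_apply, comp_zero, comp_one, leibniz_zero,
      leibniz_one] <;>
    simp [densityOp, psiPar, smul_eq_C_mul, -one_div] <;> grind

/-- The `𝒦`-module `Ψ^k_ℓ(lam, p)` of pseudodifferential operators of degree `≤ (k, ℓ)` from
`𝔽(lam)` to `𝔽(lam + p)`, under the supercommutator action. -/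
def psiModule (lam p k : ℂ) (l : ZMod 2) : SuperAction (ℕ → SPoly) where
  par := psiPar l
  act := (psiCommutator lam p k l).compr₂ (LinearMap.funLeft ℂ SPoly (· + 2))

/-! ## Uniserial extensions -/

/-- `A` is a uniserial `𝔰`-split `(lam; p₁, …, pₙ)` extension, where `a = [2 p₁, …, 2 pₙ]`. -/
def IsUniserialSplit {V : Type*} [AddCommGroup V] [Module ℂ V] (A : SuperAction V)
    (lam : ℂ) (a : List ℤ) : Prop :=
  A.IsSplitExtension (densityChain lam a) ∧ A.Uniserial

/-- `A` is, up to a possibly odd equivalence, a subquotient of a module of pseudodifferential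
operators: `A ≅ M / N` for invariant subspaces `N ⊆ M` of some `Ψ^k_ℓ(ν, q)`. -/
def IsPsiSubquotient {V : Type*} [AddCommGroup V] [Module ℂ V] (A : SuperAction V) : Prop :=
  ∃ (ν q k : ℂ) (l : ZMod 2) (M N : Submodule ℂ (ℕ → SPoly))
    (hM : (psiModule ν q k l).Invariant M) (hN : (psiModule ν q k l).Invariant N), N ≤ M ∧
    (((psiModule ν q k l).subquotient M N hM hN).EvenEquiv A ∨
      ((psiModule ν q k l).subquotient M N hM hN).OddEquiv A)

/-- There is a uniserial `𝔰`-split `(lam; a₁/2, …, aₙ/2)` extension that is a subquotient of a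
module of pseudodifferential operators, and it is unique: every uniserial `𝔰`-split
`(lam; a₁/2, …, aₙ/2)` extension is evenly equivalent to it. -/
def UniqueUniserialPsi (lam : ℂ) (a : List ℤ) : Prop :=
  ∃ (V : Type) (_ : AddCommGroup V) (_ : Module ℂ V) (A : SuperAction V),
    IsUniserialSplit A lam a ∧ IsPsiSubquotient A ∧
    ∀ (W : Type u) [AddCommGroup W] [Module ℂ W] (B : SuperAction W),
      IsUniserialSplit B lam a → A.EvenEquiv B

end SuperLine

end

noncomputable section

namespace SuperLine

/-! An `𝔰`-split extension has a normal form: a sum of copies of `ℂ[x, ξ]` on which `𝔰` acts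
diagonally through densities (`IsGraded`, `IsSplitExtension.exists_isGraded`). Each off-diagonal
entry is then an `𝔰`-relative cochain with values in maps between two density modules. Modulo `𝔰`,
the algebra `𝒦` is generated by `ξ x²`, which has weight `3/2` and whose bracket with `ξ` lies in
`𝔰`. So the operator of `ξ x²` anticommutes with `D` and has a fixed weight, and the entry is
determined by one scalar, `coef`; it vanishes if the weights differ by less than `3/2`
(`IsRelCochain.eq_zero`, `IsGraded.entry_eq`).

Uniqueness. The element `½ x⁴` is the bracket of `ξ x²` with itself and also that of `ξ x` with `ξ
x³`. Comparing constant terms gives a Maurer–Cartan relation (`IsGraded.mcFactor_mul_coef`): a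
factor `mcFactor` times the scalar from `i` to `j` is a sum over the components between them. Where
this factor is non-zero, the long entries follow from the short ones. Uniseriality makes the three
adjacent scalars non-zero, and a diagonal rescaling gives them any prescribed non-zero values, so
the whole module is determined (`IsGraded.evenEquiv`). Conversely, non-zero adjacent scalars
together with regularity of the weights imply uniseriality (`IsGraded.uniserial`): an element of a
submodule can be lowered by `D` to a constant, raised again by `ξ x`, and carried to the next
component by `ξ x²`.

Existence. The quotient of `Ψ^k_ℓ(ν, q)` by the operators of low degree is graded, with weights
`lam, lam + 1/2, lam + 1, …` where `lam = q - k`, as long as no denominator of the conformal symbol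
map vanishes (`isGraded_psiGraded`). Its scalars between components `3`, `4` or `5` half-steps apart
have a closed form: up to non-zero factors they are the polynomials `lowNum` in `Λ = 2 lam + i` and
two constants of the module, `K = 2 q` and `S = 4 ν + 2 q - 1`. If `K` and `S` make a few of them
vanish, two spans of components become invariant and their quotient has exactly the components `0,
a, a + b, a + b + c` (`uniqueUniserialPsi_of_lowNum`). The proposition thus reduces to a choice of
`K` and `S` in each case; the exceptional values of `lam` are those for which the equations for `K`
and `S` are compatible. -/

/-! ### Rearrangement of sums over antidiagonals. -/

open Finset in
lemma sum_antidiagonal_assoc {M : Type*} [AddCommMonoid M] (n : ℕ) (f : ℕ → ℕ → ℕ → M) :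
    ∑ p ∈ antidiagonal n, ∑ q ∈ antidiagonal p.1, f q.1 q.2 p.2
      = ∑ p ∈ antidiagonal n, ∑ q ∈ antidiagonal p.2, f p.1 q.1 q.2 := by
  simp only [Finset.sum_sigma']
  refine Finset.sum_nbij' (fun x => ⟨(x.2.1, x.2.2 + x.1.2), (x.2.2, x.1.2)⟩)
    (fun x => ⟨(x.1.1 + x.2.1, x.2.2), (x.1.1, x.2.1)⟩) ?_ ?_ ?_ ?_ ?_
  all_goals
    rintro ⟨⟨a, b⟩, ⟨c, d⟩⟩ h
    simp only [mem_sigma, HasAntidiagonal.mem_antidiagonal] at h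
  · simp; omega
  · simp; omega
  · obtain ⟨h, rfl⟩ := h; rfl
  · obtain ⟨h, rfl⟩ := h; rfl
  · rfl

open Finset in
lemma sum_antidiagonal_left_comm {M : Type*} [AddCommMonoid M] (n : ℕ) (f : ℕ → ℕ → ℕ → M) :
    ∑ p ∈ antidiagonal n, ∑ q ∈ antidiagonal p.2, f p.1 q.1 q.2
      = ∑ p ∈ antidiagonal n, ∑ q ∈ antidiagonal p.2, f q.1 p.1 q.2 := by
  simp only [Finset.sum_sigma']
  refine Finset.sum_nbij' (fun x => ⟨(x.2.1, x.1.1 + x.2.2), (x.1.1, x.2.2)⟩)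
    (fun x => ⟨(x.2.1, x.1.1 + x.2.2), (x.1.1, x.2.2)⟩) ?_ ?_ ?_ ?_ ?_
  all_goals
    rintro ⟨⟨a, b⟩, ⟨c, d⟩⟩ h
    simp only [mem_sigma, HasAntidiagonal.mem_antidiagonal] at h
  · simp; omega
  · simp; omega
  · obtain ⟨h, rfl⟩ := h; rfl
  · obtain ⟨h, rfl⟩ := h; rfl
  · rfl

open Finset in
lemma sum_antidiagonal_two_mul_succ {M : Type*} [AddCommMonoid M] (h : ℕ) (f : ℕ → ℕ → M) :
    ∑ p ∈ antidiagonal (2 * h + 1), f p.1 p.2 =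
      ∑ p ∈ antidiagonal h, f (2 * p.1) (2 * p.2 + 1)
        + ∑ p ∈ antidiagonal h, f (2 * p.1 + 1) (2 * p.2) := by
  induction h generalizing f with
  | zero => simp [Nat.antidiagonal_succ]
  | succ h ih =>
    rw [show 2 * (h + 1) + 1 = (2 * h + 1) + 1 + 1 by ring, Nat.sum_antidiagonal_succ,
      Nat.sum_antidiagonal_succ, ih (fun a b => f (a + 1 + 1) b),
      Nat.sum_antidiagonal_succ, Nat.sum_antidiagonal_succ]
    simp only [mul_add, mul_zero, zero_add, mul_one]
    abel

open Finset in
lemma sum_antidiagonal_two_mul {M : Type*} [AddCommMonoid M] (h : ℕ) (f : ℕ → ℕ → M) :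
    ∑ p ∈ antidiagonal (2 * (h + 1)), f p.1 p.2 =
      ∑ p ∈ antidiagonal (h + 1), f (2 * p.1) (2 * p.2)
        + ∑ p ∈ antidiagonal h, f (2 * p.1 + 1) (2 * p.2 + 1) := by
  rw [show 2 * (h + 1) = (2 * h + 1) + 1 by ring, Nat.sum_antidiagonal_succ,
    sum_antidiagonal_two_mul_succ h (fun a b => f (a + 1) b), Nat.sum_antidiagonal_succ]
  simp only [mul_add, mul_zero, mul_one]
  abel


/-! ### Generalized binomial coefficients. -/

lemma genBinom_eq_choose (z : ℂ) (n : ℕ) : genBinom z n = Ring.choose z n := by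
  have h : ∀ n : ℕ, (descPochhammer ℤ n).smeval z = ∏ i ∈ Finset.range n, (z - i) := by
    intro n
    induction n with
    | zero => simp
    | succ n ih =>
      rw [descPochhammer_succ_right, smeval_mul, ih, Finset.prod_range_succ, smeval_sub,
        smeval_X, smeval_natCast]
      simp
  rw [Ring.choose_eq_smul, genBinom, h, smul_eq_mul, div_eq_inv_mul]

lemma genBinom_succ_succ (z : ℂ) (n : ℕ) :
    genBinom (z + 1) (n + 1) = genBinom z n + genBinom z (n + 1) := by
  simp only [genBinom_eq_choose, Ring.choose_succ_succ]

lemma genBinom_add (x y : ℂ) (n : ℕ) :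
    genBinom (x + y) n = ∑ p ∈ Finset.HasAntidiagonal.antidiagonal n, genBinom x p.1 * genBinom y p.2 := by
  simp only [genBinom_eq_choose, Ring.add_choose_eq n (Commute.all x y)]

/-- Falling factorials concatenate. This identity is what reconciles the Leibniz rule of `∂ₓ^w` with
the ordinary product rule for `∂ₓ^h (F G)`. -/
lemma genBinom_mul_genBinom_sub (x : ℂ) (i j : ℕ) :
    genBinom x i * genBinom (x - i) j = genBinom x (i + j) * ((i + j).choose i : ℂ) := by
  have h : ((i + j).choose i : ℂ) = (i + j).factorial / (i.factorial * j.factorial) := by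
    rw [Nat.cast_choose ℂ (Nat.le_add_right i j), Nat.add_sub_cancel_left]
  have h1 : (i.factorial : ℂ) ≠ 0 := Nat.cast_ne_zero.2 i.factorial_ne_zero
  have h2 : (j.factorial : ℂ) ≠ 0 := Nat.cast_ne_zero.2 j.factorial_ne_zero
  have h3 : ((i + j).factorial : ℂ) ≠ 0 := Nat.cast_ne_zero.2 (i + j).factorial_ne_zero
  rw [h, genBinom, genBinom, genBinom, Finset.prod_range_add]
  simp only [Nat.cast_add, sub_sub]
  field_simp

/-! ### The even part of the Leibniz rule -/

lemma dx_mul (F G : SPoly) : dx (F * G) = dx F * G + F * dx G := by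
  refine TrivSqZeroExt.ext ?_ ?_ <;> simp <;> ring

lemma eps_mul (F G : SPoly) : eps (F * G) = eps F * eps G := by
  refine TrivSqZeroExt.ext ?_ ?_ <;> simp <;> ring

lemma opDbar_mul (F G : SPoly) : opDbar (F * G) = opDbar F * G + eps F * opDbar G := by
  refine TrivSqZeroExt.ext ?_ ?_ <;> (simp; ring)

lemma eps_eps (F : SPoly) : eps (eps F) = F := by
  refine TrivSqZeroExt.ext ?_ ?_ <;> simp

lemma eps_opDbar (F : SPoly) : eps (opDbar F) = -opDbar (eps F) := by
  refine TrivSqZeroExt.ext ?_ ?_ <;> simp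

lemma opDbar_opDbar (F : SPoly) : opDbar (opDbar F) = -dx F := by
  refine TrivSqZeroExt.ext ?_ ?_ <;> simp

lemma dx_eps (F : SPoly) : dx (eps F) = eps (dx F) := by
  refine TrivSqZeroExt.ext ?_ ?_ <;> simp

lemma dx_opDbar (F : SPoly) : dx (opDbar F) = opDbar (dx F) := by
  refine TrivSqZeroExt.ext ?_ ?_ <;> simp

lemma dx_pow_eps (n : ℕ) (F : SPoly) :
    (dx ^ n : Module.End ℂ SPoly) (eps F) = eps ((dx ^ n : Module.End ℂ SPoly) F) := by
  induction n generalizing F with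
  | zero => simp
  | succ n ih => rw [pow_succ, Module.End.mul_apply, Module.End.mul_apply, dx_eps, ih]

lemma dx_pow_opDbar (n : ℕ) (F : SPoly) :
    (dx ^ n : Module.End ℂ SPoly) (opDbar F) = opDbar ((dx ^ n : Module.End ℂ SPoly) F) := by
  induction n generalizing F with
  | zero => simp
  | succ n ih => rw [pow_succ, Module.End.mul_apply, Module.End.mul_apply, dx_opDbar, ih]

lemma dx_pow_mul (n : ℕ) (F G : SPoly) : (dx ^ n : Module.End ℂ SPoly) (F * G) =
    ∑ p ∈ Finset.HasAntidiagonal.antidiagonal n, (n.choose p.1 : ℂ) •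
      ((dx ^ p.1 : Module.End ℂ SPoly) F * (dx ^ p.2 : Module.End ℂ SPoly) G) := by
  induction n with
  | zero => simp
  | succ n ih =>
    simp only [Nat.cast_smul_eq_nsmul ℂ]
    rw [Finset.sum_antidiagonal_choose_succ_nsmul (fun i j =>
      (dx ^ i : Module.End ℂ SPoly) F * (dx ^ j : Module.End ℂ SPoly) G) n, pow_succ',
      Module.End.mul_apply, ih, map_sum, ← Finset.sum_add_distrib]
    refine Finset.sum_congr rfl fun p hp => ?_
    have hs : n.choose p.2 = n.choose p.1 := by
      rw [Finset.HasAntidiagonal.mem_antidiagonal] at hp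
      subst hp
      exact (Nat.choose_symm_add).symm
    rw [map_smul, dx_mul, Nat.cast_smul_eq_nsmul ℂ, hs, ← smul_add, pow_succ', pow_succ',
      Module.End.mul_apply, Module.End.mul_apply, add_comm]

/-- The operators `(-1)^h (w choose h) ∂ₓ^h`, the coefficients of the Leibniz rule of
`e^{iπw} ∂ₓ^w`. -/
def leibnizEven (w : ℂ) (h : ℕ) : Module.End ℂ SPoly :=
  ((-1) ^ h * genBinom w h) • (dx ^ h : Module.End ℂ SPoly)

lemma leibnizEven_mul (w : ℂ) (h : ℕ) (F G : SPoly) : leibnizEven w h (F * G) =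
    ∑ p ∈ Finset.HasAntidiagonal.antidiagonal h, leibnizEven w p.1 F * leibnizEven (w - p.1) p.2 G := by
  simp only [leibnizEven, LinearMap.smul_apply, dx_pow_mul, Finset.smul_sum, smul_mul_smul_comm,
    smul_smul]
  refine Finset.sum_congr rfl fun p hp => ?_
  rw [Finset.HasAntidiagonal.mem_antidiagonal] at hp
  subst hp
  congr 1
  rw [mul_assoc, ← genBinom_mul_genBinom_sub, pow_add]
  ring

/-- The Chu–Vandermonde identity: the Leibniz rule respects `∂ₓ^w ∂ₓ^w' = ∂ₓ^(w + w')`. -/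
lemma leibnizEven_add (w w' : ℂ) (h : ℕ) : leibnizEven (w + w') h =
    ∑ p ∈ Finset.HasAntidiagonal.antidiagonal h, leibnizEven w p.1 * leibnizEven w' p.2 := by
  rw [leibnizEven, genBinom_add, Finset.mul_sum, Finset.sum_smul]
  refine Finset.sum_congr rfl fun p hp => ?_
  rw [Finset.HasAntidiagonal.mem_antidiagonal] at hp
  subst hp
  rw [leibnizEven, leibnizEven, smul_mul_smul_comm, pow_add, pow_add]
  congr 1
  ring

/-- Pascal's rule. It is needed when two odd symbols are multiplied, because `D̄² = -∂ₓ` raises the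
exponent by one. -/
lemma leibnizEven_succ (w : ℂ) (h : ℕ) :
    leibnizEven (w + 1) (h + 1) = leibnizEven w (h + 1) - dx * leibnizEven w h := by
  rw [leibnizEven, genBinom_succ_succ, leibnizEven, leibnizEven, mul_smul_comm, ← pow_succ',
    pow_succ (-1 : ℂ)]
  module

lemma leibnizEven_succ_apply (w : ℂ) (h : ℕ) (F : SPoly) :
    leibnizEven (w + 1) (h + 1) F = leibnizEven w (h + 1) F - leibnizEven w h (dx F) := by
  have : dx * leibnizEven w h = leibnizEven w h * dx := by
    rw [leibnizEven, mul_smul_comm, smul_mul_assoc, ← pow_succ, ← pow_succ']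
  rw [leibnizEven_succ, this]; rfl

lemma leibnizEven_eps (w : ℂ) (h : ℕ) (F : SPoly) :
    leibnizEven w h (eps F) = eps (leibnizEven w h F) := by
  simp [leibnizEven, dx_pow_eps]

lemma leibnizEven_opDbar (w : ℂ) (h : ℕ) (F : SPoly) :
    leibnizEven w h (opDbar F) = opDbar (leibnizEven w h F) := by
  simp [leibnizEven, dx_pow_opDbar]

lemma leibniz_even_even (z : ℂ) (h : ℕ) (F : SPoly) :
    leibniz z 0 (2 * h) F = leibnizEven (z / 2) h F := by
  simp [leibniz, leibnizEven]

lemma leibniz_even_odd (z : ℂ) (h : ℕ) (F : SPoly) : leibniz z 0 (2 * h + 1) F = 0 := by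
  simp [leibniz]

lemma leibniz_odd_even (z : ℂ) (h : ℕ) (F : SPoly) :
    leibniz z 1 (2 * h) F = leibnizEven ((z - 1) / 2) h (eps F) := by
  simp [leibniz, leibnizEven]

lemma leibniz_odd_odd (z : ℂ) (h : ℕ) (F : SPoly) :
    leibniz z 1 (2 * h + 1) F = leibnizEven ((z - 1) / 2) h (opDbar F) := by
  have : (2 * h + 1) / 2 = h := by omega
  simp [leibniz, leibnizEven, this]


/-! ### The Leibniz rule for products and for composed symbols; associativity. -/

open Finset.HasAntidiagonal (antidiagonal)

/-- Moving a symbol past `F G` is the same as moving it past `F` and then past `G`. For `m = 0` only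
even steps occur and this is `leibnizEven_mul`; for `m = 1` the odd steps come from the twisted
product rule of `D̄`. -/
theorem leibniz_mul (z : ℂ) (m : ZMod 2) (n : ℕ) (F G : SPoly) : leibniz z m n (F * G) =
    ∑ p ∈ antidiagonal n, leibniz z m p.1 F * leibniz (z - p.1) (m - p.1) p.2 G := by
  have he : ∀ i : ℕ, ((2 * i : ℕ) : ZMod 2) = 0 := fun i => by
    rw [Nat.cast_mul]; exact mul_eq_zero_of_left rfl _
  have hw : ∀ i : ℕ, (z - (2 * i : ℕ)) / 2 = z / 2 - i := fun i => by push_cast; ring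
  have hw' : ∀ i : ℕ, (z - (2 * i : ℕ) - 1) / 2 = (z - 1) / 2 - i := fun i => by push_cast; ring
  have hw'' : ∀ i : ℕ, (z - (2 * i + 1 : ℕ)) / 2 = (z - 1) / 2 - i := fun i => by push_cast; ring
  have hm : m = 0 ∨ m = 1 := by revert m; decide
  have ho : ∀ i : ℕ, (1 : ZMod 2) - ((2 * i + 1 : ℕ) : ZMod 2) = 0 := fun i => by
    rw [Nat.cast_add, he]; rfl
  obtain ⟨h, rfl | rfl⟩ : ∃ h, n = 2 * h ∨ n = 2 * h + 1 := ⟨n / 2, by omega⟩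
  · cases h with
    | zero =>
      rcases hm with rfl | rfl <;> simp [leibniz_zero, eps_mul]
    | succ h =>
      rw [sum_antidiagonal_two_mul h (fun a b => leibniz z m a F * leibniz (z - a) (m - a) b G)]
      rcases hm with rfl | rfl
      · simp only [leibniz_even_even, leibniz_even_odd, he, sub_zero, hw, zero_mul,
          Finset.sum_const_zero, add_zero, leibnizEven_mul]
      · simp only [leibniz_odd_even, he, sub_zero, hw', ho, leibniz_even_odd, mul_zero,
          Finset.sum_const_zero, add_zero, eps_mul, leibnizEven_mul]
  · rw [sum_antidiagonal_two_mul_succ h (fun a b => leibniz z m a F * leibniz (z - a) (m - a) b G)]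
    rcases hm with rfl | rfl
    · simp only [leibniz_even_even, leibniz_even_odd, he, sub_zero, zero_mul, mul_zero,
        Finset.sum_const_zero, add_zero]
    · simp only [leibniz_odd_even, leibniz_odd_odd, he, sub_zero, hw', hw'', ho, leibniz_even_even,
        opDbar_mul, map_add, leibnizEven_mul]
      rw [add_comm]

/-- The Leibniz rule is compatible with the product of symbols `D̄^z_m D̄^{z'}_{m'}`. Together with
`leibniz_mul` this is all that associativity of composition requires. -/
theorem leibniz_add (z z' : ℂ) (m m' : ZMod 2) (n : ℕ) (F : SPoly) :
    leibniz (z + z') (m + m') n F =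
      ∑ p ∈ antidiagonal n, leibniz z m p.1 (leibniz z' m' p.2 F) := by
  have hm : m = 0 ∨ m = 1 := by revert m; decide
  have hm' : m' = 0 ∨ m' = 1 := by revert m'; decide
  have h00 : ∀ h : ℕ, ∀ w w' : ℂ, ∀ F, leibnizEven (w + w') h F =
      ∑ p ∈ antidiagonal h, leibnizEven w p.1 (leibnizEven w' p.2 F) := by
    intro h w w' F
    rw [leibnizEven_add, LinearMap.sum_apply]; rfl
  have h1 : (z + z') / 2 = z / 2 + z' / 2 := by ring
  have h2 : (z + z' - 1) / 2 = z / 2 + (z' - 1) / 2 := by ring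
  have h3 : (z + z' - 1) / 2 = (z - 1) / 2 + z' / 2 := by ring
  have h4 : (z + z') / 2 = (z - 1) / 2 + (z' - 1) / 2 + 1 := by ring
  have h11 : (1 + 1 : ZMod 2) = 0 := rfl
  obtain ⟨h, rfl | rfl⟩ : ∃ h, n = 2 * h ∨ n = 2 * h + 1 := ⟨n / 2, by omega⟩
  · cases h with
    | zero =>
      rcases hm with rfl | rfl <;> rcases hm' with rfl | rfl <;>
        simp [leibniz_zero, h11, eps_eps]
    | succ h =>
      rw [sum_antidiagonal_two_mul h (fun a b => leibniz z m a (leibniz z' m' b F))]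
      rcases hm with rfl | rfl <;> rcases hm' with rfl | rfl
      · simp only [add_zero, leibniz_even_even, leibniz_even_odd, map_zero,
          Finset.sum_const_zero, h1, h00]
      · simp only [zero_add, leibniz_even_even, leibniz_odd_even, leibniz_even_odd,
          Finset.sum_const_zero, h2, h00, add_zero]
      · simp only [add_zero, leibniz_even_even, leibniz_odd_even, leibniz_even_odd, map_zero,
          Finset.sum_const_zero, h3, h00, leibnizEven_eps]
      -- Both symbols are odd: the pairs of odd steps contribute `D̄² = -∂ₓ`, which is the second
      -- summand of Pascal's rule.
      · simp only [h11, leibniz_even_even, leibniz_odd_even, leibniz_odd_odd, h4,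
          leibnizEven_succ_apply, leibnizEven_eps, eps_eps, ← leibnizEven_opDbar,
          opDbar_opDbar, map_neg, Finset.sum_neg_distrib, ← sub_eq_add_neg]
        simp only [h00]
  · rw [sum_antidiagonal_two_mul_succ h (fun a b => leibniz z m a (leibniz z' m' b F))]
    rcases hm with rfl | rfl <;> rcases hm' with rfl | rfl
    · simp only [add_zero, leibniz_even_even, leibniz_even_odd, map_zero, Finset.sum_const_zero]
    · simp only [zero_add, leibniz_even_even, leibniz_odd_odd, leibniz_even_odd,
          Finset.sum_const_zero, h2, h00, add_zero]
    · simp only [add_zero, zero_add, leibniz_even_even, leibniz_odd_odd, leibniz_even_odd, map_zero,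
          Finset.sum_const_zero, h3, h00, leibnizEven_opDbar]
    -- The two sums cancel because `D̄` anticommutes with `ε`.
    · simp only [h11, leibniz_even_odd, leibniz_odd_even, leibniz_odd_odd, leibnizEven_eps,
        leibnizEven_opDbar, eps_opDbar, map_neg, Finset.sum_neg_distrib, neg_add_cancel]

/-- Both sides expand into the same fourfold sum: on the left the first symbol passes a product
(`leibniz_mul`), on the right a product of two symbols passes a function (`leibniz_add`). -/
theorem comp_assoc (z z' : ℂ) (m m' : ZMod 2) (S T U : ℕ → SPoly) :
    comp z m S (comp z' m' T U) = comp (z + z') (m + m') (comp z m S T) U := by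
  funext n
  -- The common summand: `b` steps of the first symbol are spent on `T j`, and `y` is shared by the
  -- steps of both symbols on `U` and the index of `U`.
  let G : ℕ → ℕ → ℕ → ℕ → SPoly := fun i b j y => ∑ p ∈ antidiagonal y, ∑ q ∈ antidiagonal p.1,
    S i * leibniz (z - i) (m - i) b (T j) *
      leibniz (z - i - b) (m - i - b) q.1 (leibniz (z' - j) (m' - j) q.2 (U p.2))
  have hL : comp z m S (comp z' m' T U) n = ∑ p ∈ antidiagonal n, ∑ q ∈ antidiagonal p.2,
      ∑ r ∈ antidiagonal q.2, G p.1 q.1 r.1 r.2 := by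
    rw [comp_apply]
    refine Finset.sum_congr rfl fun p _ => ?_
    let H : ℕ → ℕ → ℕ → SPoly := fun b b2 n' => ∑ q ∈ antidiagonal n', ∑ r ∈ antidiagonal q.2,
      S p.1 * (leibniz (z - p.1) (m - p.1) b (T q.1) *
        leibniz (z - p.1 - b) (m - p.1 - b) b2 (leibniz (z' - q.1) (m' - q.1) r.1 (U r.2)))
    have h1 : ∀ q : ℕ × ℕ, S p.1 * leibniz (z - p.1) (m - p.1) q.1 (comp z' m' T U q.2)
        = ∑ r ∈ antidiagonal q.1, H r.1 r.2 q.2 := by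
      intro q
      simp only [comp_apply, map_sum, leibniz_mul, Finset.mul_sum, H]
      rw [Finset.sum_congr rfl fun q' _ => Finset.sum_comm, Finset.sum_comm]
    rw [Finset.sum_congr rfl fun q _ => h1 q, sum_antidiagonal_assoc p.2 H]
    refine Finset.sum_congr rfl fun q _ => ?_
    simp only [H, G]
    rw [sum_antidiagonal_left_comm q.2 (fun b2 j r' => ∑ r ∈ antidiagonal r',
      S p.1 * (leibniz (z - p.1) (m - p.1) q.1 (T j) *
        leibniz (z - p.1 - q.1) (m - p.1 - q.1) b2 (leibniz (z' - j) (m' - j) r.1 (U r.2))))]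
    refine Finset.sum_congr rfl fun r _ => ?_
    rw [sum_antidiagonal_assoc r.2 (fun b2 c k => S p.1 * leibniz (z - p.1) (m - p.1) q.1 (T r.1) *
      leibniz (z - p.1 - q.1) (m - p.1 - q.1) b2 (leibniz (z' - r.1) (m' - r.1) c (U k)))]
    simp only [mul_assoc]
  have hR : comp (z + z') (m + m') (comp z m S T) U n = ∑ p ∈ antidiagonal n,
      ∑ q ∈ antidiagonal p.1, ∑ r ∈ antidiagonal q.2, G q.1 r.1 r.2 p.2 := by
    rw [comp_apply]
    refine Finset.sum_congr rfl fun p _ => ?_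
    simp only [comp_apply, Finset.sum_mul, G]
    rw [Finset.sum_comm]
    refine Finset.sum_congr rfl fun q hq => ?_
    rw [Finset.sum_comm]
    refine Finset.sum_congr rfl fun r hr => Finset.sum_congr rfl fun s _ => ?_
    rw [Finset.HasAntidiagonal.mem_antidiagonal] at hq hr
    rw [← Finset.mul_sum, ← leibniz_add]
    have e1 : z + z' - (p.1 : ℂ) = z - q.1 - r.1 + (z' - r.2) := by
      rw [← hq, ← hr]; push_cast; ring
    have e2 : m + m' - (p.1 : ZMod 2) = m - q.1 - r.1 + (m' - r.2) := by
      rw [← hq, ← hr]; push_cast; ring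
    rw [e1, e2]
  rw [hL, hR, sum_antidiagonal_assoc n (fun i r1 y => ∑ r ∈ antidiagonal r1, G i r.1 r.2 y)]
  refine Finset.sum_congr rfl fun p _ => ?_
  rw [sum_antidiagonal_assoc p.2 (fun b j y => G p.1 b j y)]

open Finset.HasAntidiagonal (antidiagonal)

/-! ## The pseudodifferential operators form a representation -/

/-- The inclusion of `Ψ^k` into `Ψ^{k+1}` on coefficient sequences. -/
def shiftUp : (ℕ → SPoly) →ₗ[ℂ] (ℕ → SPoly) :=
  LinearMap.pi fun n =>
    match n with
    | 0 => 0
    | 1 => 0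
    | n + 2 => LinearMap.proj n

@[simp] lemma shiftUp_zero (T : ℕ → SPoly) : shiftUp T 0 = 0 := rfl
@[simp] lemma shiftUp_one (T : ℕ → SPoly) : shiftUp T 1 = 0 := rfl
@[simp] lemma shiftUp_add_two (T : ℕ → SPoly) (n : ℕ) : shiftUp T (n + 2) = T n := rfl

lemma shiftUp_injective : Function.Injective shiftUp := fun S T h => by
  funext n
  simpa using congrFun h (n + 2)

lemma comp_shiftUp_right (z : ℂ) (m : ZMod 2) (S T : ℕ → SPoly) :
    comp z m S (shiftUp T) = shiftUp (comp z m S T) := by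
  have key : ∀ (f : ℕ → SPoly → SPoly) (hf : ∀ b, f b 0 = 0) (T : ℕ → SPoly) (n : ℕ),
      ∑ p ∈ antidiagonal n, f p.1 (shiftUp T p.2)
        = shiftUp (fun r => ∑ p ∈ antidiagonal r, f p.1 (T p.2)) n := by
    intro f hf T n
    match n with
    | 0 => simp [hf]
    | 1 => simp [hf, Finset.Nat.antidiagonal_succ]
    | n + 2 => simp [hf, Finset.Nat.sum_antidiagonal_succ']
  funext n
  rw [comp_apply]
  have h := key (fun i x => x) (fun _ => rfl)
  rw [Finset.sum_congr rfl (g := fun p : ℕ × ℕ => (fun i (x : SPoly) => x) p.1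
    (∑ q ∈ antidiagonal p.2, S p.1 * leibniz (z - p.1) (m - p.1) q.1 (shiftUp T q.2)))
    (fun p _ => rfl)]
  have h1 : ∀ (i : ℕ) (r : ℕ), ∑ q ∈ antidiagonal r,
      S i * leibniz (z - i) (m - i) q.1 (shiftUp T q.2) =
      shiftUp (fun r => ∑ q ∈ antidiagonal r, S i * leibniz (z - i) (m - i) q.1 (T q.2)) r :=
    fun i r => key (fun b x => S i * leibniz (z - i) (m - i) b x) (fun b => by simp) T r
  simp only [h1]
  match n with
  | 0 => simp
  | 1 => simp [Finset.Nat.antidiagonal_succ]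
  | n + 2 => simp [Finset.Nat.sum_antidiagonal_succ', comp_apply]

/-- Renumbering the left factor changes the exponents that enter its Leibniz coefficients, so the
nominal degree must rise by two to compensate; the parity index is unaffected modulo two. -/
lemma comp_shiftUp_left (z : ℂ) (m : ZMod 2) (S T : ℕ → SPoly) :
    comp (z + 2) m (shiftUp S) T = shiftUp (comp z m S T) := by
  have h2 : (1 + 1 : ZMod 2) = 0 := rfl
  funext n
  rw [comp_apply]
  match n with
  | 0 => simp
  | 1 => simp [Finset.Nat.antidiagonal_succ]
  | n + 2 =>
    simp only [Finset.Nat.sum_antidiagonal_succ, shiftUp_add_two, comp_apply, shiftUp_zero,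
      shiftUp_one, zero_mul, Finset.sum_const_zero, zero_add]
    refine Finset.sum_congr rfl fun p _ => Finset.sum_congr rfl fun q _ => ?_
    have e1 : z + 2 - ((p.1 + 1 + 1 : ℕ) : ℂ) = z - p.1 := by push_cast; ring
    have e2 : m - ((p.1 + 1 + 1 : ℕ) : ZMod 2) = m - p.1 := by
      push_cast; rw [add_assoc, h2, add_zero]
    rw [e1, e2]

lemma psiCommutator_eq_shiftUp (lam p k : ℂ) (l : ZMod 2) (F : SPoly) (T : ℕ → SPoly) :
    psiCommutator lam p k l F T = shiftUp ((psiModule lam p k l).act F T) := by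
  obtain ⟨h0, h1⟩ := psiCommutator_leading lam p k l F T
  funext n
  match n with
  | 0 => exact h0
  | 1 => exact h1
  | n + 2 => rfl

lemma psiPar_shiftUp (l : ZMod 2) (T : ℕ → SPoly) :
    psiPar l (shiftUp T) = shiftUp (psiPar l T) := by
  have h2 : (1 + 1 : ZMod 2) = 0 := rfl
  funext n
  match n with
  | 0 => simp [psiPar]
  | 1 => simp [psiPar]
  | n + 2 =>
    have e2 : l - ((n + 2 : ℕ) : ZMod 2) = l - n := by
      rw [show n + 2 = n + 1 + 1 from rfl]
      push_cast; rw [add_assoc, h2, add_zero]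
    simp only [psiPar, LinearMap.pi_apply, e2, LinearMap.comp_apply, LinearMap.proj_apply,
      shiftUp_add_two]

lemma psiCommutator_shiftUp (lam p k : ℂ) (l : ZMod 2) (F : SPoly) (T : ℕ → SPoly) :
    psiCommutator lam p (k + 1) l F (shiftUp T) = shiftUp (psiCommutator lam p k l F T) := by
  simp only [psiCommutator_apply, psiPar_shiftUp, map_sub, comp_shiftUp_right, mul_add, mul_one,
    comp_shiftUp_left]

/-! ### Parity -/

/-- The sign character of `ℤ/2`. -/
def sign (m : ZMod 2) : ℂ := if m = 0 then 1 else -1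

lemma sign_add (a b : ZMod 2) : sign (a + b) = sign a * sign b := by
  have h : ∀ m : ZMod 2, m = 0 ∨ m = 1 := by decide
  have h2 : (1 + 1 : ZMod 2) = 0 := rfl
  rcases h a with rfl | rfl <;> rcases h b with rfl | rfl <;> simp [sign, h2]

lemma sign_mul_self (a : ZMod 2) : sign a * sign a = 1 := by
  unfold sign; split_ifs <;> norm_num

lemma sign_neg (a : ZMod 2) : sign (-a) = sign a := by simp [sign]

lemma sign_sub (a b : ZMod 2) : sign (a - b) = sign a * sign b := by
  rw [sub_eq_add_neg, sign_add, sign_neg]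

lemma psiPar_apply (l : ZMod 2) (T : ℕ → SPoly) (j : ℕ) :
    psiPar l T j = sign (l - j) • eps (T j) := by
  simp only [psiPar, sign, LinearMap.pi_apply]
  split_ifs <;> simp

lemma psiPar_psiPar (l : ZMod 2) (T : ℕ → SPoly) : psiPar l (psiPar l T) = T := by
  funext j
  rw [psiPar_apply, psiPar_apply, map_smul, smul_smul, sign_mul_self, one_smul, eps_eps]

lemma eps_leibniz (z : ℂ) (m : ZMod 2) (b : ℕ) (F : SPoly) :
    eps (leibniz z m b F) = sign b • leibniz z m b (eps F) := by
  have he : ∀ i : ℕ, ((2 * i : ℕ) : ZMod 2) = 0 := fun i => by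
    rw [Nat.cast_mul]; exact mul_eq_zero_of_left rfl _
  have hm : m = 0 ∨ m = 1 := by revert m; decide
  obtain ⟨h, rfl | rfl⟩ : ∃ h, b = 2 * h ∨ b = 2 * h + 1 := ⟨b / 2, by omega⟩
  · rcases hm with rfl | rfl
    · simp [leibniz_even_even, sign, leibnizEven_eps, he]
    · simp [leibniz_odd_even, sign, leibnizEven_eps, he]
  · rcases hm with rfl | rfl
    · simp [leibniz_even_odd]
    · rw [leibniz_odd_odd, leibniz_odd_odd, ← leibnizEven_eps, eps_opDbar, Nat.cast_add, he]
      simp [sign]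

/-- Each step of the Leibniz rule changes the parity of the function (`eps_leibniz`) and lowers the
index of the symbol by one; the two signs cancel. -/
lemma psiPar_comp (z : ℂ) (m m' : ZMod 2) (S T : ℕ → SPoly) :
    psiPar (m + m') (comp z m S T) = comp z m (psiPar m S) (psiPar m' T) := by
  funext n
  rw [psiPar_apply, comp_apply, comp_apply, map_sum, Finset.smul_sum]
  refine Finset.sum_congr rfl fun p hp => ?_
  rw [map_sum, Finset.smul_sum]
  refine Finset.sum_congr rfl fun q hq => ?_
  rw [Finset.HasAntidiagonal.mem_antidiagonal] at hp hq
  rw [psiPar_apply, psiPar_apply, map_smul, smul_mul_smul_comm, eps_mul, eps_leibniz,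
    mul_smul_comm, smul_smul]
  congr 1
  rw [← hp, ← hq, Nat.cast_add, Nat.cast_add]
  simp only [sign_sub, sign_add]
  linear_combination (sign m * sign m' * sign p.1 * sign q.2) * sign_mul_self (q.1 : ZMod 2)

lemma opD_eps (F : SPoly) : opD (eps F) = -eps (opD F) := by
  refine TrivSqZeroExt.ext ?_ ?_ <;> simp

lemma psiPar_densityOp (lam : ℂ) (F : SPoly) :
    psiPar 0 (densityOp lam F) = densityOp lam (eps F) := by
  funext j
  rw [psiPar_apply]
  match j with
  | 0 => simp [densityOp, sign]
  | 1 => simp [densityOp, sign, opD_eps]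
  | 2 =>
    have : ((2 : ℕ) : ZMod 2) = 0 := rfl
    simp only [densityOp, LinearMap.pi_apply, this]
    simp [sign, dx_eps]
  | n + 3 => simp [densityOp]

lemma evenPart_eps (F : SPoly) : evenPart (eps F) = evenPart F := by
  refine TrivSqZeroExt.ext ?_ ?_ <;> simp
lemma oddPart_eps (F : SPoly) : oddPart (eps F) = -oddPart F := by
  refine TrivSqZeroExt.ext ?_ ?_ <;> simp
lemma eps_evenPart (F : SPoly) : eps (evenPart F) = evenPart F := by
  refine TrivSqZeroExt.ext ?_ ?_ <;> simp
lemma eps_oddPart (F : SPoly) : eps (oddPart F) = -oddPart F := by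
  refine TrivSqZeroExt.ext ?_ ?_ <;> simp
lemma evenPart_add_oddPart (F : SPoly) : evenPart F + oddPart F = F := by
  refine TrivSqZeroExt.ext ?_ ?_ <;> simp
lemma evenPart_evenPart (F : SPoly) : evenPart (evenPart F) = evenPart F := by
  refine TrivSqZeroExt.ext ?_ ?_ <;> simp
lemma evenPart_oddPart (F : SPoly) : evenPart (oddPart F) = 0 := by
  refine TrivSqZeroExt.ext ?_ ?_ <;> simp
lemma oddPart_evenPart (F : SPoly) : oddPart (evenPart F) = 0 := by
  refine TrivSqZeroExt.ext ?_ ?_ <;> simp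
lemma oddPart_oddPart (F : SPoly) : oddPart (oddPart F) = oddPart F := by
  refine TrivSqZeroExt.ext ?_ ?_ <;> simp

lemma psiPar_psiCommutator (lam p k : ℂ) (l : ZMod 2) (F : SPoly) (T : ℕ → SPoly) :
    psiPar l (psiCommutator lam p k l F T) = psiCommutator lam p k l (eps F) (psiPar l T) := by
  have h1 := psiPar_comp 2 0 l (densityOp (lam + p) F) T
  have h2 := psiPar_comp (2 * k) l 0 T (densityOp lam (evenPart F))
  have h3 := psiPar_comp (2 * k) l 0 (psiPar l T) (densityOp lam (oddPart F))
  rw [zero_add] at h1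
  rw [add_zero] at h2 h3
  rw [psiCommutator_apply, psiCommutator_apply, map_sub, map_sub, h1, h2, h3]
  simp only [psiPar_densityOp, psiPar_psiPar, evenPart_eps, oddPart_eps, eps_evenPart, eps_oddPart]

/-! ### The bracket of differential operators of order at most one -/

lemma genBinom_one_right (z : ℂ) : genBinom z 1 = z := by simp [genBinom]

lemma genBinom_one_add_two (h : ℕ) : genBinom 1 (h + 2) = 0 := by
  have := genBinom_mul_genBinom_sub 1 2 h
  have h2 : genBinom 1 2 = 0 := by simp [genBinom, Finset.prod_range_succ]
  rw [h2, zero_mul] at this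
  have hc : (((2 + h).choose 2 : ℕ) : ℂ) ≠ 0 :=
    Nat.cast_ne_zero.2 (Nat.choose_pos (Nat.le_add_right 2 h)).ne'
  rw [add_comm]
  exact (mul_eq_zero.1 this.symm).resolve_right hc

lemma genBinom_zero_succ (h : ℕ) : genBinom 0 (h + 1) = 0 := by
  simp [genBinom, Finset.prod_range_succ']

/-- As `D̄² = -∂ₓ` is a differential operator, its Leibniz series stops: `D̄² ∘ F = F D̄² - F'`. -/
lemma sum_leibniz_two (T : ℕ → SPoly) (n : ℕ) :
    ∑ q ∈ antidiagonal n, leibniz 2 0 q.1 (T q.2) = T n - shiftUp (fun j => dx (T j)) n := by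
  have h0 : ∀ F, leibniz 2 0 0 F = F := fun F => by simp [leibniz_zero]
  have h1 : ∀ F, leibniz 2 0 1 F = 0 := fun F => by simp [leibniz_one]
  have h2 : ∀ F, leibniz 2 0 2 F = -dx F := fun F => by
    have := leibniz_even_even 2 1 F
    simpa [leibnizEven, genBinom_one_right] using this
  have h3 : ∀ n F, leibniz 2 0 (n + 3) F = 0 := fun n F => by
    obtain ⟨h, rfl | rfl⟩ : ∃ h, n = 2 * h ∨ n = 2 * h + 1 := ⟨n / 2, by omega⟩
    · exact leibniz_even_odd 2 (h + 1) F
    · have := leibniz_even_even 2 (h + 2) F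
      rw [show 2 * (h + 2) = 2 * h + 1 + 3 by ring] at this
      simpa [leibnizEven, genBinom_one_add_two] using this
  match n with
  | 0 => simp [h0]
  | 1 => simp [h0, h1, Finset.Nat.antidiagonal_succ]
  | n + 2 =>
    rw [Finset.Nat.sum_antidiagonal_succ, Finset.Nat.sum_antidiagonal_succ]
    rw [Finset.sum_eq_single_of_mem (0, n) (by simp)]
    · simp [h0, h1, h2, sub_eq_add_neg]
    · rintro ⟨a, b⟩ _ hne
      cases a with
      | zero => simp_all
      | succ a => exact h3 a _

lemma sum_leibniz_one (T : ℕ → SPoly) (n : ℕ) :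
    ∑ q ∈ antidiagonal (n + 1), leibniz 1 1 q.1 (T q.2) = eps (T (n + 1)) + opDbar (T n) := by
  have h0 : ∀ F, leibniz 1 1 0 F = eps F := fun F => by simp [leibniz_zero]
  have h1 : ∀ F, leibniz 1 1 1 F = opDbar F := fun F => by simp [leibniz_one]
  have h3 : ∀ n F, leibniz 1 1 (n + 2) F = 0 := fun n F => by
    obtain ⟨h, rfl | rfl⟩ : ∃ h, n = 2 * h ∨ n = 2 * h + 1 := ⟨n / 2, by omega⟩
    · have := leibniz_odd_even 1 (h + 1) F
      rw [mul_add] at this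
      simpa [leibnizEven, genBinom_zero_succ] using this
    · have := leibniz_odd_odd 1 (h + 1) F
      rw [mul_add, add_right_comm] at this
      simpa [leibnizEven, genBinom_zero_succ] using this
  rw [Finset.Nat.sum_antidiagonal_succ, Finset.sum_eq_single_of_mem (0, n) (by simp)]
  · simp [h0, h1]
  · rintro ⟨a, b⟩ _ hne
    cases a with
    | zero => simp_all
    | succ a => exact h3 a _

lemma sum_leibniz_zero (T : ℕ → SPoly) (n : ℕ) :
    ∑ q ∈ antidiagonal n, leibniz 0 0 q.1 (T q.2) = T n := by
  have h0 : ∀ F, leibniz 0 0 0 F = F := fun F => by simp [leibniz_zero]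
  have h3 : ∀ n F, leibniz 0 0 (n + 1) F = 0 := fun n F => by
    obtain ⟨h, rfl | rfl⟩ : ∃ h, n = 2 * h ∨ n = 2 * h + 1 := ⟨n / 2, by omega⟩
    · exact leibniz_even_odd 0 h F
    · have := leibniz_even_even 0 (h + 1) F
      rw [mul_add] at this
      simpa [leibnizEven, genBinom_zero_succ] using this
  rw [Finset.sum_eq_single_of_mem (0, n) (by simp)]
  · simp [h0]
  · rintro ⟨a, b⟩ _ hne
    cases a with
    | zero => simp_all
    | succ a => exact h3 a _

lemma densityOp_add_three (lam : ℂ) (F : SPoly) (n : ℕ) : densityOp lam F (n + 3) = 0 := rfl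
lemma densityOp_zero (lam : ℂ) (F : SPoly) : densityOp lam F 0 = -F := rfl
lemma densityOp_one (lam : ℂ) (F : SPoly) : densityOp lam F 1 = (1 / 2 : ℂ) • opD F := rfl
lemma densityOp_two (lam : ℂ) (F : SPoly) : densityOp lam F 2 = lam • dx F := rfl

lemma comp_densityOp_zero (lam : ℂ) (F : SPoly) (T : ℕ → SPoly) :
    comp 2 0 (densityOp lam F) T 0 = -F * T 0 := by
  simp [comp_zero, leibniz_zero, densityOp_zero]

lemma comp_densityOp_one (lam : ℂ) (F : SPoly) (T : ℕ → SPoly) :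
    comp 2 0 (densityOp lam F) T 1 = -F * T 1 + (1 / 2 : ℂ) • (opD F * eps (T 0)) := by
  simp [comp_one, leibniz_zero, leibniz_one, densityOp_zero, densityOp_one]

lemma sum_antidiagonal_of_support_le_two {M : Type*} [AddCommMonoid M] (n : ℕ) (f : ℕ → ℕ → M)
    (h : ∀ i r, f (i + 3) r = 0) :
    ∑ p ∈ antidiagonal (n + 2), f p.1 p.2 = f 0 (n + 2) + f 1 (n + 1) + f 2 n := by
  rw [Finset.Nat.sum_antidiagonal_succ, Finset.Nat.sum_antidiagonal_succ,
    Finset.sum_eq_single_of_mem (0, n) (by simp), ← add_assoc]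
  rintro ⟨a, b⟩ _ hne
  cases a with
  | zero => simp_all
  | succ a => exact h a b

/-- The terms in which every symbol of the density operator is spent on `T n` reassemble to the
density action on that coefficient. -/
lemma comp_densityOp_add_two (lam : ℂ) (F : SPoly) (T : ℕ → SPoly) (n : ℕ) :
    comp 2 0 (densityOp lam F) T (n + 2) = -F * T (n + 2) + (1 / 2 : ℂ) • (opD F * eps (T (n + 1)))
      + (tensorDensity lam).act F (T n) := by
  have hm : (0 - 1 : ZMod 2) = 1 := rfl
  have hm2 : (0 - 2 : ZMod 2) = 0 := rfl
  have e1 : (2 - 1 : ℂ) = 1 := by norm_num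
  rw [comp_apply]
  simp only [← Finset.mul_sum]
  rw [sum_antidiagonal_of_support_le_two n (fun i r => densityOp lam F i *
    ∑ q ∈ antidiagonal r, leibniz (2 - i) (0 - i) q.1 (T q.2))
    (fun i r => by rw [densityOp_add_three, zero_mul])]
  simp only [Nat.cast_zero, Nat.cast_one, Nat.cast_ofNat, sub_zero, hm, hm2, e1, sub_self,
    sum_leibniz_two, sum_leibniz_one, sum_leibniz_zero, shiftUp_add_two]
  rw [tensorDensity_act_eq, opDbar_opDbar]
  simp only [densityOp_zero, densityOp_one, densityOp_two, mul_sub, mul_add, neg_mul, mul_neg,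
    smul_mul_assoc]
  abel

lemma contactBracket_tensorDensity (lam : ℂ) (F G : SPoly) :
    lam • dx (contactBracket F G) = (tensorDensity lam).act F (lam • dx G)
      - (tensorDensity lam).act G (lam • dx (evenPart F))
      - (tensorDensity lam).act (eps G) (lam • dx (oddPart F)) := by
  have h2 : 2 * (C (1 / 2) : ℂ[X]) = 1 := by rw [← C_ofNat, ← C_mul]; norm_num
  refine TrivSqZeroExt.ext ?_ ?_ <;>
    simp only [tensorDensity_act, contactField_apply, contactBracket, xi, dxi] <;>
    simp [smul_eq_C_mul, -one_div]
  · ring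
  · linear_combination C lam * (derivative (derivative F.fst) * G.snd
      - F.snd * derivative (derivative G.fst)) * h2

lemma comp_densityOp_bracket_two (lam : ℂ) (F G : SPoly) :
    -contactBracket F G = -F * (lam • dx G) + (1 / 2 : ℂ) • (opD F * eps ((1 / 2 : ℂ) • opD G))
      + (tensorDensity lam).act F (-G)
      - (-G * (lam • dx (evenPart F)) + (1 / 2 : ℂ) • (opD G * eps ((1 / 2 : ℂ) • opD (evenPart F)))
      + (tensorDensity lam).act G (-evenPart F))
      - (-eps G * (lam • dx (oddPart F))
      + (1 / 2 : ℂ) • (opD (eps G) * eps ((1 / 2 : ℂ) • opD (oddPart F)))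
      + (tensorDensity lam).act (eps G) (-oddPart F)) := by
  have h2 : 2 * (C (1 / 2) : ℂ[X]) = 1 := by rw [← C_ofNat, ← C_mul]; norm_num
  refine TrivSqZeroExt.ext ?_ ?_ <;>
    simp only [tensorDensity_act, contactField_apply, contactBracket, xi, dxi] <;>
    simp [smul_eq_C_mul, -one_div]
  · linear_combination -(C (1 / 2) * F.snd * G.snd) * h2
  · linear_combination (F.snd * derivative G.fst - derivative F.fst * G.snd) * (C (1 / 2) + 1) * h2

lemma comp_densityOp_bracket_three (lam : ℂ) (F G : SPoly) :
    (1 / 2 : ℂ) • opD (contactBracket F G) =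
      (1 / 2 : ℂ) • (opD F * eps (lam • dx G)) + (tensorDensity lam).act F ((1 / 2 : ℂ) • opD G)
      - ((1 / 2 : ℂ) • (opD G * eps (lam • dx (evenPart F)))
        + (tensorDensity lam).act G ((1 / 2 : ℂ) • opD (evenPart F)))
      - ((1 / 2 : ℂ) • (opD (eps G) * eps (lam • dx (oddPart F)))
        + (tensorDensity lam).act (eps G) ((1 / 2 : ℂ) • opD (oddPart F))) := by
  have h2 : 2 * (C (1 / 2) : ℂ[X]) = 1 := by rw [← C_ofNat, ← C_mul]; norm_num
  refine TrivSqZeroExt.ext ?_ ?_ <;>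
    simp only [tensorDensity_act, contactField_apply, contactBracket, xi, dxi] <;>
    simp [smul_eq_C_mul, -one_div]
  · linear_combination -((F.snd * derivative G.fst - derivative F.fst * G.snd) * C (1 / 2)) * h2
  · ring

/-- The representation property of `𝔽(lam)`, as an identity of operators. The products have
coefficients only in positions `0` to `4`; the first two cancel because leading symbols
supercommute, and the other three are the coefficients of the bracket. -/
theorem comp_densityOp_bracket (lam : ℂ) (F G : SPoly) :
    shiftUp (densityOp lam (contactBracket F G)) =
      comp 2 0 (densityOp lam F) (densityOp lam G)
        - comp 2 0 (densityOp lam G) (densityOp lam (evenPart F))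
        - comp 2 0 (densityOp lam (eps G)) (densityOp lam (oddPart F)) := by
  have h2 : 2 * (C (1 / 2) : ℂ[X]) = 1 := by rw [← C_ofNat, ← C_mul]; norm_num
  funext n
  simp only [Pi.sub_apply]
  match n with
  | 0 =>
    rw [comp_densityOp_zero, comp_densityOp_zero, comp_densityOp_zero]
    refine TrivSqZeroExt.ext ?_ ?_ <;> simp [densityOp_zero] <;> grind
  | 1 =>
    rw [comp_densityOp_one, comp_densityOp_one, comp_densityOp_one]
    refine TrivSqZeroExt.ext ?_ ?_ <;>
      simp [densityOp_zero, densityOp_one, smul_eq_C_mul, -one_div] <;> grind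
  | 2 =>
    rw [comp_densityOp_add_two lam _ _ 0, comp_densityOp_add_two lam _ _ 0,
      comp_densityOp_add_two lam _ _ 0]
    simp only [zero_add, densityOp_zero, densityOp_one, densityOp_two]
    exact comp_densityOp_bracket_two lam F G
  | 3 =>
    rw [comp_densityOp_add_two lam _ _ 1, comp_densityOp_add_two lam _ _ 1,
      comp_densityOp_add_two lam _ _ 1]
    simp only [densityOp_add_three lam _ 0, densityOp_one, densityOp_two, mul_zero, zero_add,
      Nat.reduceAdd]
    exact comp_densityOp_bracket_three lam F G
  | 4 =>
    rw [comp_densityOp_add_two lam _ _ 2, comp_densityOp_add_two lam _ _ 2,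
      comp_densityOp_add_two lam _ _ 2]
    have := contactBracket_tensorDensity lam F G
    simp only [densityOp_add_three lam _ 0, densityOp_add_three lam _ 1, densityOp_two, mul_zero,
      map_zero, smul_zero, zero_add]
    exact this
  | n + 5 =>
    rw [comp_densityOp_add_two lam _ _ (n + 3), comp_densityOp_add_two lam _ _ (n + 3),
      comp_densityOp_add_two lam _ _ (n + 3)]
    rw [show n + 5 = n + 3 + 2 from rfl, shiftUp_add_two]
    simp [densityOp_add_three lam _ n, densityOp_add_three lam _ (n + 1),
      densityOp_add_three lam _ (n + 2)]

lemma contactBracket_evenPart (F G : SPoly) : evenPart (contactBracket F G) =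
    contactBracket (evenPart F) (evenPart G) + contactBracket (oddPart F) (oddPart G) := by
  refine TrivSqZeroExt.ext ?_ ?_ <;> simp [contactBracket]

lemma contactBracket_oddPart (F G : SPoly) : oddPart (contactBracket F G) =
    contactBracket (evenPart F) (oddPart G) + contactBracket (oddPart F) (evenPart G) := by
  refine TrivSqZeroExt.ext ?_ ?_ <;> simp [contactBracket] <;> ring

/-- A supercommutator action is a representation by associativity (`comp_assoc`) and the bracket
relation for the density operators on either side (`comp_densityOp_bracket`). -/
theorem psiModule_isRep (lam p k : ℂ) (l : ZMod 2) : (psiModule lam p k l).IsRep where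
  par_par := psiPar_psiPar l
  par_act F T := by
    apply shiftUp_injective
    change shiftUp (psiPar l _) = shiftUp ((psiModule lam p k l).act (eps F) (psiPar l T))
    rw [← psiPar_shiftUp, ← psiCommutator_eq_shiftUp, ← psiCommutator_eq_shiftUp,
      psiPar_psiCommutator]
  act_bracket F G T := by
    -- Each supercommutator raises the nominal degree by two positions. After two shifts all terms
    -- are genuine compositions, and the identity can be checked before the vanishing leading
    -- coefficients are dropped.
    apply shiftUp_injective
    apply shiftUp_injective
    have key : ∀ X Y : SPoly, shiftUp (shiftUp ((psiModule lam p k l).act X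
        ((psiModule lam p k l).act Y T))) =
        psiCommutator lam p (k + 1) l X (psiCommutator lam p k l Y T) := fun X Y => by
      rw [← psiCommutator_eq_shiftUp, ← psiCommutator_shiftUp, ← psiCommutator_eq_shiftUp]
    have e1 : (2 * (k + 1) : ℂ) = 2 * k + 2 := by ring
    have e2 : (2 * (k + 1) : ℂ) = 2 + 2 * k := by ring
    have a1 : ∀ X Y, comp 2 0 (densityOp (lam + p) X) (comp 2 0 (densityOp (lam + p) Y) T) =
        comp (2 + 2) 0 (comp 2 0 (densityOp (lam + p) X) (densityOp (lam + p) Y)) T := fun X Y => by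
      rw [comp_assoc, add_zero]
    have a2 : ∀ X Y, ∀ T : ℕ → SPoly, comp 2 0 (densityOp (lam + p) X) (comp (2 * k) l T (densityOp lam Y)) =
        comp (2 * (k + 1)) l (comp 2 0 (densityOp (lam + p) X) T) (densityOp lam Y) := fun X Y T => by
      rw [comp_assoc, zero_add, e2]
    have a3 : ∀ X Y, ∀ T : ℕ → SPoly, comp (2 * (k + 1)) l (comp (2 * k) l T (densityOp lam X)) (densityOp lam Y) =
        comp (2 * k) l T (comp 2 0 (densityOp lam X) (densityOp lam Y)) := fun X Y T => by
      rw [comp_assoc, add_zero, e1]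
    have p1 : ∀ X, ∀ T : ℕ → SPoly, psiPar l (comp 2 0 (densityOp (lam + p) X) T) =
        comp 2 0 (densityOp (lam + p) (eps X)) (psiPar l T) := fun X T => by
      have := psiPar_comp 2 0 l (densityOp (lam + p) X) T
      rwa [zero_add, psiPar_densityOp] at this
    have p2 : ∀ X, ∀ T : ℕ → SPoly, psiPar l (comp (2 * k) l T (densityOp lam X)) =
        comp (2 * k) l (psiPar l T) (densityOp lam (eps X)) := fun X T => by
      have := psiPar_comp (2 * k) l 0 T (densityOp lam X)
      rwa [add_zero, psiPar_densityOp] at this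
    have b1 : ∀ X Y, shiftUp (comp 2 0 (densityOp (lam + p) (contactBracket X Y)) T) =
        comp (2 + 2) 0 (comp 2 0 (densityOp (lam + p) X) (densityOp (lam + p) Y)
          - comp 2 0 (densityOp (lam + p) Y) (densityOp (lam + p) (evenPart X))
          - comp 2 0 (densityOp (lam + p) (eps Y)) (densityOp (lam + p) (oddPart X))) T :=
      fun X Y => by rw [← comp_densityOp_bracket, comp_shiftUp_left]
    have b2 : ∀ X Y, ∀ T : ℕ → SPoly,
        shiftUp (comp (2 * k) l T (densityOp lam (contactBracket X Y))) =
        comp (2 * k) l T (comp 2 0 (densityOp lam X) (densityOp lam Y)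
          - comp 2 0 (densityOp lam Y) (densityOp lam (evenPart X))
          - comp 2 0 (densityOp lam (eps Y)) (densityOp lam (oddPart X))) :=
      fun X Y T => by rw [← comp_densityOp_bracket, comp_shiftUp_right]
    have hF : ∀ c, densityOp c F = densityOp c (evenPart F) + densityOp c (oddPart F) := fun c => by
      rw [← map_add, evenPart_add_oddPart]
    rw [map_sub, map_sub, map_sub, map_sub, key, key, key, ← psiCommutator_eq_shiftUp]
    simp only [psiCommutator_apply, map_sub, LinearMap.sub_apply, a1, a2, a3, p1, p2, b1, b2,
      evenPart_evenPart, evenPart_oddPart, oddPart_evenPart, oddPart_oddPart, psiPar_psiPar,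
      map_zero, sub_zero, contactBracket_evenPart, contactBracket_oddPart, LinearMap.add_apply,
      evenPart_eps, oddPart_eps, eps_evenPart, eps_oddPart, map_neg, LinearMap.neg_apply, map_add,
      hF]
    abel

section Equivalences

/-! ## Equivalences and subquotients -/

namespace SuperAction

variable {V W Z : Type*} [AddCommGroup V] [Module ℂ V] [AddCommGroup W] [Module ℂ W]
  [AddCommGroup Z] [Module ℂ Z]

lemma EvenEquiv.symm {A : SuperAction V} {B : SuperAction W} (h : A.EvenEquiv B) :
    B.EvenEquiv A := by
  obtain ⟨φ, h1, h2⟩ := h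
  refine ⟨φ.symm, fun v => ?_, fun F v => ?_⟩
  · rw [LinearEquiv.symm_apply_eq, h1, LinearEquiv.apply_symm_apply]
  · rw [LinearEquiv.symm_apply_eq, h2, LinearEquiv.apply_symm_apply]

lemma EvenEquiv.trans {A : SuperAction V} {B : SuperAction W} {C : SuperAction Z}
    (h : A.EvenEquiv B) (h' : B.EvenEquiv C) : A.EvenEquiv C := by
  obtain ⟨φ, h1, h2⟩ := h
  obtain ⟨ψ, h3, h4⟩ := h'
  exact ⟨φ.trans ψ, fun v => by simp [h1, h3], fun F v => by simp [h2, h4]⟩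

/-- The action carried over to `W` by a projection `p : V → W` and a section `q : W → V`. -/
def compress (A : SuperAction V) (p : V →ₗ[ℂ] W) (q : W →ₗ[ℂ] V) : SuperAction W where
  par := p ∘ₗ A.par ∘ₗ q
  act := (A.act.compr₂ p).compl₂ q

lemma compress_par (A : SuperAction V) (p : V →ₗ[ℂ] W) (q : W →ₗ[ℂ] V) (w : W) :
    (A.compress p q).par w = p (A.par (q w)) := rfl

lemma compress_act (A : SuperAction V) (p : V →ₗ[ℂ] W) (q : W →ₗ[ℂ] V) (F : SPoly) (w : W) :
    (A.compress p q).act F w = p (A.act F (q w)) := rfl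

/-- `p : V → W` with section `q` exhibits `W` as `M / N`. -/
structure IsPresentation (A : SuperAction V) (M N : Submodule ℂ V) (p : V →ₗ[ℂ] W)
    (q : W →ₗ[ℂ] V) : Prop where
  inv_left : A.Invariant M
  inv_right : A.Invariant N
  mem : ∀ w, q w ∈ M
  apply_apply : ∀ w, p (q w) = w
  mem_iff : ∀ v ∈ M, v ∈ N ↔ p v = 0

namespace IsPresentation

variable {A : SuperAction V} {M N : Submodule ℂ V} {p : V →ₗ[ℂ] W} {q : W →ₗ[ℂ] V}

lemma sub_mem (h : A.IsPresentation M N p q) {v : V} (hv : v ∈ M) : v - q (p v) ∈ N :=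
  (h.mem_iff _ (M.sub_mem hv (h.mem _))).2 (by rw [map_sub, h.apply_apply, sub_self])

lemma par_comm (h : A.IsPresentation M N p q) {v : V} (hv : v ∈ M) :
    p (A.par v) = (A.compress p q).par (p v) := by
  have h1 := (h.mem_iff _ (h.inv_left.1 _ (M.sub_mem hv (h.mem _)))).1
    (h.inv_right.1 _ (h.sub_mem hv))
  rwa [map_sub, map_sub, sub_eq_zero] at h1

lemma act_comm (h : A.IsPresentation M N p q) (F : SPoly) {v : V} (hv : v ∈ M) :
    p (A.act F v) = (A.compress p q).act F (p v) := by
  have h1 := (h.mem_iff _ (h.inv_left.2 F trivial _ (M.sub_mem hv (h.mem _)))).1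
    (h.inv_right.2 F trivial _ (h.sub_mem hv))
  rwa [map_sub, map_sub, sub_eq_zero] at h1

lemma isRep (h : A.IsPresentation M N p q) (hA : A.IsRep) : (A.compress p q).IsRep where
  par_par w := by
    conv_rhs => rw [← h.apply_apply w, ← hA.par_par (q w)]
    rw [compress_par A p q w, ← h.par_comm (h.inv_left.1 _ (h.mem w))]
  par_act F w := by
    rw [compress_act, ← h.par_comm (h.inv_left.2 F trivial _ (h.mem w)), hA.par_act,
      h.act_comm _ (h.inv_left.1 _ (h.mem w))]
    rfl
  act_bracket F G w := by
    have key : ∀ X Y, (A.compress p q).act X ((A.compress p q).act Y w) =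
        p (A.act X (A.act Y (q w))) := fun X Y => by
      rw [compress_act A p q Y, ← h.act_comm X (h.inv_left.2 Y trivial _ (h.mem w))]
    rw [key, key, key, compress_act, hA.act_bracket, map_sub, map_sub]

lemma evenEquiv (h : A.IsPresentation M N p q) :
    (A.subquotient M N h.inv_left h.inv_right).EvenEquiv (A.compress p q) := by
  have hker : N.submoduleOf M ≤ LinearMap.ker (p.domRestrict M) := fun v hv => by
    rw [LinearMap.mem_ker]
    exact (h.mem_iff v.1 v.2).1 hv
  let f : (M ⧸ N.submoduleOf M) →ₗ[ℂ] W := Submodule.liftQ _ (p.domRestrict M) hker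
  have hf : ∀ v : M, f (Submodule.Quotient.mk v) = p v := fun v => rfl
  have hbij : Function.Bijective f := by
    constructor
    · rw [injective_iff_map_eq_zero]
      intro x
      induction x using Submodule.Quotient.induction_on with
      | H v =>
        intro hv
        rw [hf] at hv
        rw [Submodule.Quotient.mk_eq_zero]
        exact (h.mem_iff v.1 v.2).2 hv
    · intro w
      exact ⟨Submodule.Quotient.mk ⟨q w, h.mem w⟩, h.apply_apply w⟩
  refine ⟨LinearEquiv.ofBijective f hbij, fun x => ?_, fun F x => ?_⟩
  · induction x using Submodule.Quotient.induction_on with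
    | H v => exact h.par_comm v.2
  · induction x using Submodule.Quotient.induction_on with
    | H v => exact h.act_comm F v.2

lemma of_equiv (e : V ≃ₗ[ℂ] W) :
    A.IsPresentation ⊤ ⊥ e.toLinearMap e.symm.toLinearMap where
  inv_left := ⟨fun _ _ => trivial, fun _ _ _ _ => trivial⟩
  inv_right := ⟨fun v hv => by simp_all, fun F _ v hv => by simp_all⟩
  mem _ := trivial
  apply_apply w := e.apply_symm_apply w
  mem_iff v _ := by simp

end IsPresentation

lemma evenEquiv_compress (A : SuperAction V) (e : V ≃ₗ[ℂ] W) :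
    A.EvenEquiv (A.compress e.toLinearMap e.symm.toLinearMap) :=
  ⟨e, fun v => by simp [compress_par], fun F v => by simp [compress_act]⟩

lemma shift_act (A : SuperAction V) (m : ZMod 2) : (A.shift m).act = A.act := rfl

lemma shift_par (A : SuperAction V) (m : ZMod 2) (v : V) :
    (A.shift m).par v = sign m • A.par v := by
  unfold shift sign
  dsimp only
  split_ifs <;> simp

lemma isRep_shift {A : SuperAction V} (hA : A.IsRep) (m : ZMod 2) : (A.shift m).IsRep where
  par_par v := by
    rw [shift_par, shift_par, map_smul, smul_smul, sign_mul_self, one_smul, hA.par_par]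
  par_act F v := by
    rw [shift_par, shift_par, shift_act, hA.par_act, map_smul]
  act_bracket := hA.act_bracket

lemma sign_ne_zero (m : ZMod 2) : sign m ≠ 0 := by
  unfold sign; split_ifs <;> norm_num

lemma invariant_shift {A : SuperAction V} {m : ZMod 2} {U : Submodule ℂ V} :
    (A.shift m).Invariant U ↔ A.Invariant U := by
  refine and_congr (forall₂_congr fun v _ => ?_) Iff.rfl
  rw [shift_par]
  exact Submodule.smul_mem_iff _ (sign_ne_zero m)

/-- An even equivalence from a parity-shifted subquotient gives an even or an odd equivalence
from the subquotient itself. -/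
lemma evenEquiv_or_oddEquiv_of_shift {A : SuperAction V} {B : SuperAction W} (hB : B.IsRep)
    {m : ZMod 2} {M N : Submodule ℂ V} (hM : (A.shift m).Invariant M)
    (hN : (A.shift m).Invariant N) (h : ((A.shift m).subquotient M N hM hN).EvenEquiv B) :
    (A.subquotient M N (invariant_shift.1 hM) (invariant_shift.1 hN)).EvenEquiv B ∨
      (A.subquotient M N (invariant_shift.1 hM) (invariant_shift.1 hN)).OddEquiv B := by
  obtain ⟨φ, h1, h2⟩ := h
  have hpar : ∀ x, ((A.shift m).subquotient M N hM hN).par x =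
      sign m • (A.subquotient M N (invariant_shift.1 hM) (invariant_shift.1 hN)).par x := by
    intro x
    induction x using Submodule.Quotient.induction_on with
    | H v =>
      change Submodule.Quotient.mk _ = sign m • Submodule.Quotient.mk _
      rw [← Submodule.Quotient.mk_smul]
      congr 1
      ext
      exact shift_par A m v
  have hm : ∀ m : ZMod 2, m = 0 ∨ m = 1 := by decide
  rcases hm m with rfl | rfl
  · refine Or.inl ⟨φ, fun v => ?_, h2⟩
    rw [← h1, hpar]
    simp [sign]
  -- Following the equivalence by the parity of `B` replaces `F` by `ε(F)` in the equivariance,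
  -- which is the sign rule of an odd equivalence.
  · let e : W ≃ₗ[ℂ] W := LinearEquiv.ofInvolutive B.par hB.par_par
    refine Or.inr ⟨φ.trans e, fun v => ?_, fun F v => ?_⟩
    · have h3 := h1 v
      rw [hpar] at h3
      simp only [sign, one_ne_zero, if_false, neg_smul, one_smul, map_neg] at h3
      change B.par (φ _) = -B.par (B.par (φ v))
      rw [← h3, map_neg, neg_neg]
    · change B.par (φ _) = B.act (eps F) (B.par (φ v))
      rw [← hB.par_act]
      exact congrArg B.par (h2 F v)

end SuperAction

end Equivalences

/-! ## Monomials of the superline -/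

/-- The monomials `1, ξ, x, ξ x, x², …`. -/
def mono (n : ℕ) : SPoly := if Even n then .inl (X ^ (n / 2)) else .inr (X ^ (n / 2))

lemma mono_two_mul (a : ℕ) : mono (2 * a) = .inl (X ^ a) := by simp [mono]

lemma mono_two_mul_add_one (a : ℕ) : mono (2 * a + 1) = .inr (X ^ a) := by
  have : (2 * a + 1) / 2 = a := by omega
  simp [mono, this]

lemma mono_zero : mono 0 = .inl 1 := by simp [mono]
lemma mono_one : mono 1 = .inr 1 := by simp [mono]
lemma mono_two : mono 2 = .inl X := by simp [mono]

lemma exists_eq_two_mul_or (n : ℕ) : ∃ a, n = 2 * a ∨ n = 2 * a + 1 := ⟨n / 2, by omega⟩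

lemma mono_induction {P : SPoly → Prop} (hadd : ∀ F G, P F → P G → P (F + G))
    (hsmul : ∀ (c : ℂ) n, P (c • mono n)) (F : SPoly) : P F := by
  have h1 : ∀ f : ℂ[X], P (.inl f) := by
    intro f
    induction f using Polynomial.induction_on' with
    | add p q hp hq => rw [TrivSqZeroExt.inl_add]; exact hadd _ _ hp hq
    | monomial n c =>
      have := hsmul c (2 * n)
      rwa [mono_two_mul, ← TrivSqZeroExt.inl_smul, smul_eq_C_mul, C_mul_X_pow_eq_monomial] at this
  have h2 : ∀ f : ℂ[X], P (.inr f) := by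
    intro f
    induction f using Polynomial.induction_on' with
    | add p q hp hq => rw [TrivSqZeroExt.inr_add]; exact hadd _ _ hp hq
    | monomial n c =>
      have := hsmul c (2 * n + 1)
      rwa [mono_two_mul_add_one, ← TrivSqZeroExt.inr_smul, smul_eq_C_mul,
        C_mul_X_pow_eq_monomial] at this
  rw [← TrivSqZeroExt.inl_fst_add_inr_snd_eq F]
  exact hadd _ _ (h1 _) (h2 _)

lemma linearMap_ext_mono {V : Type*} [AddCommGroup V] [Module ℂ V] {f g : SPoly →ₗ[ℂ] V}
    (h : ∀ n, f (mono n) = g (mono n)) : f = g := by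
  ext F
  induction F using mono_induction with
  | hadd F G hF hG => rw [map_add, map_add, hF, hG]
  | hsmul c n => rw [map_smul, map_smul, h]

lemma opD_mono_zero : opD (mono 0) = 0 := by
  rw [mono_zero]; refine TrivSqZeroExt.ext ?_ ?_ <;> simp

lemma opD_mono_odd (a : ℕ) : opD (mono (2 * a + 1)) = mono (2 * a) := by
  rw [mono_two_mul, mono_two_mul_add_one]; refine TrivSqZeroExt.ext ?_ ?_ <;> simp

lemma opD_mono_even (a : ℕ) : opD (mono (2 * a + 2)) = (a + 1 : ℂ) • mono (2 * a + 1) := by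
  rw [show 2 * a + 2 = 2 * (a + 1) by ring, mono_two_mul, mono_two_mul_add_one]
  refine TrivSqZeroExt.ext ?_ ?_ <;> simp [smul_eq_C_mul]

lemma exists_opD_mono (n : ℕ) : ∃ c : ℂ, c ≠ 0 ∧ opD (mono (n + 1)) = c • mono n := by
  obtain ⟨a, rfl | rfl⟩ := exists_eq_two_mul_or n
  · exact ⟨1, one_ne_zero, by rw [opD_mono_odd, one_smul]⟩
  · exact ⟨a + 1, Nat.cast_add_one_ne_zero a, opD_mono_even a⟩

lemma eq_inl_C_of_opD_eq_zero {F : SPoly} (h : opD F = 0) : F = .inl (C (F.fst.coeff 0)) := by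
  have h1 : F.snd = 0 := by simpa using congrArg TrivSqZeroExt.fst h
  have h2 : derivative F.fst = 0 := by simpa using congrArg TrivSqZeroExt.snd h
  refine TrivSqZeroExt.ext ?_ ?_
  · exact eq_C_of_derivative_eq_zero h2
  · simpa using h1

/-! ### The conformal subalgebra acting on densities -/

lemma inl_one_mem : (.inl 1 : SPoly) ∈ conformal := Submodule.subset_span (by simp)
lemma inr_one_mem : (.inr 1 : SPoly) ∈ conformal := Submodule.subset_span (by simp)
lemma inl_X_mem : (.inl X : SPoly) ∈ conformal := Submodule.subset_span (by simp)
lemma inr_X_mem : (.inr X : SPoly) ∈ conformal := Submodule.subset_span (by simp)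
lemma inl_X_sq_mem : (.inl (X ^ 2) : SPoly) ∈ conformal := Submodule.subset_span (by simp)

lemma density_inr_one (mu : ℂ) (G : SPoly) :
    (tensorDensity mu).act (.inr 1) G = (1 / 2 : ℂ) • opD G := by
  refine TrivSqZeroExt.ext ?_ ?_ <;> simp [tensorDensity_act, contactField_apply, xi, dxi]

lemma X_mul_derivative_X_pow (a : ℕ) :
    X * derivative (X ^ a : ℂ[X]) = (a : ℂ[X]) * X ^ a := by
  cases a with
  | zero => simp
  | succ a => rw [derivative_X_pow]; simp [pow_succ]; ring

lemma density_inl_X (mu : ℂ) (n : ℕ) :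
    (tensorDensity mu).act (.inl X) (mono n) = (mu + n / 2 : ℂ) • mono n := by
  have h2 : 2 * (C (2⁻¹) : ℂ[X]) = 1 := by rw [← C_ofNat, ← C_mul]; norm_num
  obtain ⟨a, rfl | rfl⟩ := exists_eq_two_mul_or n
  · have hd := X_mul_derivative_X_pow a
    rw [mono_two_mul]
    refine TrivSqZeroExt.ext ?_ ?_ <;> simp [tensorDensity_act, contactField_apply, xi, dxi, smul_eq_C_mul, div_eq_mul_inv,
      -one_div, C_ofNat]
    linear_combination hd - a * X ^ a * h2
  · have hd := X_mul_derivative_X_pow a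
    rw [mono_two_mul_add_one]
    refine TrivSqZeroExt.ext ?_ ?_ <;> simp [tensorDensity_act, contactField_apply, xi, dxi, smul_eq_C_mul, div_eq_mul_inv,
      -one_div, C_ofNat]
    linear_combination hd - a * X ^ a * h2

lemma density_inr_X_even (mu : ℂ) (a : ℕ) :
    (tensorDensity mu).act (.inr X) (mono (2 * a)) = (mu + a / 2 : ℂ) • mono (2 * a + 1) := by
  have hd := X_mul_derivative_X_pow a
  rw [mono_two_mul, mono_two_mul_add_one]
  refine TrivSqZeroExt.ext ?_ ?_ <;> simp [tensorDensity_act, contactField_apply, xi, dxi, smul_eq_C_mul, div_eq_mul_inv,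
      -one_div]
  linear_combination C (2⁻¹) * hd

lemma density_inr_X_odd (mu : ℂ) (a : ℕ) :
    (tensorDensity mu).act (.inr X) (mono (2 * a + 1)) = (1 / 2 : ℂ) • mono (2 * a + 2) := by
  rw [show 2 * a + 2 = 2 * (a + 1) by ring, mono_two_mul, mono_two_mul_add_one]
  refine TrivSqZeroExt.ext ?_ ?_ <;> simp [tensorDensity_act, contactField_apply, xi, dxi, smul_eq_C_mul, div_eq_mul_inv,
      pow_succ, -one_div]
  ring

lemma density_inl_X_sq_even (mu : ℂ) (a : ℕ) :
    (tensorDensity mu).act (.inl (X ^ 2)) (mono (2 * a)) = (a + 2 * mu : ℂ) • mono (2 * a + 2) := by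
  have hd := X_mul_derivative_X_pow a
  rw [show 2 * a + 2 = 2 * (a + 1) by ring, mono_two_mul, mono_two_mul]
  refine TrivSqZeroExt.ext ?_ ?_ <;> simp [tensorDensity_act, contactField_apply, xi, dxi, smul_eq_C_mul, div_eq_mul_inv,
      pow_succ, -one_div, C_ofNat]
  linear_combination X * hd

lemma density_inl_X_sq_odd (mu : ℂ) (a : ℕ) :
    (tensorDensity mu).act (.inl (X ^ 2)) (mono (2 * a + 1))
      = (a + 1 + 2 * mu : ℂ) • mono (2 * a + 3) := by
  have h2 : 2 * (C (2⁻¹) : ℂ[X]) = 1 := by rw [← C_ofNat, ← C_mul]; norm_num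
  have hd := X_mul_derivative_X_pow a
  rw [show 2 * a + 3 = 2 * (a + 1) + 1 by ring, mono_two_mul_add_one, mono_two_mul_add_one]
  refine TrivSqZeroExt.ext ?_ ?_ <;> simp [tensorDensity_act, contactField_apply, xi, dxi, smul_eq_C_mul, div_eq_mul_inv,
      pow_succ, -one_div, C_ofNat]
  linear_combination X * hd + X ^ a * X * h2

/-- The contact Hamiltonian `ξ x²`, a lowest weight vector of `𝒦 / 𝔰`. -/
abbrev gen : SPoly := .inr (X ^ 2)

lemma density_gen_even (mu : ℂ) (a : ℕ) :
    (tensorDensity mu).act gen (mono (2 * a)) = (a / 2 + 2 * mu : ℂ) • mono (2 * a + 3) := by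
  have hd := X_mul_derivative_X_pow a
  rw [show 2 * a + 3 = 2 * (a + 1) + 1 by ring, mono_two_mul, mono_two_mul_add_one]
  refine TrivSqZeroExt.ext ?_ ?_ <;> simp [tensorDensity_act, contactField_apply, xi, dxi, smul_eq_C_mul, div_eq_mul_inv,
      pow_succ, -one_div, C_ofNat]
  linear_combination C (2⁻¹) * X * hd

lemma density_gen_odd (mu : ℂ) (a : ℕ) :
    (tensorDensity mu).act gen (mono (2 * a + 1)) = (1 / 2 : ℂ) • mono (2 * a + 4) := by
  rw [show 2 * a + 4 = 2 * (a + 2) by ring, mono_two_mul, mono_two_mul_add_one]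
  refine TrivSqZeroExt.ext ?_ ?_ <;> simp [tensorDensity_act, contactField_apply, xi, dxi, smul_eq_C_mul, div_eq_mul_inv,
      pow_succ, -one_div]
  ring

section Graded

/-! ## Graded modules with diagonal conformal action -/

/-- The constant coefficient of the even part. -/
def cc : SPoly →ₗ[ℂ] ℂ where
  toFun F := F.fst.coeff 0
  map_add' F G := by simp
  map_smul' c F := by simp

lemma cc_apply (F : SPoly) : cc F = F.fst.coeff 0 := rfl

lemma cc_inr_mul_X (mu : ℂ) (F : SPoly) : cc ((tensorDensity mu).act (.inr X) F) = 0 := by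
  simp [cc_apply, tensorDensity_act, contactField_apply, xi, dxi]

lemma cc_gen (mu : ℂ) (F : SPoly) : cc ((tensorDensity mu).act gen F) = 0 := by
  simp [cc_apply, tensorDensity_act, contactField_apply, xi, dxi, mul_coeff_zero]

lemma cc_inl_X_sq (mu : ℂ) (F : SPoly) : cc ((tensorDensity mu).act (.inl (X ^ 2)) F) = 0 := by
  simp [cc_apply, tensorDensity_act, contactField_apply, xi, dxi, mul_coeff_zero]

lemma eps_inr (f : ℂ[X]) : eps (.inr f) = -.inr f := by
  refine TrivSqZeroExt.ext ?_ ?_ <;> simp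
lemma evenPart_inl (f : ℂ[X]) : evenPart (.inl f) = .inl f := by
  refine TrivSqZeroExt.ext ?_ ?_ <;> simp
lemma oddPart_inl (f : ℂ[X]) : oddPart (.inl f) = 0 := by
  refine TrivSqZeroExt.ext ?_ ?_ <;> simp
lemma evenPart_inr (f : ℂ[X]) : evenPart (.inr f) = 0 := by
  refine TrivSqZeroExt.ext ?_ ?_ <;> simp
lemma oddPart_inr (f : ℂ[X]) : oddPart (.inr f) = .inr f := by
  refine TrivSqZeroExt.ext ?_ ?_ <;> simp

namespace SuperAction.IsRep

variable {V : Type*} [AddCommGroup V] [Module ℂ V] {A : SuperAction V}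

lemma bracket_inl (h : A.IsRep) (f : ℂ[X]) (H : SPoly) (v : V) :
    A.act (contactBracket (.inl f) H) v = A.act (.inl f) (A.act H v) - A.act H (A.act (.inl f) v) := by
  rw [h.act_bracket, evenPart_inl, oddPart_inl]
  simp

lemma bracket_inr_inr (h : A.IsRep) (f g : ℂ[X]) (v : V) :
    A.act (contactBracket (.inr f) (.inr g)) v =
      A.act (.inr f) (A.act (.inr g) v) + A.act (.inr g) (A.act (.inr f) v) := by
  rw [h.act_bracket, evenPart_inr, oddPart_inr, eps_inr]
  simp

end SuperAction.IsRep

lemma bracket_inr_inr (f g : ℂ[X]) :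
    contactBracket (.inr f) (.inr g) = (1 / 2 : ℂ) • .inl (f * g) := by
  refine TrivSqZeroExt.ext ?_ ?_ <;> simp [contactBracket]

lemma bracket_X_gen : contactBracket (.inl X) gen = (3 / 2 : ℂ) • gen := by
  have h2 : 2 * (C (1 / 2) : ℂ[X]) = 1 := by rw [← C_ofNat, ← C_mul]; norm_num
  have h3 : (C (3 / 2) : ℂ[X]) = 1 + C (1 / 2) := by rw [← C_1, ← C_add]; norm_num
  refine TrivSqZeroExt.ext ?_ ?_ <;> simp [contactBracket, smul_eq_C_mul, -one_div, h3]
  ring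

lemma bracket_X_sq_inr (n : ℕ) : contactBracket (.inl (X ^ 2)) (.inr (X ^ (n + 2))) =
    (n + 1 : ℂ) • .inr (X ^ (n + 3)) := by
  have h2 : 2 * (C (1 / 2) : ℂ[X]) = 1 := by rw [← C_ofNat, ← C_mul]; norm_num
  have hd := X_mul_derivative_X_pow (n + 2)
  refine TrivSqZeroExt.ext ?_ ?_ <;> simp [contactBracket, smul_eq_C_mul, -one_div]
  linear_combination X ^ (n + 3) * h2

/-- An `𝔰`-relative one-cochain of `𝒦` with values in the operators `𝔽(a) → 𝔽(b)`. -/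
structure IsRelCochain (a b : ℂ) (γ : SPoly →ₗ[ℂ] SPoly →ₗ[ℂ] SPoly) : Prop where
  conf : ∀ F ∈ conformal, γ F = 0
  even : ∀ f : ℂ[X], (.inl f : SPoly) ∈ conformal → ∀ H G, γ (contactBracket (.inl f) H) G =
    (tensorDensity b).act (.inl f) (γ H G) - γ H ((tensorDensity a).act (.inl f) G)
  odd : ∀ f g : ℂ[X], (.inr f : SPoly) ∈ conformal → ∀ G, γ (contactBracket (.inr f) (.inr g)) G =
    (tensorDensity b).act (.inr f) (γ (.inr g) G) + γ (.inr g) ((tensorDensity a).act (.inr f) G)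

namespace IsRelCochain

variable {a b : ℂ} {γ : SPoly →ₗ[ℂ] SPoly →ₗ[ℂ] SPoly}

/-- The bracket of `ξ` and `ξ x²` is `½ x²`, which lies in `𝔰`, where the cochain vanishes; and `ξ`
acts on densities as `½ D`. -/
lemma opD_comm (h : IsRelCochain a b γ) (G : SPoly) : opD (γ gen G) = -γ gen (opD G) := by
  have h1 := h.odd 1 (X ^ 2) inr_one_mem G
  rw [bracket_inr_inr, one_mul, map_smul, h.conf _ inl_X_sq_mem, density_inr_one,
    density_inr_one, map_smul, ← smul_add, smul_zero, LinearMap.zero_apply] at h1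
  have h2 := (smul_eq_zero.1 h1.symm).resolve_left (by norm_num)
  exact eq_neg_of_add_eq_zero_left h2

/-- Induction on the degree: if the image of the preceding monomial vanishes, `D` kills the present
image, which is then a constant. Comparing weights under `𝕏(x)`, where `ξ x²` has weight `3/2`, a
non-zero constant is possible in one degree only, and that case is excluded by assumption. -/
lemma gen_mono_eq_zero (h : IsRelCochain a b γ)
    (hc : ∀ n : ℕ, b - a - 3 / 2 = n / 2 → cc (γ gen (mono n)) = 0) (n : ℕ) :
    γ gen (mono n) = 0 := by
  have key : ∀ n, opD (γ gen (mono n)) = 0 → γ gen (mono n) = 0 := by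
    intro n hn
    have h2 := eq_inl_C_of_opD_eq_zero hn
    have h3 := h.even X inl_X_mem gen (mono n)
    set c := (γ gen (mono n)).fst.coeff 0 with hcdef
    have h4 : γ gen (mono n) = c • mono 0 := by
      rw [h2, mono_zero, ← TrivSqZeroExt.inl_smul, smul_eq_C_mul, mul_one]
    rw [bracket_X_gen, map_smul, LinearMap.smul_apply, density_inl_X, map_smul, h4, map_smul,
      density_inl_X, smul_smul, smul_smul, smul_smul, ← sub_smul] at h3
    have h5 := congrArg cc h3
    simp only [map_smul, cc_apply, mono_zero, TrivSqZeroExt.fst_inl, coeff_one_zero,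
      smul_eq_mul, mul_one, Nat.cast_zero, zero_div, add_zero] at h5
    by_cases hw : b - a - 3 / 2 = n / 2
    · have h6 : c = 0 := hc n hw
      rw [h4, h6, zero_smul]
    · have h6 : c * (b - a - 3 / 2 - n / 2) = 0 := by linear_combination -h5
      rcases mul_eq_zero.1 h6 with h7 | h7
      · rw [h4, h7, zero_smul]
      · exact absurd (sub_eq_zero.1 h7) hw
  induction n with
  | zero => exact key 0 (by rw [h.opD_comm, opD_mono_zero, map_zero, neg_zero])
  | succ n ih =>
    obtain ⟨c, -, hc'⟩ := exists_opD_mono n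
    exact key (n + 1) (by rw [h.opD_comm, hc', map_smul, ih, smul_zero, neg_zero])

/-- A relative cochain is determined by its value at `ξ x²`. -/
lemma eq_zero_of_gen (h : IsRelCochain a b γ) (h0 : γ gen = 0) : γ = 0 := by
  -- Bracketing with `x²` climbs from `ξ x²` through all `ξ xⁿ⁺²`, with non-zero factors.
  have hodd : ∀ n : ℕ, γ (.inr (X ^ (n + 2))) = 0 := by
    intro n
    induction n with
    | zero => exact h0
    | succ n ih =>
      ext1 G
      have h1 := h.even (X ^ 2) inl_X_sq_mem (.inr (X ^ (n + 2))) G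
      rw [bracket_X_sq_inr, map_smul, ih] at h1
      simp only [LinearMap.smul_apply, LinearMap.zero_apply, map_zero, sub_zero] at h1
      exact (smul_eq_zero.1 h1).resolve_left (Nat.cast_add_one_ne_zero n)
  refine linearMap_ext_mono fun n => ?_
  rw [LinearMap.zero_apply]
  obtain ⟨k, rfl | rfl⟩ := exists_eq_two_mul_or n
  · rw [mono_two_mul]
    match k with
    | 0 => exact h.conf _ (by simpa using inl_one_mem)
    | 1 => exact h.conf _ (by simpa using inl_X_mem)
    | 2 => exact h.conf _ inl_X_sq_mem
    | k + 3 =>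
      ext1 G
      -- The even elements outside `𝔰` are brackets of `ξ x` with the odd ones.
      have h1 := h.odd X (X ^ (k + 2)) inr_X_mem G
      rw [bracket_inr_inr, map_smul, hodd, ← pow_succ'] at h1
      simp only [LinearMap.smul_apply, LinearMap.zero_apply, map_zero, add_zero] at h1
      exact (smul_eq_zero.1 h1).resolve_left (by norm_num)
  · rw [mono_two_mul_add_one]
    match k with
    | 0 => exact h.conf _ (by simpa using inr_one_mem)
    | 1 => exact h.conf _ (by simpa using inr_X_mem)
    | k + 2 => exact hodd k

/-- For given weights at most one `n` is possible, so the space of relative cochains between two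
density modules is at most one-dimensional, and the constant term in that degree is its coordinate.
-/
lemma eq_zero (h : IsRelCochain a b γ)
    (hc : ∀ n : ℕ, b - a - 3 / 2 = n / 2 → cc (γ gen (mono n)) = 0) : γ = 0 :=
  h.eq_zero_of_gen (linearMap_ext_mono fun n => h.gen_mono_eq_zero hc n)

end IsRelCochain

variable {ι : Type*} [DecidableEq ι]

/-- A representation on a sum of copies of `ℂ[x, ξ]` for which the conformal subalgebra acts
diagonally, the copy of index `i` being `𝔽(lam + m i / 2)` with parity shifted by `m i`. -/
structure IsGraded (A : SuperAction (ι → SPoly)) (lam : ℂ) (m : ι → ℕ) : Prop where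
  isRep : A.IsRep
  par : ∀ g i, A.par g i = sign (m i : ZMod 2) • eps (g i)
  conf : ∀ F ∈ conformal, ∀ g i, A.act F g i = (tensorDensity (lam + m i / 2)).act F (g i)

/-- The matrix entries of an action on a sum of copies of `ℂ[x, ξ]`. -/
def entry (A : SuperAction (ι → SPoly)) (i j : ι) : SPoly →ₗ[ℂ] SPoly →ₗ[ℂ] SPoly :=
  (A.act.compr₂ (LinearMap.proj j)).compl₂ (LinearMap.single ℂ (fun _ => SPoly) i)

lemma entry_apply (A : SuperAction (ι → SPoly)) (i j : ι) (F G : SPoly) :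
    entry A i j F G = A.act F (Pi.single i G) j := rfl

lemma act_eq_sum_entry [Fintype ι] (A : SuperAction (ι → SPoly)) (F : SPoly) (g : ι → SPoly) (j : ι) :
    A.act F g j = ∑ i, entry A i j F (g i) := by
  conv_lhs => rw [← Finset.univ_sum_single g]
  rw [map_sum, Finset.sum_apply]
  rfl

/-- The coefficient of `1` in the image of the monomial of degree `n` under the action of
`ξ x²`. -/
def coef (A : SuperAction (ι → SPoly)) (i j : ι) (n : ℕ) : ℂ := cc (entry A i j gen (mono n))

/-- The direct sum of the modules `𝔽(lam + m i / 2)`. -/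
def densitySum (lam : ℂ) (m : ι → ℕ) : SuperAction (ι → SPoly) where
  par := LinearMap.pi fun i => sign (m i : ZMod 2) • eps ∘ₗ LinearMap.proj i
  act :=
    { toFun := fun F => LinearMap.pi fun i =>
        (tensorDensity (lam + m i / 2)).act F ∘ₗ LinearMap.proj i
      map_add' := fun F G => by ext g i <;> simp
      map_smul' := fun c F => by ext g i <;> simp }

lemma densitySum_act (lam : ℂ) (m : ι → ℕ) (F : SPoly) (g : ι → SPoly) (i : ι) :
    (densitySum lam m).act F g i = (tensorDensity (lam + m i / 2)).act F (g i) := rfl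

lemma isGraded_densitySum (lam : ℂ) (m : ι → ℕ) : IsGraded (densitySum lam m) lam m where
  isRep :=
    { par_par := fun v => by
        funext i
        have h1 : (tensorDensity 0).par = eps := rfl
        change sign _ • eps (sign _ • eps (v i)) = v i
        rw [map_smul, smul_smul, sign_mul_self, one_smul, ← h1, (tensorDensity_isRep 0).par_par]
      par_act := fun F v => by
        funext i
        have := (tensorDensity_isRep (lam + m i / 2)).par_act F (v i)
        change sign _ • eps _ = (tensorDensity (lam + m i / 2)).act _ (sign _ • eps (v i))
        rw [map_smul]
        exact congrArg _ this
      act_bracket := fun F G v => by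
        funext i
        exact (tensorDensity_isRep (lam + m i / 2)).act_bracket F G (v i) }
  par _ _ := rfl
  conf _ _ _ _ := rfl

namespace IsGraded

variable {A B : SuperAction (ι → SPoly)} {lam : ℂ} {m : ι → ℕ}

lemma conf_single (h : IsGraded A lam m) {F : SPoly} (hF : F ∈ conformal) (i : ι) (G : SPoly) :
    A.act F (Pi.single i G) = Pi.single i ((tensorDensity (lam + m i / 2)).act F G) := by
  funext j
  rw [h.conf F hF]
  by_cases hj : j = i
  · subst hj; simp
  · simp [hj]

/-- Since `𝔰` acts diagonally, the bracket relation with one argument in `𝔰` is linear in the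
entries. Taking a difference of two graded actions makes the cochain vanish on `𝔰`, also for `i =
j`. -/
lemma isRelCochain (h : IsGraded A lam m) (h' : IsGraded B lam m) (i j : ι) :
    IsRelCochain (lam + m i / 2) (lam + m j / 2) (entry A i j - entry B i j) where
  conf F hF := by
    ext1 G
    rw [LinearMap.sub_apply, LinearMap.sub_apply, entry_apply, entry_apply, h.conf F hF,
      h'.conf F hF, sub_self, LinearMap.zero_apply]
  even f hf H G := by
    simp only [LinearMap.sub_apply, entry_apply, h.isRep.bracket_inl, h'.isRep.bracket_inl,
      Pi.sub_apply, map_sub, h.conf_single hf, h'.conf_single hf, h.conf _ hf, h'.conf _ hf]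
    abel
  odd f g hf G := by
    simp only [LinearMap.sub_apply, entry_apply, h.isRep.bracket_inr_inr,
      h'.isRep.bracket_inr_inr, Pi.add_apply, map_sub, h.conf_single hf, h'.conf_single hf,
      h.conf _ hf, h'.conf _ hf]
    abel

/-- An entry is known as soon as its single scalar is. The offset `3` is twice the weight of `ξ x²`.
-/
lemma entry_eq (h : IsGraded A lam m) (h' : IsGraded B lam m) (i j : ι)
    (hc : ∀ n, m j = m i + 3 + n → coef A i j n = coef B i j n) : entry A i j = entry B i j := by
  rw [← sub_eq_zero]
  refine (h.isRelCochain h' i j).eq_zero fun n hn => ?_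
  rw [LinearMap.sub_apply, LinearMap.sub_apply, map_sub, sub_eq_zero]
  refine hc n ?_
  have h1 : (m j : ℂ) = m i + 3 + n := by linear_combination 2 * hn
  exact_mod_cast h1

lemma entry_densitySum_ne {i j : ι} (hij : i ≠ j) : entry (densitySum lam m) i j = 0 := by
  ext1 F; ext1 G
  rw [entry_apply, densitySum_act, Pi.single_eq_of_ne hij.symm, map_zero]
  rfl

lemma entry_eq_zero (h : IsGraded A lam m) {i j : ι} (hij : i ≠ j)
    (hc : ∀ n, m j = m i + 3 + n → coef A i j n = 0) : entry A i j = 0 := by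
  rw [← entry_densitySum_ne (lam := lam) (m := m) hij]
  refine h.entry_eq (isGraded_densitySum lam m) i j fun n hn => ?_
  rw [hc n hn, coef, entry_densitySum_ne hij]
  simp

lemma entry_eq_zero_of_lt (h : IsGraded A lam m) {i j : ι} (hij : i ≠ j)
    (hc : m j < m i + 3) : entry A i j = 0 :=
  h.entry_eq_zero hij fun n hn => by omega

lemma entry_self (h : IsGraded A lam m) (i : ι) :
    entry A i i = (tensorDensity (lam + m i / 2)).act := by
  rw [h.entry_eq (isGraded_densitySum lam m) i i fun n hn => by omega]
  ext1 F; ext1 G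
  rw [entry_apply, densitySum_act, Pi.single_eq_same]

lemma ext [Fintype ι] (h : IsGraded A lam m) (h' : IsGraded B lam m)
    (hc : ∀ i j n, m j = m i + 3 + n → coef A i j n = coef B i j n) : A = B := by
  have h1 : A.par = B.par := by
    refine LinearMap.ext fun g => ?_
    funext i; rw [h.par, h'.par]
  have h2 : A.act = B.act := by
    refine LinearMap.ext fun F => LinearMap.ext fun g => ?_
    funext j
    simp only [act_eq_sum_entry, fun i => h.entry_eq h' i j (hc i j)]
  cases A; cases B
  simp_all

/-- The conformal generators are the brackets of `ξ` and `ξ x`. -/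
lemma conf_of_generators (hA : A.IsRep)
    (h1 : ∀ g i, A.act (.inr 1) g i = (tensorDensity (lam + m i / 2)).act (.inr 1) (g i))
    (hX : ∀ g i, A.act (.inr X) g i = (tensorDensity (lam + m i / 2)).act (.inr X) (g i)) :
    ∀ F ∈ conformal, ∀ g i, A.act F g i = (tensorDensity (lam + m i / 2)).act F (g i) := by
  have hmul : ∀ f f' : ℂ[X],
      (∀ g i, A.act (.inr f) g i = (tensorDensity (lam + m i / 2)).act (.inr f) (g i)) →
      (∀ g i, A.act (.inr f') g i = (tensorDensity (lam + m i / 2)).act (.inr f') (g i)) →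
      ∀ g i, A.act (.inl (f * f')) g i =
        (tensorDensity (lam + m i / 2)).act (.inl (f * f')) (g i) := by
    intro f f' hf hf' g i
    have h2 := congrFun (hA.bracket_inr_inr f f' g) i
    have h3 := (tensorDensity_isRep (lam + m i / 2)).bracket_inr_inr f f' (g i)
    rw [Pi.add_apply, hf (A.act _ g), hf' (A.act _ g), hf, hf', ← h3, bracket_inr_inr, map_smul, map_smul,
      LinearMap.smul_apply, LinearMap.smul_apply, Pi.smul_apply] at h2
    exact smul_right_injective _ (by norm_num : (1 / 2 : ℂ) ≠ 0) h2
  intro F hF g i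
  induction hF using Submodule.span_induction with
  | mem F hF =>
    simp only [Set.mem_insert_iff, Set.mem_singleton_iff] at hF
    rcases hF with rfl | rfl | rfl | rfl | rfl
    · simpa using hmul 1 1 h1 h1 g i
    · exact h1 g i
    · simpa using hmul 1 X h1 hX g i
    · exact hX g i
    · simpa [sq] using hmul X X hX hX g i
  | zero => simp
  | add F F' _ _ h h' => rw [map_add, map_add, LinearMap.add_apply, Pi.add_apply, h, h']; rfl
  | smul c F _ h => rw [map_smul, map_smul, LinearMap.smul_apply, Pi.smul_apply, h]; rfl

/-! ### The Maurer–Cartan relation -/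

/-- The brackets `{ξ x², ξ x²}` and `{ξ x, ξ x³}` are both `½ x⁴`, and `ξ x³ = {x², ξ x²}`. The
outputs of `ξ x` and `x²` have no constant term, so only one of the terms survives `cc`. -/
lemma cc_act_gen_act_gen (h : IsGraded A lam m) (g : ι → SPoly) (j : ι) :
    2 * cc (A.act gen (A.act gen g) j) =
      -cc (A.act gen (A.act (.inl (X ^ 2)) (A.act (.inr X) g)) j) := by
  have h1 := h.isRep.bracket_inr_inr (X ^ 2) (X ^ 2) g
  have h2 := h.isRep.bracket_inr_inr X (X ^ 3) g
  rw [bracket_inr_inr, ← pow_add] at h1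
  rw [bracket_inr_inr, ← pow_succ'] at h2
  rw [h2] at h1
  have h3 : ∀ v, A.act (.inr (X ^ 3)) v =
      A.act (.inl (X ^ 2)) (A.act gen v) - A.act gen (A.act (.inl (X ^ 2)) v) := by
    intro v
    have h4 := h.isRep.bracket_inl (X ^ 2) gen v
    have h5 := bracket_X_sq_inr 0
    simp only [Nat.cast_zero, zero_add, one_smul] at h5
    rwa [h5] at h4
  have h6 := congrArg cc (congrFun h1 j)
  rw [h3 (A.act (.inr X) g)] at h6
  simp only [Pi.add_apply, Pi.sub_apply, map_add, map_sub, h.conf _ inr_X_mem,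
    h.conf _ inl_X_sq_mem, cc_inr_mul_X, cc_inl_X_sq] at h6
  rw [two_mul, ← h6]
  ring

/-- The preceding identity expanded over the intermediate component. The term through `j` itself
drops out because `ξ x²` acting on a density has no constant term; the term through `i` is moved to
the left. -/
lemma maurerCartan [Fintype ι] (h : IsGraded A lam m) {i j : ι} (hij : i ≠ j) (G : SPoly) :
    cc (entry A i j gen ((tensorDensity (lam + m i / 2)).act (.inl (X ^ 2))
        ((tensorDensity (lam + m i / 2)).act (.inr X) G)
        + (2 : ℂ) • (tensorDensity (lam + m i / 2)).act gen G)) =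
      -2 * ∑ l ∈ (Finset.univ.erase i).erase j, cc (entry A l j gen (entry A i l gen G)) := by
  have h1 := h.cc_act_gen_act_gen (Pi.single i G) j
  rw [h.conf_single inr_X_mem, h.conf_single inl_X_sq_mem, act_eq_sum_entry, map_sum,
    ← Finset.add_sum_erase _ _ (Finset.mem_univ i),
    ← Finset.add_sum_erase _ _ (Finset.mem_erase.2 ⟨hij.symm, Finset.mem_univ j⟩)] at h1
  simp only [← entry_apply] at h1
  rw [h.entry_self i, h.entry_self j, cc_gen] at h1
  rw [map_add, map_add, map_smul, map_smul, smul_eq_mul]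
  linear_combination h1

/-- The factor by which the Maurer–Cartan relation multiplies a coefficient in degree `n + 6`. -/
def mcFactor (L : ℂ) (n : ℕ) : ℂ :=
  if Even n then (((n / 2 : ℕ) + 2 * L) * ((n / 2 : ℕ) + 1 + 2 * L) + 2 * (n / 2 : ℕ) + 8 * L) / 2
  else ((n / 2 : ℕ) + 3 + 2 * L) / 2

lemma mcFactor_spec (L : ℂ) (n : ℕ) :
    (tensorDensity L).act (.inl (X ^ 2)) ((tensorDensity L).act (.inr X) (mono n))
        + (2 : ℂ) • (tensorDensity L).act gen (mono n) = mcFactor L n • mono (n + 3) := by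
  obtain ⟨a, rfl | rfl⟩ := exists_eq_two_mul_or n
  · rw [density_inr_X_even, map_smul, density_inl_X_sq_odd, density_gen_even, smul_smul,
      smul_smul, ← add_smul, mcFactor, if_pos (by simp), Nat.mul_div_cancel_left _ two_pos]
    congr 1
    ring
  · have h1 : ¬ Even (2 * a + 1) := by simp
    have h2 : (2 * a + 1) / 2 = a := by omega
    rw [density_inr_X_odd, map_smul, show 2 * a + 2 = 2 * (a + 1) by ring,
      density_inl_X_sq_even, density_gen_odd, smul_smul,
      smul_smul, show 2 * (a + 1) + 2 = 2 * a + 1 + 3 by ring,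
      show 2 * a + 4 = 2 * a + 1 + 3 by ring, ← add_smul, mcFactor, if_neg h1, h2]
    congr 1
    push_cast
    ring

/-- The quadratic recursion for the scalars: where `mcFactor` is non-zero, an entry spanning at
least six half-steps is determined by the entries through the components between. -/
lemma mcFactor_mul_coef [Fintype ι] (h : IsGraded A lam m) {i j : ι} (hij : i ≠ j) (n : ℕ) :
    mcFactor (lam + m i / 2) n * coef A i j (n + 3) =
      -2 * ∑ l ∈ (Finset.univ.erase i).erase j,
        cc (entry A l j gen (entry A i l gen (mono n))) := by
  rw [← h.maurerCartan hij, mcFactor_spec, map_smul, map_smul]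
  rfl

end IsGraded

end Graded

section Uniserial

/-! ## Uniserial modules -/

namespace SuperAction

variable {V W : Type*} [AddCommGroup V] [Module ℂ V] [AddCommGroup W] [Module ℂ W]

lemma eq_of_par_of_act {A B : SuperAction V} (hp : ∀ v, A.par v = B.par v)
    (ha : A.act = B.act) : A = B := by
  have hp' : A.par = B.par := LinearMap.ext hp
  cases A; cases B
  simp_all

lemma Invariant.inf {A : SuperAction V} {U U' : Submodule ℂ V} (h : A.Invariant U)
    (h' : A.Invariant U') : A.Invariant (U ⊓ U') :=
  ⟨fun v hv => ⟨h.1 v hv.1, h'.1 v hv.2⟩,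
    fun F _ v hv => ⟨h.2 F trivial v hv.1, h'.2 F trivial v hv.2⟩⟩

lemma Invariant.sup {A : SuperAction V} {U U' : Submodule ℂ V} (h : A.Invariant U)
    (h' : A.Invariant U') : A.Invariant (U ⊔ U') := by
  refine ⟨fun v hv => ?_, fun F _ v hv => ?_⟩ <;>
  obtain ⟨u, hu, u', hu', rfl⟩ := Submodule.mem_sup.1 hv <;> rw [map_add]
  · exact Submodule.add_mem_sup (h.1 u hu) (h'.1 u' hu')
  · exact Submodule.add_mem_sup (h.2 F trivial u hu) (h'.2 F trivial u' hu')

/-- A module is uniserial if and only if its submodules form a chain. -/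
lemma uniserial_iff {A : SuperAction V} :
    A.Uniserial ↔ ∀ U U', A.Invariant U → A.Invariant U' → U ≤ U' ∨ U' ≤ U := by
  constructor
  · intro h U U' hU hU'
    -- The subquotient `(U + U') / (U ∩ U')` is the direct sum of the images of `U` and `U'`, so
    -- indecomposability makes one of them vanish.
    set M := U ⊔ U' with hM
    set N := U ⊓ U' with hN
    have hiM : A.Invariant M := hU.sup hU'
    have hiN : A.Invariant N := hU.inf hU'
    let π := (N.submoduleOf M).mkQ
    have hinv : ∀ Y : Submodule ℂ V, A.Invariant Y →
        (A.subquotient M N hiM hiN).Invariant ((Y.submoduleOf M).map π) := by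
      intro Y hY
      refine ⟨?_, ?_⟩
      · rintro _ ⟨y, hy, rfl⟩
        exact ⟨⟨A.par y, hiM.1 _ y.2⟩, hY.1 _ hy, rfl⟩
      · rintro F - _ ⟨y, hy, rfl⟩
        exact ⟨⟨A.act F y, hiM.2 F trivial _ y.2⟩, hY.2 F trivial _ hy, rfl⟩
    have hsub : ∀ Y : Submodule ℂ V, Y ≤ M → (Y.submoduleOf M).map π = ⊥ → Y ≤ N := by
      intro Y hYM hY y hy
      have h1 : π ⟨y, hYM hy⟩ ∈ (Y.submoduleOf M).map π := ⟨_, hy, rfl⟩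
      rw [hY, Submodule.mem_bot] at h1
      exact (Submodule.Quotient.mk_eq_zero (N.submoduleOf M)).1 h1
    have hcompl : IsCompl ((U.submoduleOf M).map π) ((U'.submoduleOf M).map π) := by
      constructor
      · rw [Submodule.disjoint_def]
        rintro _ ⟨y, hy, rfl⟩ ⟨y', hy', hyy'⟩
        have h1 : (y' - y : M) ∈ N.submoduleOf M := by
          rw [← Submodule.Quotient.mk_eq_zero, Submodule.Quotient.mk_sub, sub_eq_zero]
          exact hyy'
        have h2 : (y' : V) - y ∈ N := h1
        have hy2 : (y' : V) ∈ U' := hy'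
        have h3 : (y : V) ∈ U' := by
          have := U'.sub_mem hy2 (hN ▸ h2 : (y' : V) - y ∈ U ⊓ U').2
          rwa [sub_sub_cancel] at this
        exact (Submodule.Quotient.mk_eq_zero _).2 (show (y : V) ∈ N from ⟨hy, h3⟩)
      · rw [codisjoint_iff, eq_top_iff]
        intro x _
        induction x using Submodule.Quotient.induction_on with
        | H z =>
          obtain ⟨u, hu, u', hu', hz⟩ := Submodule.mem_sup.1 z.2
          have h1 : z = ⟨u, le_sup_left (a := U) hu⟩ + ⟨u', le_sup_right (b := U') hu'⟩ :=
            Subtype.ext hz.symm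
          rw [h1]
          exact Submodule.add_mem_sup (Submodule.mem_map_of_mem (f := π) hu)
            (Submodule.mem_map_of_mem (f := π) hu')
    rcases h M N hiM hiN (inf_le_left.trans le_sup_left) _ _ (hinv U hU) (hinv U' hU') hcompl
      with h1 | h1
    · exact Or.inl ((hsub U le_sup_left h1).trans inf_le_right)
    · exact Or.inr ((hsub U' le_sup_right h1).trans inf_le_left)
  · intro h M N hM hN hNM U U' hU hU' hUU'
    have hinv : ∀ Y, (A.subquotient M N hM hN).Invariant Y →
        A.Invariant ((Y.comap (N.submoduleOf M).mkQ).map M.subtype) := by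
      intro Y hY
      refine ⟨?_, ?_⟩
      · rintro _ ⟨y, hy, rfl⟩
        exact ⟨⟨A.par y, hM.1 _ y.2⟩, hY.1 _ hy, rfl⟩
      · rintro F - _ ⟨y, hy, rfl⟩
        exact ⟨⟨A.act F y, hM.2 F trivial _ y.2⟩, hY.2 F trivial _ hy, rfl⟩
    have hle : ∀ Y Y' : Submodule ℂ (M ⧸ N.submoduleOf M),
        (Y.comap (N.submoduleOf M).mkQ).map M.subtype ≤
          (Y'.comap (N.submoduleOf M).mkQ).map M.subtype → Y ≤ Y' := by
      intro Y Y' hY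
      rw [Submodule.map_le_map_iff_of_injective M.injective_subtype] at hY
      intro y hy
      induction y using Submodule.Quotient.induction_on with
      | H z => exact hY (x := z) hy
    rcases h _ _ (hinv U hU) (hinv U' hU') with h1 | h1
    · exact Or.inl (hUU'.disjoint.eq_bot_of_le (hle _ _ h1))
    · exact Or.inr (hUU'.symm.disjoint.eq_bot_of_le (hle _ _ h1))

lemma EvenEquiv.uniserial {A : SuperAction V} {B : SuperAction W} (h : A.EvenEquiv B)
    (hA : A.Uniserial) : B.Uniserial := by
  rw [uniserial_iff] at hA ⊢
  obtain ⟨φ, h1, h2⟩ := h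
  have hinv : ∀ U, B.Invariant U → A.Invariant (U.comap φ.toLinearMap) := fun U hU =>
    ⟨fun v hv => by
      rw [Submodule.mem_comap, LinearEquiv.coe_coe, h1]; exact hU.1 _ hv,
     fun F _ v hv => by
      rw [Submodule.mem_comap, LinearEquiv.coe_coe, h2]; exact hU.2 F trivial _ hv⟩
  intro U U' hU hU'
  have := hA _ _ (hinv U hU) (hinv U' hU')
  rwa [Submodule.comap_le_comap_iff_of_surjective φ.surjective,
    Submodule.comap_le_comap_iff_of_surjective φ.surjective] at this

end SuperAction

/-! ## Submodules of density modules -/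

/-- As `D² = ∂ₓ`, repeated application of `D` lowers the degree until only a non-zero constant is
left, which `D` kills. -/
lemma exists_opD_pow_eq_C {F : SPoly} (hF : F ≠ 0) :
    ∃ (k : ℕ) (c : ℂ), c ≠ 0 ∧ (opD ^ k : Module.End ℂ SPoly) F = c • mono 0 := by
  have key : ∀ (d : ℕ) (F : SPoly), F.fst.natDegree ≤ d → F.snd.natDegree ≤ d → F ≠ 0 →
      ∃ (k : ℕ) (c : ℂ), c ≠ 0 ∧ (opD ^ k : Module.End ℂ SPoly) F = c • mono 0 := by
    intro d
    have hconst : ∀ F : SPoly, opD F = 0 → F ≠ 0 → ∃ (k : ℕ) (c : ℂ), c ≠ 0 ∧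
        (opD ^ k : Module.End ℂ SPoly) F = c • mono 0 := by
      intro F h0 hF
      have h1 := eq_inl_C_of_opD_eq_zero h0
      refine ⟨0, F.fst.coeff 0, fun h => hF ?_, ?_⟩
      · rw [h1, h]; simp
      · rw [mono_zero, ← TrivSqZeroExt.inl_smul, smul_eq_C_mul, mul_one, pow_zero]
        exact h1
    have hstep : ∀ F : SPoly, (∃ (k : ℕ) (c : ℂ), c ≠ 0 ∧
        (opD ^ k : Module.End ℂ SPoly) (opD F) = c • mono 0) → ∃ (k : ℕ) (c : ℂ), c ≠ 0 ∧
        (opD ^ k : Module.End ℂ SPoly) F = c • mono 0 := by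
      rintro F ⟨k, c, hc, h⟩
      exact ⟨k + 1, c, hc, by rw [pow_succ]; exact h⟩
    induction d with
    | zero =>
      intro F h1 h2 hF
      by_cases h0 : opD F = 0
      · exact hconst F h0 hF
      · refine hstep F (hconst _ ?_ h0)
        refine TrivSqZeroExt.ext ?_ ?_
        · simp [derivative_of_natDegree_zero (Nat.le_zero.1 h1)]
        · simp [derivative_of_natDegree_zero (Nat.le_zero.1 h2)]
    | succ d ih =>
      intro F h1 h2 hF
      by_cases h0 : opD F = 0
      · exact hconst F h0 hF
      by_cases h0' : opD (opD F) = 0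
      · exact hstep F (hconst _ h0' h0)
      refine hstep F (hstep _ (ih _ ?_ ?_ h0'))
      · have := natDegree_derivative_le F.fst
        simp only [opD_fst, opD_snd]; omega
      · have := natDegree_derivative_le F.snd
        simp only [opD_fst, opD_snd]; omega
  exact key (max F.fst.natDegree F.snd.natDegree) F (le_max_left _ _) (le_max_right _ _) hF

/-- A submodule of `𝔽(mu)` that contains a non-constant element is everything. -/
lemma eq_top_of_opD_ne_zero {mu : ℂ} {U : Submodule ℂ SPoly} (heps : ∀ F ∈ U, eps F ∈ U)
    (hact : ∀ F, ∀ G ∈ U, (tensorDensity mu).act F G ∈ U) {G : SPoly} (hG : G ∈ U)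
    (h0 : opD G ≠ 0) : U = ⊤ := by
  have hD : ∀ F ∈ U, opD F ∈ U := by
    intro F hF
    have := hact (.inr 1) F hF
    rwa [density_inr_one, Submodule.smul_mem_iff _ (by norm_num)] at this
  obtain ⟨k, c, hc, hk⟩ := exists_opD_pow_eq_C h0
  have hpow : ∀ k : ℕ, ∀ F ∈ U, (opD ^ k : Module.End ℂ SPoly) F ∈ U := by
    intro k
    induction k with
    | zero => intro F hF; exact hF
    | succ k ih => intro F hF; rw [pow_succ]; exact ih _ (hD F hF)
  have h1 : mono 1 ∈ U := by
    set H := (opD ^ k : Module.End ℂ SPoly) G with hH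
    have hHU : H ∈ U := hpow k G hG
    have hDH : opD H = c • mono 0 := by
      rw [← hk, hH, ← Module.End.mul_apply, ← Module.End.mul_apply, ← pow_succ, ← pow_succ']
    -- The odd part of an element that `D` sends to a constant is a multiple of `ξ`; invariance
    -- under `ε` isolates it.
    have h2 : H - eps H = (2 * c) • mono 1 := by
      have h3 : H.snd = C c := by
        have := congrArg TrivSqZeroExt.fst hDH
        simpa [mono_zero, smul_eq_C_mul] using this
      rw [mono_one]
      refine TrivSqZeroExt.ext ?_ ?_
      · simp
      · simp [h3, smul_eq_C_mul, C_ofNat]; ring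
    have h3 := U.sub_mem hHU (heps H hHU)
    rwa [h2, Submodule.smul_mem_iff _ (by simpa using hc)] at h3
  have hodd : ∀ a : ℕ, mono (2 * a + 1) ∈ U ∧ mono (2 * a) ∈ U := by
    have hlow : ∀ n, mono (n + 1) ∈ U → mono n ∈ U := by
      intro n hn
      obtain ⟨c, hc, h⟩ := exists_opD_mono n
      have := hD _ hn
      rwa [h, Submodule.smul_mem_iff _ hc] at this
    intro a
    induction a with
    | zero => exact ⟨h1, hlow 0 h1⟩
    | succ a ih =>
      -- The element `ξ x²` sends `ξ xᵃ` to `½ xᵃ⁺²` whatever the weight, so this ascent never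
      -- stalls; only the constants could be left behind.
      have h2 := hact gen _ ih.1
      rw [density_gen_odd, Submodule.smul_mem_iff _ (by norm_num)] at h2
      have h3 : mono (2 * (a + 1) + 1) ∈ U := hlow _ h2
      exact ⟨h3, hlow _ h3⟩
  rw [eq_top_iff]
  intro F _
  induction F using mono_induction with
  | hadd F F' h h' => exact U.add_mem (h trivial) (h' trivial)
  | hsmul c n =>
    refine U.smul_mem c ?_
    obtain ⟨a, rfl | rfl⟩ := exists_eq_two_mul_or n
    exacts [(hodd a).2, (hodd a).1]

/-! ## The flag of a graded module -/

/-- The elements whose first `s` components vanish. -/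
def filt (n s : ℕ) : Submodule ℂ (Fin n → SPoly) where
  carrier := {g | ∀ i : Fin n, i.val < s → g i = 0}
  add_mem' hf hg i hi := by simp [hf i hi, hg i hi]
  zero_mem' i _ := rfl
  smul_mem' c g hg i hi := by simp [hg i hi]

section Flag

variable {n : ℕ}

lemma filt_mono {s t : ℕ} (h : s ≤ t) : filt n t ≤ filt n s :=
  fun _ hg i hi => hg i (hi.trans_le h)

lemma filt_zero : filt n 0 = ⊤ := eq_top_iff.2 fun _ _ _ h => absurd h (Nat.not_lt_zero _)

lemma filt_self : filt n n = ⊥ := eq_bot_iff.2 fun _ hg => funext fun i => hg i i.2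

lemma single_mem_filt {s : ℕ} {i : Fin n} (h : s ≤ i.val) (G : SPoly) :
    (Pi.single i G : Fin n → SPoly) ∈ filt n s := fun j hj =>
  Pi.single_eq_of_ne (fun hji => by subst hji; omega) _

lemma sub_single_mem_filt {r : Fin n} {g : Fin n → SPoly} (hg : g ∈ filt n r) :
    g - Pi.single r (g r) ∈ filt n (r + 1) := by
  intro i hi
  rw [Pi.sub_apply]
  by_cases h : i = r
  · subst h; simp
  · have : i.val ≠ r.val := fun h' => h (Fin.ext h')
    rw [hg i (by omega), Pi.single_eq_of_ne h, sub_zero]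

end Flag

namespace IsGraded

variable {n : ℕ} {A : SuperAction (Fin n → SPoly)} {lam : ℂ} {m : Fin n → ℕ}

lemma invariant_filt (h : IsGraded A lam m) (hm : StrictMono m) (s : ℕ) :
    A.Invariant (filt n s) := by
  refine ⟨fun g hg i hi => ?_, fun F _ g hg j hj => ?_⟩
  · rw [h.par, hg i hi, map_zero, smul_zero]
  · rw [act_eq_sum_entry]
    refine Finset.sum_eq_zero fun i _ => ?_
    rcases lt_or_ge j i with hji | hij
    · have : m j < m i := hm hji
      rw [h.entry_eq_zero_of_lt hji.ne' (by omega)]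
      rfl
    · rw [hg i (lt_of_le_of_lt hij hj), map_zero]

/-- The action on the leading component. -/
lemma act_apply_of_mem_filt (h : IsGraded A lam m) (hm : StrictMono m) {r : Fin n}
    {g : Fin n → SPoly} (hg : g ∈ filt n r) (F : SPoly) :
    A.act F g r = (tensorDensity (lam + m r / 2)).act F (g r) := by
  have h1 := (h.invariant_filt hm (r + 1)).2 F trivial _ (sub_single_mem_filt hg) r (by omega)
  rw [map_sub, Pi.sub_apply, sub_eq_zero] at h1
  rw [h1, ← entry_apply, h.entry_self]

lemma isPresentation_filt (h : IsGraded A lam m) (hm : StrictMono m) (r : Fin n) :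
    A.IsPresentation (filt n r) (filt n (r + 1)) (LinearMap.proj r)
      (LinearMap.single ℂ (fun _ => SPoly) r) where
  inv_left := h.invariant_filt hm _
  inv_right := h.invariant_filt hm _
  mem w := single_mem_filt le_rfl w
  apply_apply w := by simp
  mem_iff v hv := by
    refine ⟨fun hv' => hv' r (Nat.lt_succ_self _), fun hv' i hi => ?_⟩
    by_cases hir : i = r
    · subst hir; exact hv'
    · have : i.val ≠ r.val := fun h' => hir (Fin.ext h')
      exact hv i (by omega)

lemma compress_eq (h : IsGraded A lam m) (r : Fin n) :
    A.compress (LinearMap.proj r) (LinearMap.single ℂ (fun _ => SPoly) r) =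
      (tensorDensity (lam + m r / 2)).shift (m r) := by
  refine SuperAction.eq_of_par_of_act (fun w => ?_) ?_
  · rw [SuperAction.shift_par, SuperAction.compress_par]
    simp [h.par, tensorDensity]
  · rw [SuperAction.shift_act, ← h.entry_self r]
    rfl

lemma isSplitExtension (h : IsGraded A lam m) (hm : StrictMono m) :
    A.IsSplitExtension fun r => (tensorDensity (lam + m r / 2)).shift (m r) := by
  refine ⟨h.isRep, fun s => filt n s, fun s => h.invariant_filt hm _, filt_zero, filt_self,
    fun r => ⟨filt_mono (Nat.le_succ _), ?_, LinearMap.range (LinearMap.single ℂ (fun _ => SPoly) r), ?_, ?_, ?_⟩⟩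
  · have h1 := (h.isPresentation_filt hm r).evenEquiv
    rw [h.compress_eq] at h1
    exact h1
  · refine ⟨?_, ?_⟩
    · rintro _ ⟨G, rfl⟩
      refine ⟨sign (m r : ZMod 2) • eps G, ?_⟩
      funext i
      rw [h.par]
      by_cases hi : i = r
      · subst hi; simp
      · simp [hi]
    · rintro F hF _ ⟨G, rfl⟩
      exact ⟨_, (h.conf_single hF r G).symm⟩
  · refine le_antisymm (sup_le ?_ (filt_mono (Nat.le_succ _))) fun g hg => ?_
    · rintro _ ⟨G, rfl⟩
      exact single_mem_filt le_rfl G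
    · rw [← add_sub_cancel (Pi.single r (g r)) g]
      exact Submodule.add_mem_sup ⟨g r, rfl⟩ (sub_single_mem_filt hg)
  · rw [← disjoint_iff, Submodule.disjoint_def]
    rintro _ ⟨G, rfl⟩ hG
    have := hG r (Nat.lt_succ_self _)
    simp at this
    simp [this]

end IsGraded

end Uniserial

/-! ### A criterion for graded modules to be uniserial. -/

section UniserialCriterion

namespace IsGraded

section Uniserial

variable {n : ℕ} {A : SuperAction (Fin n → SPoly)} {lam : ℂ} {m : Fin n → ℕ}
  {U : Submodule ℂ (Fin n → SPoly)}

lemma isRelCochain_of_ne (h : IsGraded A lam m) {i j : Fin n} (hij : i ≠ j) :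
    IsRelCochain (lam + m i / 2) (lam + m j / 2) (entry A i j) := by
  have := h.isRelCochain (isGraded_densitySum lam m) i j
  rw [entry_densitySum_ne hij] at this
  convert this using 1
  refine LinearMap.ext fun F => LinearMap.ext fun G => ?_
  rw [LinearMap.sub_apply, LinearMap.sub_apply]
  exact (sub_zero (entry A i j F G)).symm

lemma opD_pow_mem (h : IsGraded A lam m) (hU : A.Invariant U) {g : Fin n → SPoly} (hg : g ∈ U)
    (k : ℕ) : (fun i => (opD ^ k : Module.End ℂ SPoly) (g i)) ∈ U := by
  induction k with
  | zero => exact hg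
  | succ k ih =>
    have h1 := U.smul_mem (2 : ℂ) (hU.2 (.inr 1) trivial _ ih)
    convert h1 using 1
    funext i
    rw [Pi.smul_apply, h.conf _ inr_one_mem, density_inr_one, smul_smul, pow_succ']
    norm_num

/-- Modulo the later components, component `r` is a density module, and there a non-constant element
generates everything. -/
lemma filt_le_of_opD_ne_zero (h : IsGraded A lam m) (hm : StrictMono m) (hU : A.Invariant U)
    {r : Fin n} (hr : filt n (r + 1) ≤ U) {g : Fin n → SPoly} (hg : g ∈ U) (hgr : g ∈ filt n r)
    (h0 : opD (g r) ≠ 0) : filt n r ≤ U := by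
  have h1 : U.comap (LinearMap.single ℂ (fun _ => SPoly) r) = ⊤ := by
    refine eq_top_of_opD_ne_zero (mu := lam + m r / 2) (G := g r) (fun F hF => ?_)
      (fun F G hG => ?_) ?_ h0
    · have h2 := hU.1 _ hF
      have h3 : A.par (Pi.single r F) = sign (m r : ZMod 2) • Pi.single r (eps F) := by
        funext i
        rw [h.par]
        by_cases hi : i = r
        · subst hi; simp
        · simp [hi]
      rw [LinearMap.single_apply, h3, Submodule.smul_mem_iff _ (SuperAction.sign_ne_zero _)] at h2
      exact h2
    · have h2 := hU.2 F trivial _ hG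
      have hs : (Pi.single r G : Fin n → SPoly) ∈ filt n r := single_mem_filt le_rfl G
      have h3 := sub_single_mem_filt ((h.invariant_filt hm r).2 F trivial _ hs)
      rw [h.act_apply_of_mem_filt hm hs, Pi.single_eq_same] at h3
      have h4 := U.sub_mem h2 (hr h3)
      rwa [LinearMap.single_apply, sub_sub_cancel] at h4
    · have h2 := U.sub_mem hg (hr (sub_single_mem_filt hgr))
      rwa [sub_sub_cancel] at h2
  intro f hf
  have h2 : Pi.single r (f r) ∈ U := by
    have : f r ∈ U.comap (LinearMap.single ℂ (fun _ => SPoly) r) := by rw [h1]; trivial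
    exact this
  have h3 := U.add_mem h2 (hr (sub_single_mem_filt hf))
  rwa [add_sub_cancel] at h3

/-- A polynomial in `𝕏(x)` removes the components of higher weight. -/
lemma exists_aeval_eq_zero (h : IsGraded A lam m) (hm : StrictMono m) {r : Fin n}
    {g : Fin n → SPoly} (hg : g ∈ filt n (r + 1)) :
    ∃ p : ℂ[X], p.eval (lam + m r / 2 : ℂ) ≠ 0 ∧ aeval (A.act (.inl X)) p g = 0 := by
  set Q : (Fin n → SPoly) → Prop := fun g =>
    ∃ p : ℂ[X], p.eval (lam + m r / 2 : ℂ) ≠ 0 ∧ aeval (A.act (.inl X)) p g = 0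
  have hadd : ∀ g g', Q g → Q g' → Q (g + g') := by
    rintro g g' ⟨p, hp, h1⟩ ⟨p', hp', h2⟩
    refine ⟨p * p', by rw [eval_mul]; exact mul_ne_zero hp hp', ?_⟩
    have h3 : aeval (A.act (.inl X)) (p * p') g = 0 := by
      rw [mul_comm, map_mul, Module.End.mul_apply, h1, map_zero]
    have h4 : aeval (A.act (.inl X)) (p * p') g' = 0 := by
      rw [map_mul, Module.End.mul_apply, h2, map_zero]
    rw [map_add, h3, h4, add_zero]
  have h0 : Q 0 := ⟨1, by simp, map_zero _⟩
  have hsingle : ∀ i, Q (Pi.single i (g i)) := by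
    intro i
    by_cases hi : i.val < r + 1
    · rw [hg i hi, Pi.single_zero]; exact h0
    · generalize g i = G
      induction G using mono_induction with
      | hadd F G hF hG => rw [Pi.single_add]; exact hadd _ _ hF hG
      | hsmul c k =>
        -- Monomials in a later component are eigenvectors of `𝕏(x)` whose weights differ from `lam
        -- + m r / 2`, because `m` is strictly increasing.
        refine ⟨X - C (lam + m i / 2 + k / 2), ?_, ?_⟩
        · rw [eval_sub, eval_X, eval_C]
          have h1 : r < i := by rw [Fin.lt_def]; omega
          have h2 : m r < m i := hm h1
          intro h3
          have h4 : (m r : ℂ) = m i + k := by linear_combination 2 * h3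
          have h5 : m r = m i + k := by exact_mod_cast h4
          omega
        · rw [map_sub, aeval_X, aeval_C, LinearMap.sub_apply, h.conf_single inl_X_mem, map_smul,
            density_inl_X, Module.algebraMap_end_apply, smul_comm, Pi.single_smul, sub_self]
  change Q g
  rw [← Finset.univ_sum_single g]
  exact Finset.sum_induction _ _ hadd h0 fun i _ => hsingle i

/-- Powers of `D` turn the leading component into a non-zero constant, and a polynomial in `𝕏(x)`
then removes everything in the later components without killing that constant. -/
lemma single_one_mem (h : IsGraded A lam m) (hm : StrictMono m) (hU : A.Invariant U) {r : Fin n}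
    {g : Fin n → SPoly} (hg : g ∈ U) (hgr : g ∈ filt n r) (h0 : g r ≠ 0) :
    Pi.single r (mono 0) ∈ U := by
  obtain ⟨k, c, hc, hk⟩ := exists_opD_pow_eq_C h0
  have h1 := h.opD_pow_mem hU hg k
  set f : Fin n → SPoly := fun i => (opD ^ k : Module.End ℂ SPoly) (g i) with hf
  have hfr : f ∈ filt n r := fun i hi => by rw [hf]; simp only; rw [hgr i hi, map_zero]
  have h2 := sub_single_mem_filt hfr
  have h3 : f r = c • mono 0 := hk
  rw [h3] at h2
  obtain ⟨p, hp, hp0⟩ := h.exists_aeval_eq_zero hm h2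
  have hmem : ∀ v ∈ U, aeval (A.act (.inl X)) p v ∈ U := by
    intro v hv
    have hpow : ∀ i : ℕ, (A.act (.inl X) ^ i) v ∈ U := fun i => by
      induction i with
      | zero => exact hv
      | succ i ih => rw [pow_succ']; exact hU.2 _ trivial _ ih
    rw [aeval_eq_sum_range, LinearMap.sum_apply]
    exact U.sum_mem fun i _ => U.smul_mem _ (hpow i)
  have h4 := hmem f h1
  rw [map_sub, sub_eq_zero] at hp0
  rw [hp0, Pi.single_smul, map_smul, Submodule.smul_mem_iff _ hc] at h4
  have h5 : ∀ p : ℂ[X], aeval (A.act (.inl X)) p (Pi.single r (mono 0) : Fin n → SPoly) =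
      p.eval (lam + m r / 2 : ℂ) • (Pi.single r (mono 0) : Fin n → SPoly) := by
    have h6 : A.act (.inl X) (Pi.single r (mono 0)) =
        (lam + m r / 2 : ℂ) • (Pi.single r (mono 0) : Fin n → SPoly) := by
      rw [h.conf_single inl_X_mem, density_inl_X, Nat.cast_zero, zero_div, add_zero,
        Pi.single_smul]
    intro p
    by_cases hv : (Pi.single r (mono 0) : Fin n → SPoly) = 0
    · rw [hv, map_zero, smul_zero]
    · exact Module.End.aeval_apply_of_hasEigenvector
        ⟨Module.End.mem_eigenspace_iff.2 h6, hv⟩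
  rwa [h5, Submodule.smul_mem_iff _ hp] at h4

/-- The element `ξ x` raises the degree by one, with factor `½` from odd monomials and `lam + m r /
2 + a / 2` from even ones. Hence regularity is needed only at the even degrees passed on the way. -/
lemma single_mono_mem (h : IsGraded A lam m) (hU : A.Invariant U) {r : Fin n}
    (h0 : Pi.single r (mono 0) ∈ U) {N : ℕ} (hN : ∀ a : ℕ, 2 * a < N → lam + m r / 2 + a / 2 ≠ 0)
    {j : ℕ} (hj : j ≤ N) : Pi.single r (mono j) ∈ U := by
  induction j with
  | zero => exact h0
  | succ j ih =>
    have h1 := hU.2 (.inr X) trivial _ (ih (by omega))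
    rw [h.conf_single inr_X_mem] at h1
    obtain ⟨a, rfl | rfl⟩ := exists_eq_two_mul_or j
    · rwa [density_inr_X_even, Pi.single_smul,
        Submodule.smul_mem_iff _ (hN a (by omega))] at h1
    · rwa [density_inr_X_odd, Pi.single_smul, Submodule.smul_mem_iff _ (by norm_num)] at h1

variable (hR : ∀ (k : ℕ) (i : Fin n), k < m i → lam + k / 2 ≠ 0)
  (hb : ∀ r r' : Fin n, r'.val = r + 1 → ∃ k, m r' = m r + 3 + k ∧ coef A r r' k ≠ 0)

-- A leading component that is not the last can be merely constant and still generate everything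
-- from there on: the constant is raised by `ξ x`, and the non-zero adjacent coefficient carries it
-- to a non-constant element of the next component.
include hR hb in
lemma filt_le_of_ne_zero (h : IsGraded A lam m) (hm : StrictMono m) (hU : A.Invariant U)
    {r r' : Fin n} (hr : r'.val = r + 1)
    (ih : ∀ g ∈ U, g ∈ filt n r' → opD (g r') ≠ 0 → filt n r' ≤ U)
    {g : Fin n → SPoly} (hg : g ∈ U) (hgr : g ∈ filt n r) (h0 : g r ≠ 0) : filt n r ≤ U := by
  obtain ⟨k, hk, hcoef⟩ := hb r r' hr
  have hne : r ≠ r' := fun h' => by subst h'; omega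
  have h1 : ∀ j, j ≤ k + 4 → Pi.single r (mono j) ∈ U := fun j hj => by
    refine h.single_mono_mem hU (h.single_one_mem hm hU hg hgr h0) (N := k + 4) (fun a ha => ?_) hj
    have h2 := hR (m r + a) r' (by omega)
    push_cast at h2
    convert h2 using 1
    ring
  have hs : (Pi.single r (mono (k + 1)) : Fin n → SPoly) ∈ filt n r := single_mem_filt le_rfl _
  -- Degree `k` would only reach a constant of component `r'`; degree `k + 1` reaches an element
  -- with non-zero `D`. The part remaining in component `r` has degree `k + 4` and already lies in
  -- `U`, which explains the bound used above.
  have h2 := hU.2 gen trivial _ (h1 (k + 1) (by omega))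
  have h3 := sub_single_mem_filt ((h.invariant_filt hm r).2 gen trivial _ hs)
  rw [h.act_apply_of_mem_filt hm hs, Pi.single_eq_same] at h3
  have h4 : ∃ c : ℂ, (tensorDensity (lam + m r / 2)).act gen (mono (k + 1)) =
      c • mono (k + 4) := by
    obtain ⟨a, ha | ha⟩ := exists_eq_two_mul_or (k + 1)
    · exact ⟨_, by rw [ha, density_gen_even, ← ha]⟩
    · exact ⟨_, by rw [ha, density_gen_odd, show 2 * a + 4 = k + 4 by omega]⟩
  obtain ⟨c, hc⟩ := h4
  rw [hc, Pi.single_smul] at h3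
  have h5 : filt n (r + 1) ≤ U := by
    rw [← hr] at h3 ⊢
    refine ih _ (U.sub_mem h2 (U.smul_mem c (h1 (k + 4) le_rfl))) h3 ?_
    rw [Pi.sub_apply, Pi.smul_apply, Pi.single_eq_of_ne hne.symm, smul_zero, sub_zero,
      ← entry_apply, (h.isRelCochain_of_ne hne).opD_comm]
    obtain ⟨d, hd, hd'⟩ := exists_opD_mono k
    rw [hd', map_smul]
    refine neg_ne_zero.2 (smul_ne_zero hd fun h6 => hcoef ?_)
    rw [coef, h6, map_zero]
  refine h.filt_le_of_opD_ne_zero hm hU h5 (h1 1 (by omega)) (single_mem_filt le_rfl _) ?_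
  rw [Pi.single_eq_same]
  obtain ⟨d, hd, hd'⟩ := exists_opD_mono 0
  rw [hd']
  refine smul_ne_zero hd fun h6 => ?_
  have := congrArg cc h6
  simp [cc_apply, mono_zero] at this

include hR hb in
lemma filt_le (h : IsGraded A lam m) (hm : StrictMono m) (hU : A.Invariant U) (r : Fin n)
    {g : Fin n → SPoly} (hg : g ∈ U) (hgr : g ∈ filt n r) (h0 : opD (g r) ≠ 0) :
    filt n r ≤ U := by
  have key : ∀ d : ℕ, ∀ r : Fin n, r.val + d + 1 = n → ∀ g ∈ U, g ∈ filt n r →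
      opD (g r) ≠ 0 → filt n r ≤ U := by
    intro d
    induction d with
    | zero =>
      intro r hr g hg hgr h0
      refine h.filt_le_of_opD_ne_zero hm hU ?_ hg hgr h0
      rw [show r.val + 1 = n from hr, filt_self]
      exact bot_le
    | succ d ih =>
      intro r hr g hg hgr h0
      exact filt_le_of_ne_zero hR hb h hm hU (r' := ⟨r + 1, by omega⟩) rfl
        (ih ⟨r + 1, by omega⟩ (by simp only; omega)) hg hgr fun h1 => h0 (by rw [h1, map_zero])
  exact key (n - r - 1) r (by omega) g hg hgr h0

lemma exists_leading {g : Fin n → SPoly} (hg : g ≠ 0) : ∃ r : Fin n, g ∈ filt n r ∧ g r ≠ 0 := by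
  obtain ⟨i, hi⟩ := Function.ne_iff.1 hg
  obtain ⟨r, hr, hmin⟩ := WellFounded.has_min (wellFounded_lt (α := Fin n)) {i | g i ≠ 0} ⟨i, hi⟩
  refine ⟨r, fun j hj => ?_, hr⟩
  by_contra hne
  exact hmin j hne hj

-- A non-zero submodule contains every component from its leading one onwards, except that in the
-- last component it may consist of constants only (a submodule when that weight is zero). The
-- possible submodules therefore form a chain.
include hR hb in
lemma uniserial (h : IsGraded A lam m) (hm : StrictMono m) : A.Uniserial := by
  rw [SuperAction.uniserial_iff]
  have halt : ∀ U, A.Invariant U → ∀ (r : Fin n) (g), g ∈ U → g ∈ filt n r → g r ≠ 0 →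
      filt n r ≤ U ∨ (r.val + 1 = n ∧ opD (g r) = 0) := by
    intro U hU r g hg hgr h0
    by_cases hr : r.val + 1 = n
    · by_cases h1 : opD (g r) = 0
      · exact Or.inr ⟨hr, h1⟩
      · exact Or.inl (filt_le hR hb h hm hU r hg hgr h1)
    · exact Or.inl (filt_le_of_ne_zero hR hb h hm hU (r' := ⟨r + 1, by omega⟩) rfl
        (fun g hg hgr h1 => filt_le hR hb h hm hU _ hg hgr h1) hg hgr h0)
  have key : ∀ U U', A.Invariant U → A.Invariant U' → ∀ (r r' : Fin n) (g g'), r ≤ r' →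
      g ∈ U → g ∈ filt n r → g r ≠ 0 → g' ∈ U' → g' ∈ filt n r' → g' r' ≠ 0 →
      g' ∈ U ∨ g ∈ U' := by
    intro U U' hU hU' r r' g g' hrr hg hgr h0 hg' hgr' h0'
    rcases halt U hU r g hg hgr h0 with h1 | ⟨h1, h2⟩
    · exact Or.inl (h1 (filt_mono hrr hgr'))
    have hreq : r = r' := le_antisymm hrr (by rw [Fin.le_def]; omega)
    subst hreq
    rcases halt U' hU' r g' hg' hgr' h0' with h3 | ⟨-, h3⟩
    · exact Or.inr (h3 hgr)
    -- What is left is two elements that are constants in the last component, and these are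
    -- proportional.
    have hlast : ∀ f : Fin n → SPoly, f ∈ filt n r → f = Pi.single r (f r) := by
      intro f hf
      have h4 := sub_single_mem_filt hf
      rwa [h1, filt_self, Submodule.mem_bot, sub_eq_zero] at h4
    have h4 := eq_inl_C_of_opD_eq_zero h2
    have h5 := eq_inl_C_of_opD_eq_zero h3
    set c := (g r).fst.coeff 0
    set c' := (g' r).fst.coeff 0
    have hc' : c' ≠ 0 := fun hc => h0' (by rw [h5, hc]; simp)
    right
    have h6 : g = (c / c') • g' := by
      rw [hlast g hgr, hlast g' hgr', h4, h5, ← Pi.single_smul, ← TrivSqZeroExt.inl_smul,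
        smul_C, smul_eq_mul, div_mul_cancel₀ _ hc']
    rw [h6]
    exact U'.smul_mem _ hg'
  intro U U' hU hU'
  by_contra hcon
  push Not at hcon
  obtain ⟨h1, h2⟩ := hcon
  obtain ⟨g, hg, hgn⟩ := Set.not_subset.1 h1
  obtain ⟨g', hg', hgn'⟩ := Set.not_subset.1 h2
  obtain ⟨r, hr, hr0⟩ := exists_leading (fun h0 => hgn (by rw [h0]; exact U'.zero_mem) : g ≠ 0)
  obtain ⟨r', hr', hr0'⟩ := exists_leading (fun h0 => hgn' (by rw [h0]; exact U.zero_mem) : g' ≠ 0)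
  rcases le_total r r' with hle | hle
  · rcases key U U' hU hU' r r' g g' hle hg hr hr0 hg' hr' hr0' with h3 | h3
    exacts [hgn' h3, hgn h3]
  · rcases key U' U hU' hU r' r g' g hle hg' hr' hr0' hg hr hr0 with h3 | h3
    exacts [hgn h3, hgn' h3]

end Uniserial

end IsGraded

end UniserialCriterion

section Classification

/-! ## Uniserial extensions are graded modules -/

namespace SuperAction

variable {V W : Type*} [AddCommGroup V] [Module ℂ V] [AddCommGroup W] [Module ℂ W]

/-- An invariant complement gives a section of an equivalence of a subquotient with `C`. -/
lemma exists_section {B : SuperAction V} {C : SuperAction W} {M N U : Submodule ℂ V}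
    {hM : B.Invariant M} {hN : B.Invariant N} (hC : (B.subquotient M N hM hN).EvenEquiv C)
    {S : Submodule ℂ SPoly} (hU : B.InvariantUnder S U) (hsup : U ⊔ N = M) (hinf : U ⊓ N = ⊥) :
    ∃ η : W →ₗ[ℂ] V, (∀ w, η w ∈ M) ∧ (∀ w, η w ∈ N → w = 0) ∧
      (∀ v ∈ M, ∃ w, v - η w ∈ N) ∧ (∀ w, B.par (η w) = η (C.par w)) ∧
      ∀ F ∈ S, ∀ w, B.act F (η w) = η (C.act F w) := by
  obtain ⟨φ, h1, h2⟩ := hC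
  have hUM : U ≤ M := hsup ▸ le_sup_left
  let f : U →ₗ[ℂ] W := φ.toLinearMap ∘ₗ (N.submoduleOf M).mkQ ∘ₗ Submodule.inclusion hUM
  have hf : ∀ u : U, f u = φ (Submodule.Quotient.mk ⟨u, hUM u.2⟩) := fun u => rfl
  have hinj : Function.Injective f := by
    rw [injective_iff_map_eq_zero]
    intro u hu
    rw [hf, LinearEquiv.map_eq_zero_iff, Submodule.Quotient.mk_eq_zero] at hu
    have h3 : (u : V) ∈ U ⊓ N := ⟨u.2, hu⟩
    rw [hinf, Submodule.mem_bot] at h3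
    exact Subtype.ext h3
  have hsurj : ∀ v : M, ∃ u : U, f u = φ (Submodule.Quotient.mk v) ∧ (v : V) - u ∈ N := by
    intro v
    obtain ⟨u, hu, w, hw, hv⟩ := Submodule.mem_sup.1 (hsup.symm ▸ v.2 : (v : V) ∈ U ⊔ N)
    have h3 : (v : V) - u ∈ N := by rw [← hv, add_sub_cancel_left]; exact hw
    refine ⟨⟨u, hu⟩, ?_, h3⟩
    rw [hf]
    congr 1
    rw [eq_comm, Submodule.Quotient.eq]
    exact h3
  have hbij : Function.Bijective f := by
    refine ⟨hinj, fun w => ?_⟩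
    obtain ⟨x, rfl⟩ := φ.surjective w
    induction x using Submodule.Quotient.induction_on with
    | H v => exact (hsurj v).imp fun u hu => hu.1
  let e := LinearEquiv.ofBijective f hbij
  have he : ∀ u : U, e.symm (f u) = u := fun u => e.symm_apply_apply u
  have hew : ∀ w, f (e.symm w) = w := fun w => e.apply_symm_apply w
  refine ⟨U.subtype ∘ₗ e.symm.toLinearMap, fun w => hUM (e.symm w).2, fun w hw => ?_,
    fun v hv => ?_, fun w => ?_, fun F hF w => ?_⟩
  · have h3 : ((e.symm w : U) : V) ∈ U ⊓ N := ⟨(e.symm w).2, hw⟩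
    rw [hinf, Submodule.mem_bot] at h3
    rw [← hew w, Subtype.ext h3 (a2 := (0 : U)), map_zero]
  · obtain ⟨u, hu, huN⟩ := hsurj ⟨v, hv⟩
    exact ⟨f u, by simpa [he] using huN⟩
  · have h3 : C.par w = f ⟨B.par (e.symm w), hU.1 _ (e.symm w).2⟩ := by
      conv_lhs => rw [← hew w, hf, ← h1]
      rfl
    rw [h3]
    simp [he]
  · have h3 : C.act F w = f ⟨B.act F (e.symm w), hU.2 F hF _ (e.symm w).2⟩ := by
      conv_lhs => rw [← hew w, hf, ← h2]
      rfl
    rw [h3]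
    simp [he]

/-- An `𝔰`-split extension of density modules is equivalent to a graded module. -/
lemma IsSplitExtension.exists_isGraded {n : ℕ} {lam : ℂ} {m : Fin n → ℕ} {B : SuperAction V}
    (hB : B.IsSplitExtension fun r : Fin n => (tensorDensity (lam + m r / 2)).shift (m r)) :
    ∃ A : SuperAction (Fin n → SPoly), IsGraded A lam m ∧ B.EvenEquiv A := by
  obtain ⟨hrep, flag, hinv, htop, hbot, hstep⟩ := hB
  choose hle hequiv U hU hsup hinf using hstep
  choose η hηM hηN hηs hηp hηa using fun r => exists_section (hequiv r) (hU r) (hsup r) (hinf r)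
  -- The `𝔰`-invariant complements of the steps of the flag add up to the whole module, compatibly
  -- with parity and with `𝔰`; this is what diagonalizes the action of `𝔰`.
  let Φ : (Fin n → SPoly) →ₗ[ℂ] V := LinearMap.lsum ℂ (fun _ => SPoly) ℂ η
  have hΦ : ∀ g, Φ g = ∑ r, η r (g r) := fun g => by simp [Φ, LinearMap.lsum_apply]
  have hΦs : ∀ r G, Φ (Pi.single r G) = η r G := fun r G => by
    rw [hΦ, Finset.sum_eq_single r, Pi.single_eq_same]
    · intro i _ hi; rw [Pi.single_eq_of_ne hi, map_zero]
    · simp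
  have hpeel : ∀ (r : Fin n) (g : Fin n → SPoly), Φ g = η r (g r) + Φ (g - Pi.single r (g r)) := by
    intro r g
    rw [map_sub, hΦs, add_sub_cancel]
  -- Bijectivity is proved one step of the flag at a time, from the bottom up.
  have key : ∀ s : Fin (n + 1), (∀ g ∈ filt n s, Φ g ∈ flag s ∧ (Φ g = 0 → g = 0)) ∧
      ∀ v ∈ flag s, ∃ g ∈ filt n s, Φ g = v := by
    intro s
    induction s using Fin.reverseInduction with
    | last =>
      rw [hbot, Fin.val_last, filt_self]
      refine ⟨fun g hg => ?_, fun v hv => ⟨0, Submodule.zero_mem _, ?_⟩⟩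
      · rw [Submodule.mem_bot] at hg
        subst hg
        simp
      · rw [map_zero]; exact ((Submodule.mem_bot ℂ).1 hv).symm
    | cast r ih =>
      obtain ⟨ih1, ih2⟩ := ih
      rw [Fin.val_succ] at ih1 ih2
      rw [Fin.val_castSucc]
      refine ⟨fun g hg => ?_, fun v hv => ?_⟩
      · obtain ⟨h1, h2⟩ := ih1 _ (sub_single_mem_filt hg)
        refine ⟨?_, fun h0 => ?_⟩
        · rw [hpeel r]
          exact Submodule.add_mem _ (hηM r _) (hle r h1)
        · rw [hpeel r] at h0
          have h3 : g r = 0 := hηN r _ (by rw [eq_neg_of_add_eq_zero_left h0]; exact neg_mem h1)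
          rw [h3, map_zero, zero_add] at h0
          have h4 := h2 (by rw [h3]; exact h0)
          rwa [h3, Pi.single_zero, sub_zero] at h4
      · obtain ⟨w, hw⟩ := hηs r v hv
        obtain ⟨g, hg, hgv⟩ := ih2 _ hw
        refine ⟨Pi.single r w + g, Submodule.add_mem _ (single_mem_filt le_rfl w)
          (filt_mono (Nat.le_succ _) hg), ?_⟩
        rw [map_add, hΦs, hgv, add_sub_cancel]
  have h0 := key 0
  rw [htop, Fin.val_zero, filt_zero] at h0
  have hbij : Function.Bijective Φ := by
    refine ⟨?_, fun v => ?_⟩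
    · rw [injective_iff_map_eq_zero]
      exact fun g hg => (h0.1 g trivial).2 hg
    · obtain ⟨g, -, hg⟩ := h0.2 v trivial
      exact ⟨g, hg⟩
  let e : V ≃ₗ[ℂ] (Fin n → SPoly) := (LinearEquiv.ofBijective Φ hbij).symm
  have heΦ : ∀ g, e (Φ g) = g := fun g => (LinearEquiv.ofBijective Φ hbij).symm_apply_apply g
  refine ⟨B.compress e.toLinearMap e.symm.toLinearMap, ⟨(IsPresentation.of_equiv e).isRep hrep, fun g i => ?_, fun F hF g i => ?_⟩, evenEquiv_compress B e⟩
  · change e (B.par (Φ g)) i = _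
    have h1 : B.par (Φ g) = Φ fun r => sign (m r : ZMod 2) • eps (g r) := by
      rw [hΦ, hΦ, map_sum]
      refine Finset.sum_congr rfl fun r _ => ?_
      rw [hηp, shift_par]
      rfl
    rw [h1, heΦ]
  · change e (B.act F (Φ g)) i = _
    have h1 : B.act F (Φ g) = Φ fun r => (tensorDensity (lam + m r / 2)).act F (g r) := by
      rw [hΦ, hΦ, map_sum]
      exact Finset.sum_congr rfl fun r _ => hηa r F hF (g r)
    rw [h1, heΦ]

end SuperAction

/-! ### Uniqueness from the adjacent coefficients. -/

namespace IsGraded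

section Nonsplit

variable {n : ℕ} {A B : SuperAction (Fin n → SPoly)} {lam : ℂ} {m : Fin n → ℕ}

/-- In a uniserial graded module the coefficients next to the diagonal do not vanish. -/
lemma exists_coef_ne_zero (h : IsGraded A lam m) (hm : StrictMono m) (hA : A.Uniserial)
    {r r' : Fin n} (hr : r'.val = r + 1) : ∃ k, m r' = m r + 3 + k ∧ coef A r r' k ≠ 0 := by
  by_contra hcon
  push Not at hcon
  have hne : r ≠ r' := fun h' => by subst h'; omega
  have h0 := h.entry_eq_zero hne hcon
  -- If nothing passes from `r` to its successor `r'`, omitting component `r'` from `filt n r`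
  -- leaves an invariant subspace. It is not comparable with `filt n (r + 1)`, against uniseriality.
  let U : Submodule ℂ (Fin n → SPoly) := filt n r ⊓ LinearMap.ker (LinearMap.proj r')
  have hU : A.Invariant U := by
    refine ⟨fun g hg => ⟨(h.invariant_filt hm _).1 g hg.1, ?_⟩,
      fun F _ g hg => ⟨(h.invariant_filt hm _).2 F trivial g hg.1, ?_⟩⟩
    · have h1 : g r' = 0 := hg.2
      change A.par g r' = 0
      rw [h.par, h1, map_zero, smul_zero]
    · change A.act F g r' = 0
      rw [act_eq_sum_entry]
      refine Finset.sum_eq_zero fun i _ => ?_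
      rcases lt_trichotomy i r' with hi | hi | hi
      · by_cases hir : i = r
        · subst hir; rw [h0]; rfl
        · have h1 : i.val < r.val := by
            have h2 : i.val ≠ r.val := fun h' => hir (Fin.ext h')
            rw [Fin.lt_def] at hi
            omega
          rw [hg.1 i h1, map_zero]
      · have h1 : g r' = 0 := hg.2
        rw [hi, h1, map_zero]
      · have h1 : m r' < m i := hm hi
        rw [h.entry_eq_zero_of_lt hi.ne' (by omega)]
        rfl
  have h1 : (.inl 1 : SPoly) ≠ 0 := fun h' => by
    have := congrArg TrivSqZeroExt.fst h'
    simp at this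
  rcases SuperAction.uniserial_iff.1 hA U (filt n (r + 1)) hU (h.invariant_filt hm _) with h2 | h2
  · have h3 : (Pi.single r (.inl 1) : Fin n → SPoly) ∈ U :=
      ⟨single_mem_filt le_rfl _, Pi.single_eq_of_ne hne.symm _⟩
    have h4 := h2 h3 r (Nat.lt_succ_self _)
    rw [Pi.single_eq_same] at h4
    exact h1 h4
  · have h3 := (h2 (single_mem_filt (i := r') hr.symm.le (.inl 1))).2
    have h4 : (Pi.single r' (.inl 1) : Fin n → SPoly) r' = 0 := h3
    rw [Pi.single_eq_same] at h4
    exact h1 h4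

/-- The action conjugated by a diagonal matrix. -/
lemma exists_rescale (h : IsGraded A lam m) (d : Fin n → ℂ) (hd : ∀ i, d i ≠ 0) :
    ∃ A', IsGraded A' lam m ∧ A.EvenEquiv A' ∧
      ∀ i j k, coef A' i j k = d j / d i * coef A i j k := by
  let e : (Fin n → SPoly) ≃ₗ[ℂ] (Fin n → SPoly) :=
    LinearEquiv.piCongrRight fun i => LinearEquiv.smulOfNeZero ℂ SPoly (d i) (hd i)
  have he : ∀ g i, e g i = d i • g i := fun g i => rfl
  have hes : ∀ g i, e.symm g i = (d i)⁻¹ • g i := fun g i => by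
    have h1 := he (e.symm g) i
    rw [e.apply_symm_apply] at h1
    rw [h1, smul_smul, inv_mul_cancel₀ (hd i), one_smul]
  refine ⟨A.compress e.toLinearMap e.symm.toLinearMap,
    ⟨(SuperAction.IsPresentation.of_equiv e).isRep h.isRep, fun g i => ?_, fun F hF g i => ?_⟩,
    SuperAction.evenEquiv_compress A e, fun i j k => ?_⟩
  · change e (A.par (e.symm g)) i = _
    rw [he, h.par, hes, map_smul, smul_comm (d i), smul_smul (d i), mul_inv_cancel₀ (hd i),
      one_smul]
  · change e (A.act F (e.symm g)) i = _
    rw [he, h.conf F hF, hes, map_smul, smul_smul (d i), mul_inv_cancel₀ (hd i), one_smul]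
  · change cc (e (A.act gen (e.symm (Pi.single i (mono k)))) j) = _
    have h1 : e.symm (Pi.single i (mono k)) = (d i)⁻¹ • Pi.single i (mono k) := by
      funext l
      rw [hes, Pi.smul_apply]
      by_cases hl : l = i
      · subst hl; rfl
      · rw [Pi.single_eq_of_ne hl, smul_zero, smul_zero]
    rw [h1, he, map_smul, map_smul, Pi.smul_apply, map_smul, smul_smul, div_eq_mul_inv]
    rfl

/-- The two actions have the same right-hand side in the Maurer–Cartan relation, because components
outside the range from `i` to `j` contribute nothing; dividing by `mcFactor` identifies the scalars.
-/
lemma entry_eq_of_maurerCartan (h : IsGraded A lam m) (h' : IsGraded B lam m) {i j : Fin n}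
    (hm : StrictMono m) (hij : i ≠ j) (hgap : m i + 6 ≤ m j)
    (hmc : ∀ k, m j = m i + 6 + k → mcFactor (lam + m i / 2) k ≠ 0)
    (hl : ∀ l, i < l → l < j → entry A i l = entry B i l ∧ entry A l j = entry B l j) :
    entry A i j = entry B i j := by
  refine h.entry_eq h' i j fun k hk => ?_
  obtain ⟨k, rfl⟩ := Nat.exists_eq_add_of_le' (show 3 ≤ k by omega)
  refine mul_left_cancel₀ (hmc k (by omega)) ?_
  rw [h.mcFactor_mul_coef hij, h'.mcFactor_mul_coef hij]
  congr 1
  refine Finset.sum_congr rfl fun l hl' => ?_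
  rw [Finset.mem_erase, Finset.mem_erase] at hl'
  rcases lt_or_gt_of_ne hl'.2.1 with hli | hli
  · have := hm hli
    rw [h.entry_eq_zero_of_lt hl'.2.1.symm (by omega),
      h'.entry_eq_zero_of_lt hl'.2.1.symm (by omega)]
    simp
  rcases lt_or_gt_of_ne hl'.1 with hlj | hlj
  · obtain ⟨h1, h2⟩ := hl l hli hlj
    rw [h1, h2]
  · have := hm hlj
    rw [h.entry_eq_zero_of_lt hl'.1 (by omega), h'.entry_eq_zero_of_lt hl'.1 (by omega)]
    simp

end Nonsplit

/-- Graded modules with four components are classified by their degrees. -/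
lemma evenEquiv {A B : SuperAction (Fin 4 → SPoly)} {lam : ℂ} {m : Fin 4 → ℕ}
    (h : IsGraded A lam m) (h' : IsGraded B lam m) (hm : StrictMono m)
    (hgap : ∀ r r' : Fin 4, r'.val = r + 1 → m r + 3 ≤ m r')
    (hmc : ∀ i j : Fin 4, i.val + 1 < j → ∀ k, m j = m i + 6 + k →
      mcFactor (lam + m i / 2) k ≠ 0)
    (hA : ∀ r r' : Fin 4, r'.val = r + 1 → ∀ k, m r' = m r + 3 + k → coef A r r' k ≠ 0)
    (hB : ∀ r r' : Fin 4, r'.val = r + 1 → ∀ k, m r' = m r + 3 + k → coef B r r' k ≠ 0) :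
    A.EvenEquiv B := by
  obtain ⟨k0, hk0⟩ := Nat.exists_eq_add_of_le (hgap 0 1 rfl)
  obtain ⟨k1, hk1⟩ := Nat.exists_eq_add_of_le (hgap 1 2 rfl)
  obtain ⟨k2, hk2⟩ := Nat.exists_eq_add_of_le (hgap 2 3 rfl)
  have hA0 := hA 0 1 rfl k0 hk0
  have hA1 := hA 1 2 rfl k1 hk1
  have hA2 := hA 2 3 rfl k2 hk2
  have hB0 := hB 0 1 rfl k0 hk0
  have hB1 := hB 1 2 rfl k1 hk1
  have hB2 := hB 2 3 rfl k2 hk2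
  set d0 := coef B 0 1 k0 / coef A 0 1 k0
  set d1 := coef B 1 2 k1 / coef A 1 2 k1
  set d2 := coef B 2 3 k2 / coef A 2 3 k2
  have hd0 : d0 ≠ 0 := div_ne_zero hB0 hA0
  have hd1 : d1 ≠ 0 := div_ne_zero hB1 hA1
  have hd2 : d2 ≠ 0 := div_ne_zero hB2 hA2
  -- The successive quotients of this diagonal are the ratios of the adjacent coefficients of `B` to
  -- those of `A`.
  obtain ⟨A', hA', hequiv, hcoef⟩ := h.exists_rescale ![1, d0, d0 * d1, d0 * d1 * d2] (by
    intro i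
    fin_cases i
    exacts [one_ne_zero, hd0, mul_ne_zero hd0 hd1, mul_ne_zero (mul_ne_zero hd0 hd1) hd2])
  have h01 : entry A' 0 1 = entry B 0 1 := hA'.entry_eq h' 0 1 fun k hk => by
    obtain rfl : k = k0 := by omega
    rw [hcoef]
    change d0 / 1 * _ = _
    rw [div_one, div_mul_cancel₀ _ hA0]
  have h12 : entry A' 1 2 = entry B 1 2 := hA'.entry_eq h' 1 2 fun k hk => by
    obtain rfl : k = k1 := by omega
    rw [hcoef]
    change d0 * d1 / d0 * _ = _
    rw [mul_div_cancel_left₀ _ hd0, div_mul_cancel₀ _ hA1]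
  have h23 : entry A' 2 3 = entry B 2 3 := hA'.entry_eq h' 2 3 fun k hk => by
    obtain rfl : k = k2 := by omega
    rw [hcoef]
    change d0 * d1 * d2 / (d0 * d1) * _ = _
    rw [mul_div_cancel_left₀ _ (mul_ne_zero hd0 hd1), div_mul_cancel₀ _ hA2]
  have hle : ∀ i j : Fin 4, j ≤ i → entry A' i j = entry B i j := fun i j hij =>
    hA'.entry_eq h' i j fun k hk => by
      have := hm.monotone hij
      omega
  have h02 : entry A' 0 2 = entry B 0 2 := by
    refine hA'.entry_eq_of_maurerCartan h' hm (by decide) (by omega) (hmc 0 2 (by decide))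
      fun l h1 h2 => ?_
    fin_cases l
    exacts [absurd h1 (by decide), ⟨h01, h12⟩, absurd h2 (by decide), absurd h2 (by decide)]
  have h13 : entry A' 1 3 = entry B 1 3 := by
    refine hA'.entry_eq_of_maurerCartan h' hm (by decide) (by omega) (hmc 1 3 (by decide))
      fun l h1 h2 => ?_
    fin_cases l
    exacts [absurd h1 (by decide), absurd h1 (by decide), ⟨h12, h23⟩, absurd h2 (by decide)]
  have h03 : entry A' 0 3 = entry B 0 3 := by
    refine hA'.entry_eq_of_maurerCartan h' hm (by decide) (by omega) (hmc 0 3 (by decide))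
      fun l h1 h2 => ?_
    fin_cases l
    exacts [absurd h1 (by decide), ⟨h01, h13⟩, ⟨h02, h23⟩, absurd h2 (by decide)]
  have hall : ∀ i j : Fin 4, entry A' i j = entry B i j := by
    intro i j
    rcases le_or_gt j i with hij | hij
    · exact hle i j hij
    · fin_cases i <;> fin_cases j <;> first | exact absurd hij (by decide) | assumption
  rw [hA'.ext h' fun i j k _ => by rw [coef, coef, hall]] at hequiv
  exact hequiv

end IsGraded

end Classification

set_option linter.unusedSimpArgs false

/-! ## The action on pseudodifferential operators, term by term -/

/-- Multiplication of the sequence of coefficients by the shift by one step. -/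
def shiftOne : (ℕ → SPoly) →ₗ[ℂ] (ℕ → SPoly) :=
  LinearMap.pi fun n =>
    match n with
    | 0 => 0
    | n + 1 => LinearMap.proj n

/-- The sequence without its first term. -/
def tail : (ℕ → SPoly) →ₗ[ℂ] (ℕ → SPoly) := LinearMap.funLeft ℂ SPoly (· + 1)

@[simp] lemma tail_apply (T : ℕ → SPoly) (n : ℕ) : tail T n = T (n + 1) := rfl

/-- The sequence with first term `G` and no others. -/
def head : SPoly →ₗ[ℂ] (ℕ → SPoly) := LinearMap.single ℂ (fun _ => SPoly) 0

@[simp] lemma shiftOne_zero (T : ℕ → SPoly) : shiftOne T 0 = 0 := rfl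
@[simp] lemma shiftOne_succ (T : ℕ → SPoly) (n : ℕ) : shiftOne T (n + 1) = T n := rfl
@[simp] lemma head_zero (G : SPoly) : head G 0 = G := by simp [head]
@[simp] lemma head_succ (G : SPoly) (n : ℕ) : head G (n + 1) = 0 := by simp [head]
lemma tail_head (G : SPoly) : tail (head G) = 0 := by funext n; simp
lemma tail_shiftOne (T : ℕ → SPoly) : tail (shiftOne T) = T := rfl

lemma head_add_shiftOne_tail (T : ℕ → SPoly) : head (T 0) + shiftOne (tail T) = T := by
  funext n
  cases n <;> simp

open Finset in
lemma comp_shiftOne_right (z : ℂ) (m : ZMod 2) (S T : ℕ → SPoly) :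
    comp z m S (shiftOne T) = shiftOne (comp z m S T) := by
  funext n
  match n with
  | 0 => simp [comp_zero]
  | n + 1 =>
    rw [shiftOne_succ, comp_apply, comp_apply, Nat.sum_antidiagonal_succ']
    have h : ∀ p : ℕ × ℕ, ∑ q ∈ antidiagonal (p.2 + 1),
        S p.1 * leibniz (z - p.1) (m - p.1) q.1 (shiftOne T q.2) =
        ∑ q ∈ antidiagonal p.2, S p.1 * leibniz (z - p.1) (m - p.1) q.1 (T q.2) := fun p => by
      rw [Nat.sum_antidiagonal_succ']
      simp
    simp [h]

open Finset in
lemma comp_shiftOne_left (z : ℂ) (m : ZMod 2) (S T : ℕ → SPoly) :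
    comp z m (shiftOne S) T = shiftOne (comp (z - 1) (m - 1) S T) := by
  funext n
  rw [comp_apply]
  match n with
  | 0 => simp
  | n + 1 =>
    rw [shiftOne_succ, comp_apply, Nat.sum_antidiagonal_succ]
    simp only [shiftOne_succ, shiftOne_zero, zero_mul, sum_const_zero, zero_add]
    refine sum_congr rfl fun p _ => sum_congr rfl fun q _ => ?_
    rw [show z - ((p.1 + 1 : ℕ) : ℂ) = z - 1 - p.1 by push_cast; ring,
      show m - ((p.1 + 1 : ℕ) : ZMod 2) = m - 1 - p.1 by push_cast; ring]

lemma psiPar_shiftOne (l : ZMod 2) (T : ℕ → SPoly) :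
    psiPar l (shiftOne T) = shiftOne (psiPar (l - 1) T) := by
  funext n
  match n with
  | 0 => simp [psiPar_apply]
  | n + 1 =>
    rw [shiftOne_succ, psiPar_apply, psiPar_apply, shiftOne_succ,
      show l - ((n + 1 : ℕ) : ZMod 2) = l - 1 - n by push_cast; ring]

/-- Operators of lower degree form a submodule `Ψ^{k-1/2}_{l-1}` with the same `nu` and `q`. Thus it
is enough to know the action on a single leading term, with `k` and `l` variable. -/
lemma psiModule_act_shiftOne (nu q k : ℂ) (l : ZMod 2) (F : SPoly) (T : ℕ → SPoly) :
    (psiModule nu q k l).act F (shiftOne T) =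
      shiftOne ((psiModule nu q (k - 1 / 2) (l - 1)).act F T) := by
  apply shiftUp_injective
  have h1 : ∀ S, shiftUp (shiftOne S) = shiftOne (shiftUp S) := fun S => by
    funext n
    match n with
    | 0 => rfl
    | 1 => rfl
    | 2 => rfl
    | n + 3 => rfl
  rw [← psiCommutator_eq_shiftUp, h1, ← psiCommutator_eq_shiftUp, psiCommutator_apply,
    psiCommutator_apply, psiPar_shiftOne, comp_shiftOne_right, comp_shiftOne_left,
    comp_shiftOne_left, show 2 * (k - 1 / 2) = 2 * k - 1 by ring, map_sub, map_sub]

lemma leibniz_eq_zero {z : ℂ} {m : ZMod 2} {b : ℕ} {F : SPoly}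
    (h : (dx ^ (b / 2) : Module.End ℂ SPoly) F = 0) : leibniz z m b F = 0 := by
  unfold leibniz
  split_ifs <;> simp [h, dx_pow_eps, dx_pow_opDbar]

lemma leibniz_two_even (z : ℂ) (F : SPoly) : leibniz z 0 2 F = -(z / 2) • dx F := by
  simp [leibniz, genBinom_one_right]

lemma leibniz_two_odd (z : ℂ) (F : SPoly) : leibniz z 1 2 F = -((z - 1) / 2) • dx (eps F) := by
  simp [leibniz, genBinom_one_right]

lemma leibniz_three_even (z : ℂ) (F : SPoly) : leibniz z 0 3 F = 0 := leibniz_even_odd z 1 F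

lemma leibniz_three_odd (z : ℂ) (F : SPoly) :
    leibniz z 1 3 F = -((z - 1) / 2) • dx (opDbar F) := by
  have h : ¬ Even 3 := by decide
  simp [leibniz, genBinom_one_right, h]

lemma genBinom_two (w : ℂ) : genBinom w 2 = w * (w - 1) / 2 := by
  simp [genBinom, Finset.prod_range_succ]

lemma leibniz_four_even (z : ℂ) (F : SPoly) :
    leibniz z 0 4 F = (z / 2 * (z / 2 - 1) / 2) • dx (dx F) := by
  have h : Even 4 := by decide
  simp [leibniz, genBinom_two, h, pow_two]

lemma leibniz_four_odd (z : ℂ) (F : SPoly) :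
    leibniz z 1 4 F = ((z - 1) / 2 * ((z - 1) / 2 - 1) / 2) • dx (dx (eps F)) := by
  have h : Even 4 := by decide
  simp [leibniz, genBinom_two, h, pow_two]

lemma leibniz_five_even (z : ℂ) (F : SPoly) : leibniz z 0 5 F = 0 := leibniz_even_odd z 2 F

lemma leibniz_five_odd (z : ℂ) (F : SPoly) :
    leibniz z 1 5 F = ((z - 1) / 2 * ((z - 1) / 2 - 1) / 2) • dx (dx (opDbar F)) := by
  have h : ¬ Even 5 := by decide
  simp [leibniz, genBinom_two, h, pow_two]

open Finset in
lemma comp_head_densityOp (z nu : ℂ) (l : ZMod 2) (S F : SPoly) (n : ℕ) :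
    comp z l (head S) (densityOp nu F) (n + 2) = S * (leibniz z l n (nu • dx F)
      + leibniz z l (n + 1) ((1 / 2 : ℂ) • opD F) - leibniz z l (n + 2) F) := by
  rw [comp_apply, Nat.sum_antidiagonal_succ]
  simp only [head_zero, head_succ, zero_mul, sum_const_zero, add_zero, Nat.cast_zero, sub_zero]
  rw [← Nat.sum_antidiagonal_swap]
  have := sum_antidiagonal_of_support_le_two n (fun c b => S * leibniz z l b (densityOp nu F c))
    (fun i r => by rw [densityOp_add_three, map_zero, mul_zero])
  refine this.trans ?_
  rw [densityOp_zero, densityOp_one, densityOp_two, map_neg]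
  ring

/-- The coefficients of the action of `ξ f`, for `f''' = 0`, on the term of degree `2 k` of an
operator. -/
def lowA (nu k : ℂ) (l : ZMod 2) : ℂ := if l = 0 then k / 2 else (2 * k - 1) / 4 + nu

/-- The next coefficient after `lowA`. -/
def lowB (nu k : ℂ) (l : ZMod 2) : ℂ :=
  if l = 0 then k * (k - 1) / 2 + nu * k else (k - 1 / 2) ^ 2 / 2 + nu * (k - 1 / 2)

/-- The next coefficient after `lowB`. -/
def lowC (nu k : ℂ) (l : ZMod 2) : ℂ :=
  if l = 0 then -(k * (k - 1) / 4) else -((k - 1 / 2) * (k - 3 / 2) / 4) - nu * (k - 1 / 2)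

/-- The vanishing of `f'''` cuts the Leibniz series off after four terms. This covers `ξ`, `ξ x` and
`ξ x²`, the only elements whose action has to be computed. -/
lemma psiModule_act_head (nu q k : ℂ) (l : ZMod 2) {f : ℂ[X]}
    (hf : derivative (derivative (derivative f)) = 0) (G : SPoly) :
    (psiModule nu q k l).act (.inr f) (head G) =
      head ((tensorDensity (q - k)).act (.inr f) G)
      + shiftOne (head (lowA nu k l • (.inl (derivative f) * eps G))
      + shiftOne (head (lowB nu k l • (.inr (derivative (derivative f)) * eps G))
      + shiftOne (head (lowC nu k l • (.inl (derivative (derivative f)) * eps G))))) := by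
  have hpar : psiPar l (head G) = head (sign l • eps G) := by
    funext n
    cases n <;> simp [psiPar_apply]
  have hact : ∀ n, (psiModule nu q k l).act (.inr f) (head G) n =
      comp 2 0 (densityOp (nu + q) (.inr f)) (head G) (n + 2)
        - comp (2 * k) l (head (sign l • eps G)) (densityOp nu (.inr f)) (n + 2) := fun n => by
    change psiCommutator nu q k l (.inr f) (head G) (n + 2) = _
    rw [psiCommutator_apply, evenPart_inr, oddPart_inr, hpar]
    simp
  have hdx : ∀ g : ℂ[X], dx (.inr g : SPoly) = .inr (derivative g) := fun g => by
    refine TrivSqZeroExt.ext ?_ ?_ <;> simp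
  have hdx' : ∀ g : ℂ[X], dx (.inl g : SPoly) = .inl (derivative g) := fun g => by
    refine TrivSqZeroExt.ext ?_ ?_ <;> simp
  have hD : opD (.inr f : SPoly) = .inl f := by
    refine TrivSqZeroExt.ext ?_ ?_ <;> simp
  have hDb : ∀ g : ℂ[X], opDbar (.inl g : SPoly) = -.inr (derivative g) := fun g => by
    refine TrivSqZeroExt.ext ?_ ?_ <;> simp
  have hDb' : ∀ g : ℂ[X], opDbar (.inr g : SPoly) = .inl g := fun g => by
    refine TrivSqZeroExt.ext ?_ ?_ <;> simp
  have heps : ∀ g : ℂ[X], eps (.inl g : SPoly) = .inl g := fun g => by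
    refine TrivSqZeroExt.ext ?_ ?_ <;> simp
  have hepsG : ∀ g : ℂ[X], (.inr g : SPoly) * eps G = .inr g * G := fun g => by
    refine TrivSqZeroExt.ext ?_ ?_ <;> simp
  have hl : ∀ l : ZMod 2, l = 0 ∨ l = 1 := by decide
  funext n
  rw [hact, comp_densityOp_add_two, comp_head_densityOp, hdx, hD, head_succ, head_succ,
    Pi.add_apply]
  match n with
  | 0 =>
    simp only [head_zero, shiftOne_zero, tensorDensity_act]
    rcases hl l with rfl | rfl <;>
      simp only [leibniz_zero, leibniz_one, leibniz_two_even, leibniz_two_odd, hdx, hdx', hDb, hDb',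
        heps, eps_inr, hf, map_smul, map_neg, map_zero, sign, if_true, if_false, zero_add, Nat.reduceAdd,
        one_ne_zero, mul_sub, mul_add, mul_neg, smul_mul_assoc, mul_smul_comm, mul_comm (eps G),
        hepsG, mul_zero, zero_mul, smul_zero] <;> module
  | 1 =>
    simp only [head_zero, head_succ, shiftOne_zero, shiftOne_succ, Pi.add_apply, zero_add]
    rcases hl l with rfl | rfl <;>
      simp only [lowA, leibniz_one, leibniz_two_even, leibniz_two_odd, leibniz_three_even,
        leibniz_three_odd, hdx, hdx', hDb, hDb',
        heps, eps_inr, hf, map_smul, map_neg, map_zero, sign, if_true, if_false, zero_add, Nat.reduceAdd,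
        one_ne_zero, mul_sub, mul_add, mul_neg, smul_mul_assoc, mul_smul_comm, mul_comm (eps G),
        mul_zero, smul_zero] <;> module
  | 2 =>
    simp only [head_zero, head_succ, shiftOne_zero, shiftOne_succ, Pi.add_apply, zero_add]
    rcases hl l with rfl | rfl <;>
      simp only [lowB, leibniz_two_even, leibniz_two_odd, leibniz_three_even,
        leibniz_three_odd, leibniz_four_even, leibniz_four_odd, hdx, hdx', hDb, hDb',
        heps, eps_inr, hf, map_smul, map_neg, map_zero, sign, if_true, if_false, zero_add, Nat.reduceAdd,
        one_ne_zero, mul_sub, mul_add, mul_neg, smul_mul_assoc, mul_smul_comm, mul_comm (eps G),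
        mul_zero, smul_zero] <;> module
  | 3 =>
    simp only [head_zero, head_succ, shiftOne_zero, shiftOne_succ, Pi.add_apply, zero_add]
    rcases hl l with rfl | rfl <;>
      simp only [lowC, leibniz_three_even, leibniz_five_even, leibniz_five_odd,
        leibniz_three_odd, leibniz_four_even, leibniz_four_odd, hdx, hdx', hDb, hDb',
        heps, eps_inr, hf, map_smul, map_neg, map_zero, sign, if_true, if_false, zero_add, Nat.reduceAdd,
        one_ne_zero, mul_sub, mul_add, mul_neg, smul_mul_assoc, mul_smul_comm, mul_comm (eps G),
        mul_zero, smul_zero] <;> module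
  -- From here on every summand contains at least three derivatives of `f`.
  | n + 4 =>
    have hz : ∀ (F : SPoly) (c h : ℕ), (dx ^ c : Module.End ℂ SPoly) F = 0 →
        (dx ^ (h + c) : Module.End ℂ SPoly) F = 0 := fun F c h hF => by
      rw [pow_add, Module.End.mul_apply, hF, map_zero]
    have e1 : leibniz (2 * k) l (n + 4) (nu • .inr (derivative f)) = 0 := by
      refine leibniz_eq_zero ?_
      rw [show (n + 4) / 2 = n / 2 + 2 by omega]
      refine hz _ 2 _ ?_
      rw [map_smul, pow_two, Module.End.mul_apply, hdx, hdx, hf, TrivSqZeroExt.inr_zero, smul_zero]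
    have e2 : leibniz (2 * k) l (n + 4 + 1) ((1 / 2 : ℂ) • .inl f) = 0 := by
      cases n with
      | zero =>
        rcases hl l with rfl | rfl <;>
        simp only [leibniz_five_even, leibniz_five_odd, hDb, hdx, hf, map_smul, map_neg, smul_zero,
          TrivSqZeroExt.inr_zero, neg_zero, zero_add, Nat.reduceAdd]
      | succ n =>
        refine leibniz_eq_zero ?_
        rw [show (n + 1 + 4 + 1) / 2 = n / 2 + 3 by omega]
        refine hz _ 3 _ ?_
        rw [map_smul, pow_succ, pow_two, Module.End.mul_apply, Module.End.mul_apply, hdx', hdx',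
          hdx', hf, TrivSqZeroExt.inl_zero, smul_zero]
    have e3 : leibniz (2 * k) l (n + 4 + 2) (.inr f) = 0 := by
      refine leibniz_eq_zero ?_
      rw [show (n + 4 + 2) / 2 = n / 2 + 3 by omega]
      refine hz _ 3 _ ?_
      rw [pow_succ, pow_two, Module.End.mul_apply, Module.End.mul_apply, hdx, hdx, hdx, hf,
        TrivSqZeroExt.inr_zero]
    rw [e1, e2, e3]
    simp

section Projections

/-! ## The conformal splitting of pseudodifferential operators -/

/-- The defect in the commutation of `D^r` with the action of `ξ x` on `𝔽(mu)`. -/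
def rho (mu : ℂ) : ℕ → ℂ
  | 0 => 0
  | r + 1 => mu + r / 2 - rho mu r

lemma rho_two_mul (mu : ℂ) (a : ℕ) : rho mu (2 * a) = a / 2 ∧ rho mu (2 * a + 1) = mu + a / 2 := by
  induction a with
  | zero => simp [rho]
  | succ a ih =>
    have h1 : rho mu (2 * (a + 1)) = (a + 1 : ℕ) / 2 := by
      rw [show 2 * (a + 1) = 2 * a + 1 + 1 by ring, rho, ih.2]
      push_cast
      ring
    refine ⟨h1, ?_⟩
    rw [rho, h1]
    push_cast
    ring

/-- These are the denominators of the conformal projections. At positive even indices they never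
vanish; at odd indices they are weights excluded by regularity. -/
lemma rho_succ_ne_zero {mu : ℂ} {m r : ℕ} (hmu : ∀ n : ℕ, n < m → mu + n / 2 ≠ 0) (hr : r < m) :
    rho mu (r + 1) ≠ 0 := by
  obtain ⟨a, rfl | rfl⟩ := exists_eq_two_mul_or r
  · rw [(rho_two_mul mu a).2]
    exact hmu a (by omega)
  · rw [show 2 * a + 1 + 1 = 2 * (a + 1) by ring, (rho_two_mul mu (a + 1)).1]
    have := Nat.cast_add_one_ne_zero (R := ℂ) a
    push_cast
    exact div_ne_zero this two_ne_zero

lemma opD_density_inr_X (mu : ℂ) (G : SPoly) : opD ((tensorDensity mu).act (.inr X) G) =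
    (tensorDensity (mu + 1 / 2)).act (.inr X) (opD G) + mu • eps G := by
  refine TrivSqZeroExt.ext ?_ ?_ <;>
    simp [tensorDensity_act, contactField_apply, xi, dxi, smul_eq_C_mul, div_eq_mul_inv]
  ring

lemma opD_pow_succ_apply (r : ℕ) (G : SPoly) : (opD ^ (r + 1) : Module.End ℂ SPoly) G =
    opD ((opD ^ r : Module.End ℂ SPoly) G) := by
  rw [pow_succ', Module.End.mul_apply]

lemma opD_pow_eps (r : ℕ) (G : SPoly) : (opD ^ r : Module.End ℂ SPoly) (eps G) =
    (-1 : ℂ) ^ r • eps ((opD ^ r : Module.End ℂ SPoly) G) := by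
  induction r with
  | zero => simp
  | succ r ih =>
    rw [opD_pow_succ_apply, ih, map_smul, opD_eps, opD_pow_succ_apply, pow_succ]
    module

lemma opD_pow_density_inr_X (mu : ℂ) (r : ℕ) (G : SPoly) :
    (opD ^ (r + 1) : Module.End ℂ SPoly) ((tensorDensity mu).act (.inr X) G) =
    (tensorDensity (mu + (r + 1 : ℕ) / 2)).act (.inr X) ((opD ^ (r + 1) : Module.End ℂ SPoly) G)
      + rho mu (r + 1) • eps ((opD ^ r : Module.End ℂ SPoly) G) := by
  induction r with
  | zero =>
    rw [zero_add, pow_one, opD_density_inr_X]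
    simp [rho]
  | succ r ih =>
    rw [opD_pow_succ_apply, ih, map_add, opD_density_inr_X, map_smul, opD_eps,
      ← opD_pow_succ_apply, ← opD_pow_succ_apply, rho.eq_2 mu (r + 1),
      show mu + ((r + 1 : ℕ) : ℂ) / 2 + 1 / 2 = mu + ((r + 1 + 1 : ℕ) : ℂ) / 2 by push_cast; ring]
    module

variable (nu q : ℂ)

/-- The coefficient of `D^r` in the conformal projection of a term of degree `2 k`. -/
def lowD : ℕ → ℂ → ZMod 2 → ℂ
  | 0, _, _ => 1
  | r + 1, k, l =>
    (-1) ^ (r + 1) * lowA nu k l * lowD r (k - 1 / 2) (l - 1) / rho (q - k) (r + 1)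

/-- The `𝔰`-equivariant projection of operators of degree `2 k` to the densities of degree
`q - k + j / 2`. -/
def theta : ℕ → ℂ → ZMod 2 → ((ℕ → SPoly) →ₗ[ℂ] SPoly)
  | 0, _, _ => LinearMap.proj 0
  | j + 1, k, l => lowD nu q (j + 1) k l • (opD ^ (j + 1) : Module.End ℂ SPoly) ∘ₗ LinearMap.proj 0
      + theta j (k - 1 / 2) (l - 1) ∘ₗ tail

variable {nu q}

lemma theta_zero (k : ℂ) (l : ZMod 2) (T : ℕ → SPoly) : theta nu q 0 k l T = T 0 := rfl

lemma theta_succ (j : ℕ) (k : ℂ) (l : ZMod 2) (T : ℕ → SPoly) : theta nu q (j + 1) k l T =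
    lowD nu q (j + 1) k l • (opD ^ (j + 1) : Module.End ℂ SPoly) (T 0)
      + theta nu q j (k - 1 / 2) (l - 1) (tail T) := rfl

lemma theta_shiftOne (j : ℕ) (k : ℂ) (l : ZMod 2) (T : ℕ → SPoly) :
    theta nu q (j + 1) k l (shiftOne T) = theta nu q j (k - 1 / 2) (l - 1) T := by
  rw [theta_succ, shiftOne_zero, map_zero, smul_zero, zero_add, tail_shiftOne]

lemma theta_head (j : ℕ) (k : ℂ) (l : ZMod 2) (G : SPoly) : theta nu q j k l (head G) =
    lowD nu q j k l • (opD ^ j : Module.End ℂ SPoly) G := by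
  cases j with
  | zero => simp [theta_zero, lowD]
  | succ j => rw [theta_succ, tail_head, map_zero, add_zero, head_zero]

lemma psiModule_act_inr_one_head (k : ℂ) (l : ZMod 2) (G : SPoly) :
    (psiModule nu q k l).act (.inr 1) (head G) = head ((1 / 2 : ℂ) • opD G) := by
  rw [psiModule_act_head nu q k l (by simp), density_inr_one]
  simp

lemma psiModule_act_inr_X_head (k : ℂ) (l : ZMod 2) (G : SPoly) :
    (psiModule nu q k l).act (.inr X) (head G) =
      head ((tensorDensity (q - k)).act (.inr X) G) + shiftOne (head (lowA nu k l • eps G)) := by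
  rw [psiModule_act_head nu q k l (by simp)]
  simp

lemma theta_act_inr_one (j : ℕ) (k : ℂ) (l : ZMod 2) (T : ℕ → SPoly) :
    theta nu q j k l ((psiModule nu q k l).act (.inr 1) T) =
      (1 / 2 : ℂ) • opD (theta nu q j k l T) := by
  induction j generalizing k l T with
  | zero =>
    conv_lhs => rw [← head_add_shiftOne_tail T, map_add, psiModule_act_inr_one_head,
      psiModule_act_shiftOne, theta_zero]
    simp [theta_zero]
  | succ j ih =>
    conv_lhs => rw [← head_add_shiftOne_tail T, map_add, psiModule_act_inr_one_head,
      psiModule_act_shiftOne, map_add, theta_shiftOne, ih, theta_head, map_smul]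
    rw [theta_succ, map_add, map_smul, smul_add, ← Module.End.mul_apply, ← Module.End.mul_apply,
      ← pow_succ, ← pow_succ']
    module

/-- Together with the action of `ξ` this gives equivariance under all of `𝔰`. The action of `ξ x`
sends a leading term to itself plus a single term one degree lower, and the coefficients `lowD` are
chosen so that this extra term cancels the defect `rho` of `D^{j+1}`. -/
lemma theta_act_inr_X {m j : ℕ} (k : ℂ) (l : ZMod 2) (hj : j ≤ m)
    (hreg : ∀ n : ℕ, n < m → q - k + n / 2 ≠ 0) (T : ℕ → SPoly) :
    theta nu q j k l ((psiModule nu q k l).act (.inr X) T) =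
      (tensorDensity (q - k + j / 2)).act (.inr X) (theta nu q j k l T) := by
  induction j generalizing k l T m with
  | zero =>
    conv_lhs => rw [← head_add_shiftOne_tail T, map_add, psiModule_act_inr_X_head,
      psiModule_act_shiftOne, theta_zero]
    simp [theta_zero]
  | succ j ih =>
    have h1 : ∀ n : ℕ, n < m - 1 → q - (k - 1 / 2) + n / 2 ≠ 0 := fun n hn => by
      have := hreg (n + 1) (by omega)
      push_cast at this
      convert this using 1
      ring
    have h2 := rho_succ_ne_zero hreg (show j < m by omega)
    -- The defining recursion of `lowD` without its denominator; this is the only point where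
    -- regularity enters.
    have h3 : lowD nu q (j + 1) k l * rho (q - k) (j + 1) =
        (-1) ^ (j + 1) * lowA nu k l * lowD nu q j (k - 1 / 2) (l - 1) := by
      rw [lowD, div_mul_cancel₀ _ h2]
    conv_lhs => rw [← head_add_shiftOne_tail T, map_add, psiModule_act_inr_X_head,
      psiModule_act_shiftOne, map_add, map_add, theta_shiftOne, theta_shiftOne,
      ih (m := m - 1) _ _ (by omega) h1, theta_head, theta_head, map_smul, opD_pow_eps,
      opD_pow_density_inr_X]
    rw [theta_succ, map_add, map_smul,
      show q - (k - 1 / 2) + (j : ℂ) / 2 = q - k + ((j + 1 : ℕ) : ℂ) / 2 by push_cast; ring,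
      smul_add, smul_smul, h3, smul_smul, smul_smul, pow_succ]
    module

lemma sign_natCast (n : ℕ) : sign (n : ZMod 2) = (-1) ^ n := by
  induction n with
  | zero => simp [sign]
  | succ n ih =>
    rw [Nat.cast_add, sign_add, ih, pow_succ]
    simp [sign]

lemma psiPar_head (l : ZMod 2) (G : SPoly) : psiPar l (head G) = head (sign l • eps G) := by
  funext n
  cases n <;> simp [psiPar_apply]

lemma theta_psiPar (j : ℕ) (k : ℂ) (l : ZMod 2) (T : ℕ → SPoly) :
    theta nu q j k l (psiPar l T) = (sign l * sign (j : ZMod 2)) • eps (theta nu q j k l T) := by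
  induction j generalizing k l T with
  | zero => simp [theta_zero, psiPar_apply, sign]
  | succ j ih =>
    conv_lhs => rw [← head_add_shiftOne_tail T, map_add, psiPar_shiftOne, psiPar_head, map_add,
      theta_shiftOne, theta_head, ih, map_smul, opD_pow_eps]
    rw [theta_succ, map_add, map_smul, sign_natCast, sign_natCast, sign_sub,
      show sign 1 = -1 by simp [sign]]
    module

/-- The projections are triangular in the coefficients of `T`, with ones on the diagonal, so their
values can be prescribed successively. -/
lemma exists_theta_eq (m : ℕ) (k : ℂ) (l : ZMod 2) (g : ℕ → SPoly) :
    ∃ T, ∀ j ≤ m, theta nu q j k l T = g j := by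
  induction m generalizing k l g with
  | zero => exact ⟨head (g 0), fun j hj => by rw [Nat.le_zero.1 hj, theta_zero, head_zero]⟩
  | succ m ih =>
    obtain ⟨T, hT⟩ := ih (k - 1 / 2) (l - 1) fun j =>
      g (j + 1) - lowD nu q (j + 1) k l • (opD ^ (j + 1) : Module.End ℂ SPoly) (g 0)
    refine ⟨head (g 0) + shiftOne T, fun j hj => ?_⟩
    cases j with
    | zero => simp [theta_zero]
    | succ j =>
      rw [map_add, theta_shiftOne, theta_head, hT j (by omega), add_sub_cancel]

lemma theta_eq_zero_iff (m : ℕ) (k : ℂ) (l : ZMod 2) (T : ℕ → SPoly) :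
    (∀ j ≤ m, theta nu q j k l T = 0) ↔ ∀ j ≤ m, T j = 0 := by
  induction m generalizing k l T with
  | zero => simp [theta_zero]
  | succ m ih =>
    have h1 := ih (k - 1 / 2) (l - 1) (tail T)
    constructor
    · intro h
      have h0 : T 0 = 0 := h 0 (by omega)
      have h2 := h1.1 fun j hj => by
        have := h (j + 1) (by omega)
        rwa [theta_succ, h0, map_zero, smul_zero, zero_add] at this
      intro j hj
      cases j with
      | zero => exact h0
      | succ j => exact h2 j (by omega)
    · intro h j hj
      cases j with
      | zero => exact h 0 hj
      | succ j =>
        rw [theta_succ, h 0 (by omega), map_zero, smul_zero, zero_add]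
        exact h1.2 (fun i hi => h (i + 1) (by omega)) j (by omega)

lemma psiModule_act_apply_eq_zero {m : ℕ} {k : ℂ} {l : ZMod 2} {F : SPoly} {T : ℕ → SPoly}
    (hT : ∀ j ≤ m, T j = 0) : ∀ j ≤ m, (psiModule nu q k l).act F T j = 0 := by
  have h0 : T = shiftOne (tail T) := by
    conv_lhs => rw [← head_add_shiftOne_tail T, hT 0 (by omega), map_zero, zero_add]
  rw [h0, psiModule_act_shiftOne]
  induction m generalizing k l T with
  | zero => intro j hj; rw [Nat.le_zero.1 hj]; rfl
  | succ m ih =>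
    intro j hj
    cases j with
    | zero => rfl
    | succ j =>
      have h1 : ∀ j ≤ m, tail T j = 0 := fun j hj => hT (j + 1) (by omega)
      have h2 : tail T = shiftOne (tail (tail T)) := by
        conv_lhs => rw [← head_add_shiftOne_tail (tail T), h1 0 (by omega), map_zero, zero_add]
      rw [shiftOne_succ, h2, psiModule_act_shiftOne]
      exact ih h1 h2 j (by omega)

/-! ### The graded module of operators modulo lower degrees -/

variable (nu q)

/-- All the conformal projections up to degree `m`. -/
def thetaPi (m : ℕ) (k : ℂ) (l : ZMod 2) : (ℕ → SPoly) →ₗ[ℂ] (Fin (m + 1) → SPoly) :=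
  LinearMap.pi fun j => theta nu q j k l

lemma exists_thetaPi_section (m : ℕ) (k : ℂ) (l : ZMod 2) :
    ∃ s : (Fin (m + 1) → SPoly) →ₗ[ℂ] (ℕ → SPoly), thetaPi nu q m k l ∘ₗ s = LinearMap.id := by
  refine LinearMap.exists_rightInverse_of_surjective _ (LinearMap.range_eq_top.2 fun g => ?_)
  obtain ⟨T, hT⟩ := exists_theta_eq (nu := nu) (q := q) m k l
    fun j => if h : j < m + 1 then g ⟨j, h⟩ else 0
  refine ⟨T, funext fun j => ?_⟩
  change theta nu q j k l T = g j
  rw [hT j (by omega), dif_pos j.2]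

/-- A section of the conformal projections. -/
def thetaSection (m : ℕ) (k : ℂ) (l : ZMod 2) : (Fin (m + 1) → SPoly) →ₗ[ℂ] (ℕ → SPoly) :=
  (exists_thetaPi_section nu q m k l).choose

/-- The quotient of `Ψ^k_l(nu, q)` by the operators of degree less than `2 k - m`, in conformal
coordinates. -/
def psiGraded (m : ℕ) (k : ℂ) (l : ZMod 2) : SuperAction (Fin (m + 1) → SPoly) :=
  ((psiModule nu q k l).shift l).compress (thetaPi nu q m k l) (thetaSection nu q m k l)

/-- By triangularity the common kernel of the projections consists of the operators whose first `m +
1` coefficients vanish, and these form a submodule. No regularity is needed for this. -/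
lemma isPresentation_psiGraded (m : ℕ) (k : ℂ) (l : ZMod 2) :
    ((psiModule nu q k l).shift l).IsPresentation ⊤ (LinearMap.ker (thetaPi nu q m k l))
      (thetaPi nu q m k l) (thetaSection nu q m k l) where
  inv_left := ⟨fun _ _ => trivial, fun _ _ _ _ => trivial⟩
  inv_right := by
    have hker : ∀ T, T ∈ LinearMap.ker (thetaPi nu q m k l) ↔ ∀ j ≤ m, T j = 0 := fun T => by
      rw [LinearMap.mem_ker, ← theta_eq_zero_iff (nu := nu) (q := q) m k l]
      refine ⟨fun h j hj => congrFun h ⟨j, by omega⟩, fun h => funext fun j => h j (by omega)⟩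
    refine ⟨fun T hT => ?_, fun F _ T hT => ?_⟩
    · rw [hker] at hT ⊢
      intro j hj
      rw [SuperAction.shift_par]
      change sign l • psiPar l T j = 0
      rw [psiPar_apply, hT j hj, map_zero, smul_zero, smul_zero]
    · rw [hker] at hT ⊢
      exact psiModule_act_apply_eq_zero hT
  mem _ := trivial
  apply_apply g := LinearMap.congr_fun (exists_thetaPi_section nu q m k l).choose_spec g
  mem_iff _ _ := LinearMap.mem_ker

lemma isRep_psiGraded (m : ℕ) (k : ℂ) (l : ZMod 2) : (psiGraded nu q m k l).IsRep :=
  (isPresentation_psiGraded nu q m k l).isRep (SuperAction.isRep_shift (psiModule_isRep nu q k l) l)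

lemma psiGraded_act_thetaPi (m : ℕ) (k : ℂ) (l : ZMod 2) (F : SPoly) (T : ℕ → SPoly) :
    (psiGraded nu q m k l).act F (thetaPi nu q m k l T) =
      thetaPi nu q m k l ((psiModule nu q k l).act F T) :=
  ((isPresentation_psiGraded nu q m k l).act_comm F (v := T) trivial).symm

/-- Equivariance of the projections under `ξ` and `ξ x` makes `𝔰` act diagonally. The parity shift
by `l` in `psiGraded` makes component `0` unshifted. -/
lemma isGraded_psiGraded (m : ℕ) (k : ℂ) (l : ZMod 2)
    (hreg : ∀ n : ℕ, n < m → q - k + n / 2 ≠ 0) :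
    IsGraded (psiGraded nu q m k l) (q - k) (fun j : Fin (m + 1) => (j : ℕ)) where
  isRep := isRep_psiGraded nu q m k l
  par g j := by
    have h1 := (isPresentation_psiGraded nu q m k l).apply_apply g
    set T := thetaSection nu q m k l g
    have h2 := ((isPresentation_psiGraded nu q m k l).par_comm (v := T) trivial).symm
    change (psiGraded nu q m k l).par _ = _ at h2
    rw [h1, SuperAction.shift_par] at h2
    rw [h2, ← h1]
    change theta nu q j k l (sign l • psiPar l T) = _ • eps (theta nu q j k l T)
    rw [map_smul, theta_psiPar, smul_smul, ← mul_assoc, sign_mul_self, one_mul]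
  conf := by
    have hsurj : ∀ g, ∃ T, thetaPi nu q m k l T = g := fun g =>
      ⟨_, (isPresentation_psiGraded nu q m k l).apply_apply g⟩
    refine IsGraded.conf_of_generators (isRep_psiGraded nu q m k l) (fun g j => ?_) fun g j => ?_
    · obtain ⟨T, rfl⟩ := hsurj g
      rw [psiGraded_act_thetaPi, density_inr_one]
      exact theta_act_inr_one j k l T
    · obtain ⟨T, rfl⟩ := hsurj g
      rw [psiGraded_act_thetaPi]
      exact theta_act_inr_X k l (by omega) hreg T

end Projections

section Coefficients

/-! ## The coefficients of the graded module of operators -/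

lemma psiModule_act_shiftOne_pow (nu q k : ℂ) (l : ZMod 2) (F : SPoly) (i : ℕ) (T : ℕ → SPoly) :
    (psiModule nu q k l).act F ((shiftOne ^ i : Module.End ℂ (ℕ → SPoly)) T) =
      (shiftOne ^ i : Module.End ℂ (ℕ → SPoly)) ((psiModule nu q (k - i / 2) (l - i)).act F T) := by
  induction i generalizing k l with
  | zero => simp
  | succ i ih =>
    rw [pow_succ', Module.End.mul_apply, Module.End.mul_apply, psiModule_act_shiftOne, ih,
      show k - 1 / 2 - (i : ℂ) / 2 = k - ((i + 1 : ℕ) : ℂ) / 2 by push_cast; ring,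
      show l - 1 - (i : ZMod 2) = l - ((i + 1 : ℕ) : ZMod 2) by push_cast; ring]

lemma theta_shiftOne_pow (nu q k : ℂ) (l : ZMod 2) (i r : ℕ) (T : ℕ → SPoly) :
    theta nu q (i + r) k l ((shiftOne ^ i : Module.End ℂ (ℕ → SPoly)) T) =
      theta nu q r (k - i / 2) (l - i) T := by
  induction i generalizing k l with
  | zero => simp
  | succ i ih =>
    rw [pow_succ', Module.End.mul_apply, show i + 1 + r = i + r + 1 by ring, theta_shiftOne, ih,
      show k - 1 / 2 - (i : ℂ) / 2 = k - ((i + 1 : ℕ) : ℂ) / 2 by push_cast; ring,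
      show l - 1 - (i : ZMod 2) = l - ((i + 1 : ℕ) : ZMod 2) by push_cast; ring]

lemma theta_shiftOne_pow_of_lt (nu q k : ℂ) (l : ZMod 2) {i j : ℕ} (h : j < i) (T : ℕ → SPoly) :
    theta nu q j k l ((shiftOne ^ i : Module.End ℂ (ℕ → SPoly)) T) = 0 := by
  induction i generalizing k l j with
  | zero => omega
  | succ i ih =>
    rw [pow_succ', Module.End.mul_apply]
    cases j with
    | zero => rfl
    | succ j => rw [theta_shiftOne, ih _ _ (by omega)]

variable (nu q : ℂ)

/-- An operator of degree `2 k` whose conformal projections are the monomial of degree `n`, in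
degree zero, and zero otherwise. -/
def lowVec (n : ℕ) (k : ℂ) (l : ZMod 2) : ℕ → SPoly :=
  match n with
  | 0 => head (mono 0)
  | 1 => head (mono 1) - lowD nu q 1 k l • shiftOne (head (mono 0))
  | _ => head (mono 2) - lowD nu q 1 k l • shiftOne (head (mono 1))
      + (lowD nu q 1 k l * lowD nu q 1 (k - 1 / 2) (l - 1) - lowD nu q 2 k l)
        • shiftOne (shiftOne (head (mono 0)))

/-- The coefficient of `1` in the image of `lowVec` under the action of `ξ x²`. -/
def lowCoef (n : ℕ) (k : ℂ) (l : ZMod 2) : ℂ :=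
  cc (theta nu q (n + 3) k l ((psiModule nu q k l).act gen (lowVec nu q n k l)))

variable {nu q}

lemma opD_mono_one : opD (mono 1) = mono 0 := opD_mono_odd 0

lemma opD_mono_two : opD (mono 2) = mono 1 := by simpa using opD_mono_even 0

lemma opD_mono_three : opD (mono 3) = mono 2 := opD_mono_odd 1

lemma opD_mono_four : opD (mono 4) = (2 : ℂ) • mono 3 := by
  have := opD_mono_even 1
  norm_num at this
  exact this

lemma opD_mono_five : opD (mono 5) = mono 4 := opD_mono_odd 2

lemma theta_lowVec {n : ℕ} (hn : n ≤ 2) (k : ℂ) (l : ZMod 2) (j : ℕ) :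
    theta nu q j k l (lowVec nu q n k l) = if j = 0 then mono n else 0 := by
  have hzero : ∀ r, (opD ^ r : Module.End ℂ SPoly) 0 = 0 := fun r => map_zero _
  have h0 : ∀ r, (opD ^ (r + 1) : Module.End ℂ SPoly) (mono 0) = 0 := fun r => by
    rw [pow_succ, Module.End.mul_apply, opD_mono_zero, hzero]
  have h1 : ∀ r, (opD ^ (r + 1) : Module.End ℂ SPoly) (mono 1) =
      (opD ^ r : Module.End ℂ SPoly) (mono 0) := fun r => by
    rw [pow_succ, Module.End.mul_apply, opD_mono_one]
  have h2 : ∀ r, (opD ^ (r + 1) : Module.End ℂ SPoly) (mono 2) =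
      (opD ^ r : Module.End ℂ SPoly) (mono 1) := fun r => by
    rw [pow_succ, Module.End.mul_apply, opD_mono_two]
  have hD : ∀ k l, lowD nu q 0 k l = 1 := fun k l => rfl
  interval_cases n
  · rcases j with _ | j
    · simp [lowVec, theta_zero]
    · simp [lowVec, theta_head, h0]
  · rcases j with _ | _ | j
    · simp [lowVec, theta_zero]
    · simp [lowVec, theta_head, theta_shiftOne, opD_mono_one, hD]
    · simp [lowVec, theta_head, theta_shiftOne, h0, h1]
  · rcases j with _ | _ | _ | j
    · simp [lowVec, theta_zero]
    · simp only [lowVec, map_add, map_sub, map_smul, theta_head, theta_shiftOne, h2, hD,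
        pow_zero, Module.End.one_apply, one_smul, theta_zero, shiftOne_zero, smul_zero, add_zero,
        zero_add, sub_self, one_ne_zero, if_false]
    · simp only [lowVec, map_add, map_sub, map_smul, theta_head, theta_shiftOne, h1, h2, hD,
        pow_zero, Module.End.one_apply, one_smul, Nat.succ_ne_zero, if_false, zero_add, Nat.reduceAdd,
        show (2 : ℕ) = 1 + 1 from rfl, smul_smul]
      module
    · simp [lowVec, theta_head, theta_shiftOne, h0, h1, h2]

lemma thetaPi_apply (m : ℕ) (k : ℂ) (l : ZMod 2) (T : ℕ → SPoly) (j : Fin (m + 1)) :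
    thetaPi nu q m k l T j = theta nu q j k l T := rfl

/-- The components from `i` onwards are those of `Ψ^{k-i/2}_{l-i}` with the same `nu` and `q`, so
every scalar is one leaving component `0`, at shifted parameters. -/
lemma coef_psiGraded {m : ℕ} {n : ℕ} (hn : n ≤ 2) (k : ℂ) (l : ZMod 2) {i j : Fin (m + 1)}
    (hij : (j : ℕ) = i + 3 + n) :
    coef (psiGraded nu q m k l) i j n = lowCoef nu q n (k - (i : ℕ) / 2) (l - (i : ℕ)) := by
  set T := lowVec nu q n (k - (i : ℕ) / 2) (l - (i : ℕ)) with hT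
  have h1 : thetaPi nu q m k l ((shiftOne ^ (i : ℕ) : Module.End ℂ (ℕ → SPoly)) T) =
      Pi.single i (mono n) := by
    funext s
    change theta nu q s k l _ = _
    rcases lt_trichotomy (s : ℕ) i with h | h | h
    · rw [theta_shiftOne_pow_of_lt _ _ _ _ h, Pi.single_eq_of_ne (by rintro rfl; omega)]
    · have h2 : s = i := Fin.ext h
      subst h2
      have := theta_shiftOne_pow nu q k l s 0 T
      rw [add_zero, theta_lowVec hn] at this
      rw [this, Pi.single_eq_same, if_pos rfl]
    · obtain ⟨r, hr⟩ := Nat.exists_eq_add_of_lt h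
      rw [hr, add_assoc, theta_shiftOne_pow, theta_lowVec hn, if_neg (Nat.succ_ne_zero r),
        Pi.single_eq_of_ne (by rintro rfl; omega)]
  have h2 : theta nu q j k l ((psiModule nu q k l).act gen
      ((shiftOne ^ (i : ℕ) : Module.End ℂ (ℕ → SPoly)) T)) =
      theta nu q (n + 3) (k - (i : ℕ) / 2) (l - (i : ℕ))
        ((psiModule nu q (k - (i : ℕ) / 2) (l - (i : ℕ))).act gen T) := by
    rw [show (j : ℕ) = i + (n + 3) by omega, psiModule_act_shiftOne_pow, theta_shiftOne_pow]
  rw [coef, entry_apply, ← h1, psiGraded_act_thetaPi, lowCoef, ← hT, ← h2, thetaPi_apply]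

lemma psiModule_act_gen_head (k : ℂ) (l : ZMod 2) (G : SPoly) :
    (psiModule nu q k l).act gen (head G) =
      head ((tensorDensity (q - k)).act gen G)
      + shiftOne (head ((2 * lowA nu k l) • (mono 2 * eps G))
      + shiftOne (head ((2 * lowB nu k l) • (mono 1 * eps G))
      + shiftOne (head ((2 * lowC nu k l) • eps G)))) := by
  have h1 : derivative (X ^ 2 : ℂ[X]) = C 2 * X := by simp [one_add_one_eq_two, C_ofNat]
  have h2 : derivative (C 2 * X : ℂ[X]) = C 2 := by
    rw [derivative_C_mul, derivative_X, mul_one]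
  have h3 : (.inl (C 2 * X) : SPoly) = (2 : ℂ) • mono 2 := by
    rw [mono_two, ← TrivSqZeroExt.inl_smul, smul_eq_C_mul]
  have h4 : (.inr (C 2) : SPoly) = (2 : ℂ) • mono 1 := by
    rw [mono_one, ← TrivSqZeroExt.inr_smul, smul_eq_C_mul, mul_one]
  have h5 : (.inl (C 2) : SPoly) = (2 : ℂ) • (1 : SPoly) := by
    rw [← TrivSqZeroExt.inl_one, ← TrivSqZeroExt.inl_smul, smul_eq_C_mul, mul_one]
  have h6 : derivative (derivative (derivative (X ^ 2 : ℂ[X]))) = 0 := by rw [h1, h2, derivative_C]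
  rw [psiModule_act_head nu q k l h6, h1, h2, h3, h4, h5]
  simp only [smul_mul_assoc, smul_smul, one_mul, mul_comm (2 : ℂ)]

/-- The constant terms of the conformal projections of `ξ x²` acting on monomials. -/
lemma cc_theta_act_gen (k : ℂ) (l : ZMod 2) :
    cc (theta nu q 3 k l ((psiModule nu q k l).act gen (head (mono 0)))) =
      2 * (q - k) * lowD nu q 3 k l + 2 * lowA nu k l * lowD nu q 2 (k - 1 / 2) (l - 1)
      + 2 * lowB nu k l * lowD nu q 1 (k - 1 / 2 - 1 / 2) (l - 1 - 1) + 2 * lowC nu k l ∧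
    cc (theta nu q 4 k l ((psiModule nu q k l).act gen (head (mono 1)))) =
      lowD nu q 4 k l - 2 * lowA nu k l * lowD nu q 3 (k - 1 / 2) (l - 1)
      - 2 * lowC nu k l * lowD nu q 1 (k - 1 / 2 - 1 / 2 - 1 / 2) (l - 1 - 1 - 1) ∧
    cc (theta nu q 5 k l ((psiModule nu q k l).act gen (head (mono 2)))) =
      (1 + 4 * (q - k)) * lowD nu q 5 k l + 4 * lowA nu k l * lowD nu q 4 (k - 1 / 2) (l - 1)
      + 2 * lowB nu k l * lowD nu q 3 (k - 1 / 2 - 1 / 2) (l - 1 - 1)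
      + 2 * lowC nu k l * lowD nu q 2 (k - 1 / 2 - 1 / 2 - 1 / 2) (l - 1 - 1 - 1) := by
  have he : ∀ a, eps (mono (2 * a)) = mono (2 * a) := fun a => by
    rw [mono_two_mul]; refine TrivSqZeroExt.ext ?_ ?_ <;> simp
  have e0 := he 0
  have e2 := he 1
  have e1 : eps (mono 1) = -mono 1 := by rw [mono_one, eps_inr]
  have p20 : mono 2 * mono 0 = mono 2 := by
    rw [mono_zero, TrivSqZeroExt.inl_one, mul_one]
  have p10 : mono 1 * mono 0 = mono 1 := by
    rw [mono_zero, TrivSqZeroExt.inl_one, mul_one]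
  have p21 : mono 2 * mono 1 = mono 3 := by
    have := mono_two_mul_add_one 1
    norm_num at this
    rw [this, mono_two, mono_one]; refine TrivSqZeroExt.ext ?_ ?_ <;> simp
  have p12 : mono 1 * mono 2 = mono 3 := by rw [mul_comm, p21]
  have p11 : mono 1 * mono 1 = 0 := by
    rw [mono_one]; refine TrivSqZeroExt.ext ?_ ?_ <;> simp
  have p22 : mono 2 * mono 2 = mono 4 := by
    have := mono_two_mul 2
    norm_num at this
    rw [this, mono_two]; refine TrivSqZeroExt.ext ?_ ?_ <;> simp [pow_two]
  have g0 : (tensorDensity (q - k)).act gen (mono 0) = (2 * (q - k)) • mono 3 :=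
    (density_gen_even (q - k) 0).trans (by simp)
  have g1 : (tensorDensity (q - k)).act gen (mono 1) = (1 / 2 : ℂ) • mono 4 :=
    density_gen_odd (q - k) 0
  have g2 : (tensorDensity (q - k)).act gen (mono 2) = (1 / 2 + 2 * (q - k)) • mono 5 :=
    (density_gen_even (q - k) 1).trans (by simp)
  have hD : ∀ k l, lowD nu q 0 k l = 1 := fun k l => rfl
  have c0 : cc (mono 0) = 1 := by simp [cc_apply, mono_zero]
  rw [mul_zero] at e0
  rw [mul_one] at e2
  refine ⟨?_, ?_, ?_⟩ <;> rw [psiModule_act_gen_head] <;>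
  simp only [e0, e1, e2, p20, p10, p21, p12, p11, p22, g0, g1, g2, map_add, map_smul, map_neg,
    smul_zero, map_zero, theta_shiftOne, theta_head, pow_succ, pow_zero, one_mul, mul_neg,
    Module.End.mul_apply, opD_mono_one, opD_mono_two, opD_mono_three, opD_mono_four,
    opD_mono_five, smul_eq_mul, c0, hD, Module.End.one_apply] <;> ring

lemma rho_one (mu : ℂ) : rho mu 1 = mu := by simpa using (rho_two_mul mu 0).2
lemma rho_two (mu : ℂ) : rho mu 2 = 1 / 2 := by simpa using (rho_two_mul mu 1).1
lemma rho_three (mu : ℂ) : rho mu 3 = mu + 1 / 2 := by simpa using (rho_two_mul mu 1).2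
lemma rho_four (mu : ℂ) : rho mu 4 = 1 := by simpa using (rho_two_mul mu 2).1
lemma rho_five (mu : ℂ) : rho mu 5 = mu + 1 := by simpa using (rho_two_mul mu 2).2

lemma lowCoef_zero (k : ℂ) (l : ZMod 2) : lowCoef nu q 0 k l =
    2 * (q - k) * lowD nu q 3 k l + 2 * lowA nu k l * lowD nu q 2 (k - 1 / 2) (l - 1)
      + 2 * lowB nu k l * lowD nu q 1 (k - 1 / 2 - 1 / 2) (l - 1 - 1) + 2 * lowC nu k l := by
  rw [← (cc_theta_act_gen k l).1, lowCoef, lowVec, zero_add]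

lemma lowCoef_one (k : ℂ) (l : ZMod 2) : lowCoef nu q 1 k l =
    lowD nu q 4 k l - 2 * lowA nu k l * lowD nu q 3 (k - 1 / 2) (l - 1)
      - 2 * lowC nu k l * lowD nu q 1 (k - 1 / 2 - 1 / 2 - 1 / 2) (l - 1 - 1 - 1)
      - lowD nu q 1 k l * lowCoef nu q 0 (k - 1 / 2) (l - 1) := by
  rw [← (cc_theta_act_gen k l).2.1, lowCoef_zero, ← (cc_theta_act_gen (k - 1 / 2) (l - 1)).1,
    lowCoef, lowVec, Nat.add_comm 1 3]
  simp only [map_sub, map_smul, psiModule_act_shiftOne, theta_shiftOne, smul_eq_mul,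
    Nat.reduceAdd]

lemma lowCoef_two (k : ℂ) (l : ZMod 2) : lowCoef nu q 2 k l =
    (1 + 4 * (q - k)) * lowD nu q 5 k l + 4 * lowA nu k l * lowD nu q 4 (k - 1 / 2) (l - 1)
      + 2 * lowB nu k l * lowD nu q 3 (k - 1 / 2 - 1 / 2) (l - 1 - 1)
      + 2 * lowC nu k l * lowD nu q 2 (k - 1 / 2 - 1 / 2 - 1 / 2) (l - 1 - 1 - 1)
      - lowD nu q 1 k l * (lowCoef nu q 1 (k - 1 / 2) (l - 1)
        + lowD nu q 1 (k - 1 / 2) (l - 1) * lowCoef nu q 0 (k - 1 / 2 - 1 / 2) (l - 1 - 1))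
      + (lowD nu q 1 k l * lowD nu q 1 (k - 1 / 2) (l - 1) - lowD nu q 2 k l)
        * lowCoef nu q 0 (k - 1 / 2 - 1 / 2) (l - 1 - 1) := by
  have h0 := lowCoef_zero (nu := nu) (q := q) (k - 1 / 2 - 1 / 2) (l - 1 - 1)
  rw [← (cc_theta_act_gen _ _).1] at h0
  have h1 := lowCoef_one (nu := nu) (q := q) (k - 1 / 2) (l - 1)
  rw [← (cc_theta_act_gen _ _).2.1] at h1
  rw [← (cc_theta_act_gen k l).2.2, h1, h0, lowCoef]
  have h3 : lowVec nu q 2 k l = head (mono 2) - lowD nu q 1 k l • shiftOne (head (mono 1))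
      + (lowD nu q 1 k l * lowD nu q 1 (k - 1 / 2) (l - 1) - lowD nu q 2 k l)
        • shiftOne (shiftOne (head (mono 0))) := rfl
  rw [h3, Nat.add_comm 2 3]
  simp only [map_add, map_sub, map_smul, psiModule_act_shiftOne, smul_eq_mul]
  rw [theta_shiftOne (j := 4), theta_shiftOne (j := 4), theta_shiftOne (j := 3)]
  ring

section LowCoef

variable (L z : ℂ)

/-- Here `L = q - k` is the weight of the starting component and `z = 2 k` the degree. The
combinations `2 L + z = 2 q` and `4 nu + 2 L + z - 1` do not change when the starting component
moves; writing the result in them makes the later equations uniform. -/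
lemma lowCoef_zero_even (h2 : 2 * L + 1 ≠ 0) (h3 : L + 1 ≠ 0) :
    lowCoef nu (L + z / 2) 0 (z / 2) 0 =
      -(z * (z - 2) * (4 * nu + 2 * L + z - 1)) / (8 * (2 * L + 1)) := by
  have hm : (0 - 1 : ZMod 2) = 1 := rfl
  have hm' : (1 - 1 : ZMod 2) = 0 := rfl
  have r0 : L + z / 2 - z / 2 = L := by ring
  have r1 : L + z / 2 - (z / 2 - 1 / 2) = (2 * L + 1) / 2 := by ring
  have r2 : L + z / 2 - (z / 2 - 1 / 2 - 1 / 2) = L + 1 := by ring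
  have r3 : L + z / 2 - (z / 2 - 1 / 2 - 1 / 2 - 1 / 2) = (2 * L + 3) / 2 := by ring
  have r4 : L + z / 2 - (z / 2 - 1 / 2 - 1 / 2 - 1 / 2 - 1 / 2) = L + 2 := by ring
  have r5 : L + 1 / 2 = (2 * L + 1) / 2 := by ring
  have r6 : (2 * L + 1) / 2 + 1 / 2 = L + 1 := by ring
  have r7 : (2 * L + 1) / 2 + 1 = (2 * L + 3) / 2 := by ring
  have r8 : L + 1 + 1 / 2 = (2 * L + 3) / 2 := by ring
  have r9 : (2 * L + 3) / 2 + 1 / 2 = L + 2 := by ring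
  rw [lowCoef_zero]
  simp only [lowD, lowA, lowB, lowC, hm, hm', if_true, if_false, one_ne_zero, zero_add,
    Nat.reduceAdd, rho_one, rho_two, rho_three, rho_four, rho_five, r0, r1, r2, r3, r4, r5, r6, r7,
    r8, r9]
  field_simp
  ring

lemma lowCoef_zero_odd (h2 : 2 * L + 1 ≠ 0) (h3 : L + 1 ≠ 0) :
    lowCoef nu (L + z / 2) 0 (z / 2) 1 =
      (z - 1) * ((2 * L + 1) * (2 * L + z) - (4 * nu + 2 * L + z - 1) ^ 2 + 1) / (8 * (2 * L + 1)) := by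
  have hm : (0 - 1 : ZMod 2) = 1 := rfl
  have hm' : (1 - 1 : ZMod 2) = 0 := rfl
  have r0 : L + z / 2 - z / 2 = L := by ring
  have r1 : L + z / 2 - (z / 2 - 1 / 2) = (2 * L + 1) / 2 := by ring
  have r2 : L + z / 2 - (z / 2 - 1 / 2 - 1 / 2) = L + 1 := by ring
  have r3 : L + z / 2 - (z / 2 - 1 / 2 - 1 / 2 - 1 / 2) = (2 * L + 3) / 2 := by ring
  have r4 : L + z / 2 - (z / 2 - 1 / 2 - 1 / 2 - 1 / 2 - 1 / 2) = L + 2 := by ring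
  have r5 : L + 1 / 2 = (2 * L + 1) / 2 := by ring
  have r6 : (2 * L + 1) / 2 + 1 / 2 = L + 1 := by ring
  have r7 : (2 * L + 1) / 2 + 1 = (2 * L + 3) / 2 := by ring
  have r8 : L + 1 + 1 / 2 = (2 * L + 3) / 2 := by ring
  have r9 : (2 * L + 3) / 2 + 1 / 2 = L + 2 := by ring
  rw [lowCoef_zero]
  simp only [lowD, lowA, lowB, lowC, hm, hm', if_true, if_false, one_ne_zero, zero_add,
    Nat.reduceAdd, rho_one, rho_two, rho_three, rho_four, rho_five, r0, r1, r2, r3, r4, r5, r6, r7,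
    r8, r9]
  field_simp
  ring

lemma lowCoef_one_even (h1 : L ≠ 0) (h3 : L + 1 ≠ 0) (h4 : 2 * L + 3 ≠ 0) :
    lowCoef nu (L + z / 2) 1 (z / 2) 0 =
      z * (z - 2) * (2 * (2 * L + 3) * (2 * L + z) - 3 * (4 * nu + 2 * L + z - 1) ^ 2
        + (2 * L + 1) * (2 * L + 3)) / (64 * L * (2 * L + 3)) := by
  have hm : (0 - 1 : ZMod 2) = 1 := rfl
  have hm' : (1 - 1 : ZMod 2) = 0 := rfl
  have r0 : L + z / 2 - z / 2 = L := by ring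
  have r1 : L + z / 2 - (z / 2 - 1 / 2) = (2 * L + 1) / 2 := by ring
  have r2 : L + z / 2 - (z / 2 - 1 / 2 - 1 / 2) = L + 1 := by ring
  have r3 : L + z / 2 - (z / 2 - 1 / 2 - 1 / 2 - 1 / 2) = (2 * L + 3) / 2 := by ring
  have r4 : L + z / 2 - (z / 2 - 1 / 2 - 1 / 2 - 1 / 2 - 1 / 2) = L + 2 := by ring
  have r5 : L + 1 / 2 = (2 * L + 1) / 2 := by ring
  have r6 : (2 * L + 1) / 2 + 1 / 2 = L + 1 := by ring
  have r7 : (2 * L + 1) / 2 + 1 = (2 * L + 3) / 2 := by ring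
  have r8 : L + 1 + 1 / 2 = (2 * L + 3) / 2 := by ring
  have r9 : (2 * L + 3) / 2 + 1 / 2 = L + 2 := by ring
  simp only [lowCoef_one, lowCoef_zero, lowD, lowA, lowB, lowC, hm, hm', if_true, if_false, one_ne_zero, zero_add,
    Nat.reduceAdd, rho_one, rho_two, rho_three, rho_four, rho_five, r0, r1, r2, r3, r4, r5, r6, r7,
    r8, r9]
  field_simp
  ring

lemma lowCoef_one_odd (h1 : L ≠ 0) (h3 : L + 1 ≠ 0) (h4 : 2 * L + 3 ≠ 0) :
    lowCoef nu (L + z / 2) 1 (z / 2) 1 =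
      (z - 1) * (z - 3) * (4 * L * (3 * L + z + 1) - 3 * (4 * nu + 2 * L + z - 1) ^ 2)
        / (64 * L * (2 * L + 3)) := by
  have hm : (0 - 1 : ZMod 2) = 1 := rfl
  have hm' : (1 - 1 : ZMod 2) = 0 := rfl
  have r0 : L + z / 2 - z / 2 = L := by ring
  have r1 : L + z / 2 - (z / 2 - 1 / 2) = (2 * L + 1) / 2 := by ring
  have r2 : L + z / 2 - (z / 2 - 1 / 2 - 1 / 2) = L + 1 := by ring
  have r3 : L + z / 2 - (z / 2 - 1 / 2 - 1 / 2 - 1 / 2) = (2 * L + 3) / 2 := by ring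
  have r4 : L + z / 2 - (z / 2 - 1 / 2 - 1 / 2 - 1 / 2 - 1 / 2) = L + 2 := by ring
  have r5 : L + 1 / 2 = (2 * L + 1) / 2 := by ring
  have r6 : (2 * L + 1) / 2 + 1 / 2 = L + 1 := by ring
  have r7 : (2 * L + 1) / 2 + 1 = (2 * L + 3) / 2 := by ring
  have r8 : L + 1 + 1 / 2 = (2 * L + 3) / 2 := by ring
  have r9 : (2 * L + 3) / 2 + 1 / 2 = L + 2 := by ring
  simp only [lowCoef_one, lowCoef_zero, lowD, lowA, lowB, lowC, hm, hm', if_true, if_false, one_ne_zero, zero_add,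
    Nat.reduceAdd, rho_one, rho_two, rho_three, rho_four, rho_five, r0, r1, r2, r3, r4, r5, r6, r7,
    r8, r9]
  field_simp
  ring

/-- The corrections in `lowVec` bring in the shorter coefficients of the components one and two
steps further on, so the formulas above are reused at `(L + 1/2, z - 1)` and `(L + 1, z - 2)`. -/
lemma lowCoef_two_even (h1 : L ≠ 0) (h2 : 2 * L + 1 ≠ 0) (h3 : L + 1 ≠ 0) (h4 : 2 * L + 3 ≠ 0)
    (h5 : L + 2 ≠ 0) :
    lowCoef nu (L + z / 2) 2 (z / 2) 0 =
      z * (z - 2) * (z - 4) * (2 * (L + 1) * (2 * L + z) + 3 - 3 * (4 * nu + 2 * L + z - 1) ^ 2)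
        / (256 * L * (L + 1) * (L + 2)) := by
  have hm : (0 - 1 : ZMod 2) = 1 := rfl
  have hm' : (1 - 1 : ZMod 2) = 0 := rfl
  have r0 : L + z / 2 - z / 2 = L := by ring
  have r1 : L + z / 2 - (z / 2 - 1 / 2) = (2 * L + 1) / 2 := by ring
  have r2 : L + z / 2 - (z / 2 - 1 / 2 - 1 / 2) = L + 1 := by ring
  have r3 : L + z / 2 - (z / 2 - 1 / 2 - 1 / 2 - 1 / 2) = (2 * L + 3) / 2 := by ring
  have r4 : L + z / 2 - (z / 2 - 1 / 2 - 1 / 2 - 1 / 2 - 1 / 2) = L + 2 := by ring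
  have r5 : L + 1 / 2 = (2 * L + 1) / 2 := by ring
  have r6 : (2 * L + 1) / 2 + 1 / 2 = L + 1 := by ring
  have r7 : (2 * L + 1) / 2 + 1 = (2 * L + 3) / 2 := by ring
  have r8 : L + 1 + 1 / 2 = (2 * L + 3) / 2 := by ring
  have r9 : (2 * L + 3) / 2 + 1 / 2 = L + 2 := by ring
  have t1 := lowCoef_one_odd (nu := nu) (L + 1 / 2) (z - 1)
    (by contrapose! h2; linear_combination 2 * h2) (by contrapose! h4; linear_combination 2 * h4)
    (by contrapose! h5; linear_combination h5 / 2)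
  have t0 := lowCoef_zero_even (nu := nu) (L + 1) (z - 2)
    (by contrapose! h4; linear_combination h4) (by contrapose! h5; linear_combination h5)
  rw [show L + 1 / 2 + (z - 1) / 2 = L + z / 2 by ring,
    show (z - 1) / 2 = z / 2 - 1 / 2 by ring,
    show 64 * (L + 1 / 2) * (2 * (L + 1 / 2) + 3) = 64 * (2 * L + 1) * (L + 2) by ring] at t1
  rw [show L + 1 + (z - 2) / 2 = L + z / 2 by ring,
    show (z - 2) / 2 = z / 2 - 1 / 2 - 1 / 2 by ring,
    show 2 * (L + 1) + 1 = 2 * L + 3 by ring] at t0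
  -- The linear denominators become opaque atoms while fractions are cleared, and are substituted
  -- back for the final polynomial identity.
  obtain ⟨a, ha⟩ : ∃ a, 2 * L + 1 = a := ⟨_, rfl⟩
  obtain ⟨b, hb⟩ : ∃ b, L + 1 = b := ⟨_, rfl⟩
  obtain ⟨c, hc⟩ : ∃ c, 2 * L + 3 = c := ⟨_, rfl⟩
  obtain ⟨d, hd⟩ : ∃ d, L + 2 = d := ⟨_, rfl⟩
  rw [lowCoef_two]
  simp only [t0, t1, lowD, lowA, lowB, lowC, hm, hm', if_true, if_false, one_ne_zero, zero_add,
    Nat.reduceAdd, rho_one, rho_two, rho_three, rho_four, rho_five, r0, r1, r2, r3, r4, r5, r6, r7,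
    r8, r9]
  simp only [ha, hb, hc, hd] at h2 h3 h4 h5 ⊢
  field_simp
  subst ha hb hc hd
  ring

lemma lowCoef_two_odd (h1 : L ≠ 0) (h2 : 2 * L + 1 ≠ 0) (h3 : L + 1 ≠ 0) (h4 : 2 * L + 3 ≠ 0)
    (h5 : L + 2 ≠ 0) :
    lowCoef nu (L + z / 2) 2 (z / 2) 1 =
      (z - 1) * (z - 3) * (4 * nu + 2 * L + z - 1) * (8 * (L + 1) * (2 * L + z) - 4 * L ^ 2 - 8 * L
        + 8 - 3 * (4 * nu + 2 * L + z - 1) ^ 2) / (256 * L * (L + 1) * (L + 2)) := by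
  have hm : (0 - 1 : ZMod 2) = 1 := rfl
  have hm' : (1 - 1 : ZMod 2) = 0 := rfl
  have r0 : L + z / 2 - z / 2 = L := by ring
  have r1 : L + z / 2 - (z / 2 - 1 / 2) = (2 * L + 1) / 2 := by ring
  have r2 : L + z / 2 - (z / 2 - 1 / 2 - 1 / 2) = L + 1 := by ring
  have r3 : L + z / 2 - (z / 2 - 1 / 2 - 1 / 2 - 1 / 2) = (2 * L + 3) / 2 := by ring
  have r4 : L + z / 2 - (z / 2 - 1 / 2 - 1 / 2 - 1 / 2 - 1 / 2) = L + 2 := by ring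
  have r5 : L + 1 / 2 = (2 * L + 1) / 2 := by ring
  have r6 : (2 * L + 1) / 2 + 1 / 2 = L + 1 := by ring
  have r7 : (2 * L + 1) / 2 + 1 = (2 * L + 3) / 2 := by ring
  have r8 : L + 1 + 1 / 2 = (2 * L + 3) / 2 := by ring
  have r9 : (2 * L + 3) / 2 + 1 / 2 = L + 2 := by ring
  have t1 := lowCoef_one_even (nu := nu) (L + 1 / 2) (z - 1)
    (by contrapose! h2; linear_combination 2 * h2) (by contrapose! h4; linear_combination 2 * h4)
    (by contrapose! h5; linear_combination h5 / 2)
  have t0 := lowCoef_zero_odd (nu := nu) (L + 1) (z - 2)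
    (by contrapose! h4; linear_combination h4) (by contrapose! h5; linear_combination h5)
  rw [show L + 1 / 2 + (z - 1) / 2 = L + z / 2 by ring,
    show (z - 1) / 2 = z / 2 - 1 / 2 by ring,
    show 64 * (L + 1 / 2) * (2 * (L + 1 / 2) + 3) = 64 * (2 * L + 1) * (L + 2) by ring] at t1
  rw [show L + 1 + (z - 2) / 2 = L + z / 2 by ring,
    show (z - 2) / 2 = z / 2 - 1 / 2 - 1 / 2 by ring,
    show 2 * (L + 1) + 1 = 2 * L + 3 by ring] at t0
  obtain ⟨a, ha⟩ : ∃ a, 2 * L + 1 = a := ⟨_, rfl⟩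
  obtain ⟨b, hb⟩ : ∃ b, L + 1 = b := ⟨_, rfl⟩
  obtain ⟨c, hc⟩ : ∃ c, 2 * L + 3 = c := ⟨_, rfl⟩
  obtain ⟨d, hd⟩ : ∃ d, L + 2 = d := ⟨_, rfl⟩
  rw [lowCoef_two]
  simp only [t0, t1, lowD, lowA, lowB, lowC, hm, hm', if_true, if_false, one_ne_zero, zero_add,
    Nat.reduceAdd, rho_one, rho_two, rho_three, rho_four, rho_five, r0, r1, r2, r3, r4, r5, r6, r7,
    r8, r9]
  simp only [ha, hb, hc, hd] at h2 h3 h4 h5 ⊢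
  field_simp
  subst ha hb hc hd
  ring

end LowCoef

end Coefficients

section Subquotients

/-! ## Subquotients of graded modules -/

/-- A subquotient of a subquotient is a subquotient; used to return from the graded picture to `Ψ`
itself. -/
lemma SuperAction.IsPresentation.trans {V W Z : Type*} [AddCommGroup V] [Module ℂ V]
    [AddCommGroup W] [Module ℂ W] [AddCommGroup Z] [Module ℂ Z] {A : SuperAction V}
    {M N : Submodule ℂ V} {p : V →ₗ[ℂ] W} {q : W →ₗ[ℂ] V} {M' N' : Submodule ℂ W}
    {p' : W →ₗ[ℂ] Z} {q' : Z →ₗ[ℂ] W} (h : A.IsPresentation M N p q)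
    (h' : (A.compress p q).IsPresentation M' N' p' q') :
    A.IsPresentation (M ⊓ M'.comap p) (M ⊓ N'.comap p) (p' ∘ₗ p) (q ∘ₗ q') where
  inv_left := by
    refine ⟨fun v hv => ⟨h.inv_left.1 v hv.1, ?_⟩, fun F _ v hv => ⟨h.inv_left.2 F trivial v hv.1, ?_⟩⟩
    · rw [SetLike.mem_coe, Submodule.mem_comap, h.par_comm hv.1]
      exact h'.inv_left.1 _ hv.2
    · rw [SetLike.mem_coe, Submodule.mem_comap, h.act_comm F hv.1]
      exact h'.inv_left.2 F trivial _ hv.2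
  inv_right := by
    refine ⟨fun v hv => ⟨h.inv_left.1 v hv.1, ?_⟩, fun F _ v hv => ⟨h.inv_left.2 F trivial v hv.1, ?_⟩⟩
    · rw [SetLike.mem_coe, Submodule.mem_comap, h.par_comm hv.1]
      exact h'.inv_right.1 _ hv.2
    · rw [SetLike.mem_coe, Submodule.mem_comap, h.act_comm F hv.1]
      exact h'.inv_right.2 F trivial _ hv.2
  mem w := ⟨h.mem _, by
    rw [SetLike.mem_coe, Submodule.mem_comap, LinearMap.comp_apply, h.apply_apply]
    exact h'.mem w⟩
  apply_apply w := by simp only [LinearMap.comp_apply, h.apply_apply, h'.apply_apply]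
  mem_iff v hv := by
    rw [LinearMap.comp_apply, ← h'.mem_iff _ hv.2]
    exact ⟨fun hv' => hv'.2, fun hv' => ⟨hv.1, hv'⟩⟩

/-- The elements supported on `T`. -/
def supported {ι : Type*} (T : Set ι) : Submodule ℂ (ι → SPoly) where
  carrier := {g | ∀ i ∉ T, g i = 0}
  zero_mem' _ _ := rfl
  add_mem' h h' i hi := by rw [Pi.add_apply, h i hi, h' i hi, add_zero]
  smul_mem' c g h i hi := by rw [Pi.smul_apply, h i hi, smul_zero]

namespace IsGraded

variable {ι κ : Type*} [DecidableEq ι] [Fintype ι] {A : SuperAction (ι → SPoly)} {lam : ℂ}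
  {m : ι → ℕ}

lemma invariant_supported (h : IsGraded A lam m) {T : Set ι}
    (hT : ∀ i ∈ T, ∀ j ∉ T, entry A i j = 0) : A.Invariant (supported T) := by
  refine ⟨fun g hg i hi => by rw [h.par, hg i hi, map_zero, smul_zero], fun F _ g hg j hj => ?_⟩
  rw [act_eq_sum_entry]
  refine Finset.sum_eq_zero fun i _ => ?_
  by_cases hi : i ∈ T
  · rw [hT i hi j hj]; rfl
  · rw [hg i hi, map_zero]

variable [DecidableEq κ] [Fintype κ]

/-- Extension by zero along `e`. -/
def extend (e : κ → ι) : (κ → SPoly) →ₗ[ℂ] (ι → SPoly) :=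
  ∑ r, LinearMap.single ℂ (fun _ => SPoly) (e r) ∘ₗ LinearMap.proj r

lemma extend_apply (e : κ → ι) (w : κ → SPoly) :
    extend e w = ∑ r, Pi.single (e r) (w r) := by
  simp [extend]

lemma extend_apply_apply {e : κ → ι} (he : Function.Injective e) (w : κ → SPoly) (r : κ) :
    extend e w (e r) = w r := by
  rw [extend_apply, Finset.sum_apply, Finset.sum_eq_single r]
  · simp
  · intro s _ hs
    rw [Pi.single_eq_of_ne (he.ne hs.symm)]
  · simp

lemma extend_apply_of_notMem {e : κ → ι} (w : κ → SPoly) {i : ι} (hi : i ∉ Set.range e) :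
    extend e w i = 0 := by
  rw [extend_apply, Finset.sum_apply]
  refine Finset.sum_eq_zero fun r _ => Pi.single_eq_of_ne (fun h => hi ⟨r, h.symm⟩) _

lemma extend_single (e : κ → ι) (r : κ) (G : SPoly) :
    extend e (Pi.single r G) = Pi.single (e r) G := by
  rw [extend_apply, Finset.sum_eq_single r]
  · simp
  · intro s _ hs
    rw [Pi.single_eq_of_ne hs, Pi.single_zero]
  · simp

/-- The components of index in the range of `e` form a subquotient. -/
lemma isPresentation_funLeft (h : IsGraded A lam m) {e : κ → ι} (he : Function.Injective e)
    {N : Set ι} (hN : ∀ r, e r ∉ N)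
    (hM : ∀ i ∈ Set.range e ∪ N, ∀ j ∉ Set.range e ∪ N, entry A i j = 0)
    (hN' : ∀ i ∈ N, ∀ j ∉ N, entry A i j = 0) :
    A.IsPresentation (supported (Set.range e ∪ N)) (supported N)
      (LinearMap.funLeft ℂ SPoly e) (extend e) where
  inv_left := h.invariant_supported hM
  inv_right := h.invariant_supported hN'
  mem w i hi := extend_apply_of_notMem w fun h => hi (Or.inl h)
  apply_apply w := funext fun r => extend_apply_apply he w r
  mem_iff v hv := by
    refine ⟨fun h => funext fun r => h _ (hN r), fun h i hi => ?_⟩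
    by_cases hr : i ∈ Set.range e
    · obtain ⟨r, rfl⟩ := hr
      exact congrFun h r
    · exact hv i fun h' => h'.elim hr hi

lemma isGraded_compress (h : IsGraded A lam m) {e : κ → ι} (he : Function.Injective e)
    (hrep : (A.compress (LinearMap.funLeft ℂ SPoly e) (extend e)).IsRep) :
    IsGraded (A.compress (LinearMap.funLeft ℂ SPoly e) (extend e)) lam (m ∘ e) where
  isRep := hrep
  par g r := by
    rw [SuperAction.compress_par, LinearMap.funLeft_apply, h.par, extend_apply_apply he]
    rfl
  conf F hF g r := by
    rw [SuperAction.compress_act, LinearMap.funLeft_apply, h.conf F hF, extend_apply_apply he]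
    rfl

lemma coef_compress (e : κ → ι) (r s : κ) (n : ℕ) :
    coef (A.compress (LinearMap.funLeft ℂ SPoly e) (extend e)) r s n = coef A (e r) (e s) n := by
  rw [coef, coef, entry_apply, entry_apply, SuperAction.compress_act, extend_single,
    LinearMap.funLeft_apply]

/-- In degree three plus three, the Maurer–Cartan relation has a single term. -/
lemma entry_eq_zero_of_add_six {k : ℕ} {A : SuperAction (Fin k → SPoly)}
    (h : IsGraded A lam fun j : Fin k => (j : ℕ)) {i j l : Fin k} (hl : (l : ℕ) = i + 3)
    (hj : (j : ℕ) = l + 3) (hlam : 2 * lam + i ≠ 0) (hlam' : 2 * lam + (i + 5 : ℕ) ≠ 0)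
    (h0 : entry A i l = 0 ∨ entry A l j = 0) : entry A i j = 0 := by
  have hij : i ≠ j := fun h' => by rw [h'] at hl; omega
  refine h.entry_eq_zero hij fun n hn => ?_
  obtain rfl : n = 0 + 3 := by omega
  have h1 := h.mcFactor_mul_coef hij 0
  rw [Finset.sum_eq_zero, mul_zero] at h1
  · refine (mul_eq_zero.1 h1).resolve_left ?_
    have h2 : mcFactor (lam + (i : ℕ) / 2) 0 = (2 * lam + i) * (2 * lam + (i + 5 : ℕ)) / 2 := by
      simp only [mcFactor, Even.zero, if_true, Nat.zero_div, Nat.cast_zero]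
      push_cast
      ring
    rw [h2]
    exact div_ne_zero (mul_ne_zero hlam hlam') two_ne_zero
  · intro s hs
    simp only [Finset.mem_erase, Finset.mem_univ, and_true] at hs
    by_cases hsl : s = l
    · subst hsl
      rcases h0 with h0 | h0 <;> rw [h0] <;> simp
    · have h3 : (s : ℕ) ≠ l := fun h' => hsl (Fin.ext h')
      rcases lt_or_ge (s : ℕ) (i + 3) with h4 | h4
      · rw [h.entry_eq_zero_of_lt hs.2.symm h4]; simp
      · rw [h.entry_eq_zero_of_lt (i := s) (j := j) hs.1 (by omega)]; simp

end IsGraded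

/-! ## The criterion -/

/-- Up to a unit, the coefficients of the graded module of operators of degree `z = K - Λ + i`
from `𝔽(ν)`, where `4 ν = S - K + 1` and `Λ = 2 lam + i`. -/
def lowNum (K S : ℂ) (n : ℕ) (t : ZMod 2) (Λ : ℂ) : ℂ :=
  match n with
  | 0 => if t = 0 then (K - Λ) * (K - Λ - 2) * S
      else (K - Λ - 1) * ((Λ + 1) * K - S ^ 2 + 1)
  | 1 => if t = 0 then
        (K - Λ) * (K - Λ - 2) * (2 * (Λ + 3) * K - 3 * S ^ 2 + (Λ + 1) * (Λ + 3))
      else (K - Λ - 1) * (K - Λ - 3) * (Λ * (Λ + 2 * K + 2) - 3 * S ^ 2)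
  | _ => if t = 0 then
        (K - Λ) * (K - Λ - 2) * (K - Λ - 4) * ((Λ + 2) * K + 3 - 3 * S ^ 2)
      else (K - Λ - 1) * (K - Λ - 3) * S * (4 * (Λ + 2) * K - Λ ^ 2 - 4 * Λ + 8 - 3 * S ^ 2)

/-- The discarded factor `c` is the denominator of the closed formula (up to sign), a product of
factors that regularity makes non-zero. -/
lemma exists_lowCoef_eq (K S L : ℂ) {n : ℕ} (hn : n ≤ 2) (t : ZMod 2)
    (hL : ∀ r : ℕ, r < n + 3 → 2 * L + r ≠ 0) :
    ∃ c : ℂ, c ≠ 0 ∧ lowCoef ((S - K + 1) / 4) (L + (K - 2 * L) / 2) n ((K - 2 * L) / 2) t =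
      lowNum K S n t (2 * L) / c := by
  have h0 : L ≠ 0 := fun h => hL 0 (by omega) (by rw [h]; simp)
  have h1 : 2 * L + 1 ≠ 0 := by simpa using hL 1 (by omega)
  have h2 : L + 1 ≠ 0 := fun h => hL 2 (by omega) (by push_cast; linear_combination 2 * h)
  have ht : t = 0 ∨ t = 1 := by revert t; decide
  have hn1 : (1 : ZMod 2) ≠ 0 := one_ne_zero
  interval_cases n
  · rcases ht with rfl | rfl
    · refine ⟨-(8 * (2 * L + 1)), neg_ne_zero.2 (mul_ne_zero (by norm_num) h1), ?_⟩
      rw [lowCoef_zero_even L _ h1 h2, lowNum, if_pos rfl, neg_div, div_neg]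
      congr 2
      ring
    · refine ⟨8 * (2 * L + 1), mul_ne_zero (by norm_num) h1, ?_⟩
      rw [lowCoef_zero_odd L _ h1 h2, lowNum, if_neg hn1]
      congr 1
      ring
  · have h3 : 2 * L + 3 ≠ 0 := by simpa using hL 3 (by omega)
    rcases ht with rfl | rfl
    · refine ⟨64 * L * (2 * L + 3), mul_ne_zero (mul_ne_zero (by norm_num) h0) h3, ?_⟩
      rw [lowCoef_one_even L _ h0 h2 h3, lowNum, if_pos rfl]
      congr 1
      ring
    · refine ⟨64 * L * (2 * L + 3), mul_ne_zero (mul_ne_zero (by norm_num) h0) h3, ?_⟩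
      rw [lowCoef_one_odd L _ h0 h2 h3, lowNum, if_neg hn1]
      congr 1
      ring
  · have h3 : 2 * L + 3 ≠ 0 := by simpa using hL 3 (by omega)
    have h4 : L + 2 ≠ 0 := fun h => hL 4 (by omega) (by push_cast; linear_combination 2 * h)
    have hc : 256 * L * (L + 1) * (L + 2) ≠ 0 :=
      mul_ne_zero (mul_ne_zero (mul_ne_zero (by norm_num) h0) h2) h4
    rcases ht with rfl | rfl
    · refine ⟨_, hc, ?_⟩
      rw [lowCoef_two_even L _ h0 h1 h2 h3 h4, lowNum, if_pos rfl]
      · congr 1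
        ring
      all_goals omega
    · refine ⟨_, hc, ?_⟩
      rw [lowCoef_two_odd L _ h0 h1 h2 h3 h4, lowNum, if_neg hn1]
      · congr 1
        ring
      all_goals omega

section Criterion

variable {lam K S : ℂ} {l : ZMod 2} {m : ℕ}

/-- The graded module of operators, in terms of the parameters of `lowNum`. -/
def psiTower (lam K S : ℂ) (l : ZMod 2) (m : ℕ) : SuperAction (Fin (m + 1) → SPoly) :=
  psiGraded ((S - K + 1) / 4) (lam + (K - 2 * lam) / 2) m ((K - 2 * lam) / 2) l

lemma isGraded_psiTower (hreg : ∀ n : ℕ, n < m → 2 * lam + n ≠ 0) :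
    IsGraded (psiTower lam K S l m) lam fun j : Fin (m + 1) => (j : ℕ) := by
  have h := isGraded_psiGraded ((S - K + 1) / 4) (lam + (K - 2 * lam) / 2) m
    ((K - 2 * lam) / 2) l fun n hn h => hreg n hn (by linear_combination 2 * h)
  rwa [add_sub_cancel_right] at h

/-- Passing to component `i` replaces `2 lam` by `2 lam + i` and `l` by `l - i`; the constants `K`
and `S` belong to the whole module. -/
lemma coef_psiTower_eq_zero_iff (hreg : ∀ n : ℕ, n < m → 2 * lam + n ≠ 0) {i j : Fin (m + 1)}
    {n : ℕ} (hn : n ≤ 2) (hij : (j : ℕ) = i + 3 + n) :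
    coef (psiTower lam K S l m) i j n = 0 ↔ lowNum K S n (l - (i : ℕ)) (2 * lam + (i : ℕ)) = 0 := by
  obtain ⟨c, hc, h⟩ := exists_lowCoef_eq K S (lam + (i : ℕ) / 2) hn (l - (i : ℕ)) fun r hr h =>
    hreg (i + r) (by omega) (by push_cast; linear_combination h)
  rw [show lam + (i : ℂ) / 2 + (K - 2 * (lam + (i : ℂ) / 2)) / 2 = lam + (K - 2 * lam) / 2 by ring,
    show (K - 2 * (lam + (i : ℂ) / 2)) / 2 = (K - 2 * lam) / 2 - (i : ℂ) / 2 by ring,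
    show 2 * (lam + (i : ℂ) / 2) = 2 * lam + (i : ℂ) by ring] at h
  rw [psiTower, coef_psiGraded hn _ _ hij, h, div_eq_zero_iff, or_iff_left hc]

end Criterion

end Subquotients

/-! ## The criterion -/

/-- `T` is closed under the operators `i → j` that are not forced to vanish by the vanishing of
the operators in `Z`. -/
abbrev IsClosed (Z : Finset (ℕ × ℕ)) (m : ℕ) (T : Finset ℕ) : Prop :=
  ∀ i ∈ T, ∀ j ∈ Finset.range (m + 1), j ∉ T → i + 3 ≤ j →
    (i, j) ∈ Z ∨ j = i + 6 ∧ ((i, i + 3) ∈ Z ∨ (i + 3, i + 6) ∈ Z)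

/-- An entry across six steps needs no separate condition: by the Maurer–Cartan relation it vanishes
once one of its two factors of length three does. Hence the combinatorial test `IsClosed` guarantees
invariance. -/
lemma IsGraded.entry_eq_zero_of_isClosed {k : ℕ} {lam : ℂ} {A : SuperAction (Fin (k + 1) → SPoly)}
    (h : IsGraded A lam fun j : Fin (k + 1) => (j : ℕ)) (hreg : ∀ n : ℕ, n < k → 2 * lam + n ≠ 0)
    {Z : Finset (ℕ × ℕ)} (hZ : ∀ i j : Fin (k + 1), ((i : ℕ), (j : ℕ)) ∈ Z → entry A i j = 0)
    {T : Finset ℕ} (hT : IsClosed Z k T) {i j : Fin (k + 1)} (hi : (i : ℕ) ∈ T)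
    (hj : (j : ℕ) ∉ T) : entry A i j = 0 := by
  have hij : i ≠ j := fun h' => hj (h' ▸ hi)
  rcases lt_or_ge (j : ℕ) (i + 3) with h1 | h1
  · exact h.entry_eq_zero_of_lt hij h1
  · rcases hT i hi j (Finset.mem_range.2 j.2) hj h1 with h2 | ⟨h2, h3⟩
    · exact hZ i j h2
    · have hl : (i : ℕ) + 3 < k + 1 := by omega
      refine h.entry_eq_zero_of_add_six (l := ⟨i + 3, hl⟩) rfl h2 (hreg _ (by omega))
        (hreg _ (by omega)) (h3.imp (hZ _ _) fun h4 => hZ _ _ ?_)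
      rw [h2]
      exact h4

/-- The degrees `0, a, a + b, a + b + c` of the components. -/
def degrees (a b c : ℕ) : Fin 4 → ℕ := ![0, a, a + b, a + b + c]

lemma densityChain_eq (lam : ℂ) (a b c : ℕ) :
    densityChain lam [(a : ℤ), (b : ℤ), (c : ℤ)] = fun r : Fin 4 =>
      (tensorDensity (lam + degrees a b c r / 2)).shift (degrees a b c r) := by
  funext r
  change Fin 4 at r
  fin_cases r <;> simp [densityChain, degrees, add_assoc]

lemma strictMono_degrees {a b c : ℕ} (ha : 0 < a) (hb : 0 < b) (hc : 0 < c) :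
    StrictMono (degrees a b c) := by
  rw [Fin.strictMono_iff_lt_succ]
  intro i
  fin_cases i <;> simpa [degrees]

lemma forall_adjacent {P : Fin 4 → Fin 4 → Prop} (h0 : P 0 1) (h1 : P 1 2) (h2 : P 2 3)
    (r r' : Fin 4) (hr : r'.val = r + 1) : P r r' := by
  fin_cases r <;> fin_cases r' <;> first | exact absurd hr (by decide) | assumption

/-- A graded module of the right type with non-zero adjacent coefficients gives the extension. -/
lemma uniqueUniserialPsi_of_isGraded {lam : ℂ} {a b c : ℕ} (ha : 3 ≤ a) (hb : 3 ≤ b)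
    (hc : 3 ≤ c) (hreg : ∀ n : ℕ, n < a + b + c → 2 * lam + n ≠ 0)
    (h02 : ∀ k, a + b = 6 + k → IsGraded.mcFactor lam k ≠ 0)
    (h13 : ∀ k, b + c = 6 + k → IsGraded.mcFactor (lam + a / 2) k ≠ 0)
    (h03 : ∀ k, a + b + c = 6 + k → IsGraded.mcFactor lam k ≠ 0)
    {A : SuperAction (Fin 4 → SPoly)} (h : IsGraded A lam (degrees a b c))
    (hb0 : coef A 0 1 (a - 3) ≠ 0) (hb1 : coef A 1 2 (b - 3) ≠ 0) (hb2 : coef A 2 3 (c - 3) ≠ 0)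
    (hpsi : IsPsiSubquotient A) :
    UniqueUniserialPsi.{u} lam [(a : ℤ), (b : ℤ), (c : ℤ)] := by
  have hm : StrictMono (degrees a b c) := strictMono_degrees (by omega) (by omega) (by omega)
  have hgap : ∀ r r' : Fin 4, r'.val = r + 1 → degrees a b c r + 3 ≤ degrees a b c r' :=
    forall_adjacent (by simpa [degrees]) (by simpa [degrees]) (by simpa [degrees])
  have hadj : ∀ r r' : Fin 4, r'.val = r + 1 → ∀ k, degrees a b c r' = degrees a b c r + 3 + k →
      coef A r r' k ≠ 0 := by
    refine forall_adjacent (fun k hk => ?_) (fun k hk => ?_) (fun k hk => ?_) <;>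
      simp only [degrees, Matrix.cons_val] at hk
    · rwa [show k = a - 3 by omega]
    · rwa [show k = b - 3 by omega]
    · rwa [show k = c - 3 by omega]
  have hmc : ∀ i j : Fin 4, i.val + 1 < j → ∀ k, degrees a b c j = degrees a b c i + 6 + k →
      IsGraded.mcFactor (lam + degrees a b c i / 2) k ≠ 0 := by
    intro i j hij k hk
    fin_cases i <;> fin_cases j <;>
      first
      | exact absurd hij (by decide)
      | simp only [degrees, Fin.zero_eta, Fin.mk_one, Fin.reduceFinMk, Matrix.cons_val] at hk ⊢
    · simpa using h02 k (by omega)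
    · simpa using h03 k (by omega)
    · exact h13 k (by omega)
  have hR : ∀ (k : ℕ) (i : Fin 4), k < degrees a b c i → lam + k / 2 ≠ 0 := by
    intro k i hk h'
    have hi : degrees a b c i ≤ a + b + c := hm.monotone (Fin.le_last i)
    exact hreg k (by omega) (by linear_combination 2 * h')
  have huni : A.Uniserial := IsGraded.uniserial hR (fun r r' hr => by
    obtain ⟨k, hk⟩ := Nat.exists_eq_add_of_le (hgap r r' hr)
    exact ⟨k, hk, hadj r r' hr k hk⟩) h hm
  refine ⟨_, _, _, A, ⟨?_, huni⟩, hpsi, fun W _ _ B hB => ?_⟩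
  · rw [densityChain_eq]
    exact h.isSplitExtension hm
  · obtain ⟨hB1, hB2⟩ := hB
    rw [densityChain_eq] at hB1
    obtain ⟨A', h', hequiv⟩ := hB1.exists_isGraded
    refine SuperAction.EvenEquiv.trans ?_ hequiv.symm
    refine h.evenEquiv h' hm hgap hmc hadj fun r r' hr k hk => ?_
    obtain ⟨k', hk', hne⟩ := h'.exists_coef_ne_zero hm (hequiv.uniserial hB2) hr
    rwa [show k = k' by omega]

/-- The criterion: `N` is the set of components to be divided out, and `Z` a set of pairs of
components between which `ξ x²` acts by zero. -/
theorem uniqueUniserialPsi_of_lowNum {lam : ℂ} (K S : ℂ) (l : ZMod 2) {a b c : ℕ} (N : Finset ℕ)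
    (Z : Finset (ℕ × ℕ)) (ha : 3 ≤ a ∧ a ≤ 5) (hb : 3 ≤ b ∧ b ≤ 5) (hc : 3 ≤ c ∧ c ≤ 5)
    (hN : IsClosed Z (a + b + c) N)
    (hM : IsClosed Z (a + b + c) ({0, a, a + b, a + b + c} ∪ N))
    (hd : Disjoint {0, a, a + b, a + b + c} N)
    (hreg : ∀ n : ℕ, n < a + b + c → 2 * lam + n ≠ 0)
    (h02 : ∀ k, a + b = 6 + k → IsGraded.mcFactor lam k ≠ 0)
    (h13 : ∀ k, b + c = 6 + k → IsGraded.mcFactor (lam + a / 2) k ≠ 0)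
    (h03 : ∀ k, a + b + c = 6 + k → IsGraded.mcFactor lam k ≠ 0)
    (hb0 : lowNum K S (a - 3) l (2 * lam) ≠ 0)
    (hb1 : lowNum K S (b - 3) (l - a) (2 * lam + a) ≠ 0)
    (hb2 : lowNum K S (c - 3) (l - (a + b : ℕ)) (2 * lam + (a + b : ℕ)) ≠ 0)
    (hZ : ∀ p ∈ Z, p.1 + 3 ≤ p.2 ∧ p.2 ≤ p.1 + 5 ∧
      lowNum K S (p.2 - p.1 - 3) (l - p.1) (2 * lam + p.1) = 0) :
    UniqueUniserialPsi.{u} lam [(a : ℤ), (b : ℤ), (c : ℤ)] := by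
  have hG := isGraded_psiTower (K := K) (S := S) (l := l) hreg
  have hm : StrictMono (degrees a b c) := strictMono_degrees (by omega) (by omega) (by omega)
  have hlt : ∀ r, degrees a b c r < a + b + c + 1 := fun r =>
    Nat.lt_succ_of_le (hm.monotone (Fin.le_last r))
  set e : Fin 4 → Fin (a + b + c + 1) := fun r => ⟨degrees a b c r, hlt r⟩ with he
  have hinj : Function.Injective e := fun r s h => hm.injective (Fin.ext_iff.1 h)
  have hZ0 : ∀ i j : Fin (a + b + c + 1), ((i : ℕ), (j : ℕ)) ∈ Z →
      entry (psiTower lam K S l (a + b + c)) i j = 0 := by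
    intro i j hij
    obtain ⟨h1, h2, h3⟩ := hZ _ hij
    refine hG.entry_eq_zero (fun h => by rw [h] at h1; simp at h1) fun n hn => ?_
    rw [coef_psiTower_eq_zero_iff hreg (by omega) hn]
    rwa [show (j : ℕ) - i - 3 = n by omega] at h3
  have hrange : ∀ i : Fin (a + b + c + 1), i ∈ Set.range e ↔
      (i : ℕ) ∈ ({0, a, a + b, a + b + c} : Finset ℕ) := by
    intro i
    simp only [Set.mem_range, Finset.mem_insert, Finset.mem_singleton, he, Fin.ext_iff,
      Fin.exists_fin_succ, degrees]
    simp [eq_comm]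
  -- The span of the four wanted components and `N`, divided by the span of `N`; both are invariant
  -- by the closedness conditions.
  have hpres := hG.isPresentation_funLeft hinj (N := {i | (i : ℕ) ∈ N})
    (fun r hr => Finset.disjoint_left.1 hd ((hrange _).1 ⟨r, rfl⟩) hr)
    (fun i hi j hj => hG.entry_eq_zero_of_isClosed hreg hZ0 hM
      (by rwa [Finset.mem_union, ← hrange]) (by rwa [Finset.mem_union, ← hrange]))
    (fun i hi j hj => hG.entry_eq_zero_of_isClosed hreg hZ0 hN hi hj)
  have hrep := hpres.isRep hG.isRep
  have hgr : IsGraded _ lam (degrees a b c) := hG.isGraded_compress hinj hrep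
  -- The same module as a subquotient of `Ψ` with its parity shifted by `l`. Undoing this shift is
  -- what may make the equivalence odd.
  have hpres' := (isPresentation_psiGraded ((S - K + 1) / 4) (lam + (K - 2 * lam) / 2)
    (a + b + c) ((K - 2 * lam) / 2) l).trans hpres
  have hne : ∀ r s : Fin 4, ∀ n, n ≤ 2 → degrees a b c s = degrees a b c r + 3 + n →
      lowNum K S n (l - (degrees a b c r : ℕ)) (2 * lam + (degrees a b c r : ℕ)) ≠ 0 →
      coef ((psiTower lam K S l (a + b + c)).compress (LinearMap.funLeft ℂ SPoly e) (IsGraded.extend e)) r s n ≠ 0 := by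
    intro r s n hn hrs h0
    rw [IsGraded.coef_compress, Ne, coef_psiTower_eq_zero_iff hreg hn hrs]
    exact h0
  refine uniqueUniserialPsi_of_isGraded ha.1 hb.1 hc.1 hreg h02 h13 h03 hgr
    (hne 0 1 _ (by omega) ?_ ?_) (hne 1 2 _ (by omega) ?_ hb1) (hne 2 3 _ (by omega) ?_ hb2)
    ⟨_, _, _, l, _, _, SuperAction.invariant_shift.1 hpres'.inv_left,
      SuperAction.invariant_shift.1 hpres'.inv_right, ?_,
      SuperAction.evenEquiv_or_oddEquiv_of_shift hrep _ _ hpres'.evenEquiv⟩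
  · simp [degrees]; omega
  · simpa [degrees] using hb0
  · simp [degrees]; omega
  · simp [degrees]; omega
  · exact inf_le_inf_left _ (Submodule.comap_mono fun g hg i hi => hg i fun h => hi (Or.inr h))

section Cases

/-! ## The cases -/

section Values

variable (K S Λ : ℂ)

lemma lowNum_zero_even : lowNum K S 0 0 Λ = (K - Λ) * (K - Λ - 2) * S := by simp [lowNum]

lemma lowNum_zero_odd :
    lowNum K S 0 1 Λ = (K - Λ - 1) * ((Λ + 1) * K - S ^ 2 + 1) := by simp [lowNum]

lemma lowNum_one_even : lowNum K S 1 0 Λ =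
    (K - Λ) * (K - Λ - 2) * (2 * (Λ + 3) * K - 3 * S ^ 2 + (Λ + 1) * (Λ + 3)) := by simp [lowNum]

lemma lowNum_one_odd : lowNum K S 1 1 Λ =
    (K - Λ - 1) * (K - Λ - 3) * (Λ * (Λ + 2 * K + 2) - 3 * S ^ 2) := by simp [lowNum]

lemma lowNum_two_even : lowNum K S 2 0 Λ =
    (K - Λ) * (K - Λ - 2) * (K - Λ - 4) * ((Λ + 2) * K + 3 - 3 * S ^ 2) := by simp [lowNum]

lemma lowNum_two_odd : lowNum K S 2 1 Λ = (K - Λ - 1) * (K - Λ - 3) * S *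
    (4 * (Λ + 2) * K - Λ ^ 2 - 4 * Λ + 8 - 3 * S ^ 2) := by simp [lowNum]

end Values

lemma IsGraded.mcFactor_even (L : ℂ) (a : ℕ) :
    mcFactor L (2 * a) = ((a + 2 * L) * (a + 1 + 2 * L) + 2 * a + 8 * L) / 2 := by
  simp [mcFactor]

lemma IsGraded.mcFactor_odd (L : ℂ) (a : ℕ) : mcFactor L (2 * a + 1) = (a + 3 + 2 * L) / 2 := by
  simp [mcFactor, show (2 * a + 1) / 2 = a by omega]

/-- A failure of regularity would force `t = -(c + 2 n)` and make `d` the square of this integer,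
which is a finite check. -/
lemma two_mul_add_ne_zero {t lam : ℂ} {c d : ℤ} {m : ℕ} (hlam : lam = (c + t) / 4)
    (ht : t ^ 2 = d) (h : ∀ n < m, (c + 2 * (n : ℤ)) ^ 2 ≠ d) : ∀ n : ℕ, n < m → 2 * lam + n ≠ 0 := by
  intro n hn h0
  refine h n hn ?_
  have h1 : t = -(c + 2 * n) := by rw [hlam] at h0; linear_combination 2 * h0
  rw [h1, neg_sq] at ht
  exact_mod_cast ht

lemma two_mul_add_ne_zero_of_rat {lam : ℂ} {c : ℤ} {m : ℕ} (hlam : lam = c / 2)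
    (h : ∀ n < m, c + (n : ℤ) ≠ 0) : ∀ n : ℕ, n < m → 2 * lam + n ≠ 0 := by
  intro n hn h0
  refine h n hn ?_
  have h1 : (c : ℂ) + n = 0 := by rw [hlam] at h0; linear_combination h0
  exact_mod_cast h1

/-- With `Λ = 2 lam`, the entries `0 → 3` and `5 → 10` vanish if `(Λ + 1) K = S² - 1` and `(Λ + 7) K
= 3 (S² - 1)`. These agree at `Λ = 2`, where `S² = 1 + 3 K`; the value `K = 8` makes `S` an integer.
-/
lemma uniqueUniserialPsi_one_four_three_three :
    UniqueUniserialPsi.{u} 1 [4, 3, 3] := by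
  refine uniqueUniserialPsi_of_lowNum (a := 4) (b := 3) (c := 3) 8 5 1
    {5, 8, 9} {(0, 3), (5, 10)} (by decide) (by decide) (by decide)
    (by decide) (by decide) (by decide) ?_ ?_ ?_ ?_ ?_ ?_ ?_ ?_
  · exact two_mul_add_ne_zero_of_rat (c := 2) (by push_cast; ring) (by decide)
  · intro k hk h
    obtain rfl : k = 1 := by omega
    rw [IsGraded.mcFactor_odd _ 0] at h
    push_cast at h
    norm_num at h
  · intro k hk h
    obtain rfl : k = 0 := by omega
    rw [IsGraded.mcFactor_even _ 0] at h
    push_cast at h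
    norm_num at h
  · intro k hk h
    obtain rfl : k = 4 := by omega
    rw [IsGraded.mcFactor_even _ 2] at h
    push_cast at h
    norm_num at h
  · intro h
    rw [lowNum_one_odd] at h
    norm_num at h
  · intro h
    rw [show (1 : ZMod 2) - (4 : ℕ) = 1 from rfl, lowNum_zero_odd] at h
    push_cast at h
    norm_num at h
  · intro h
    rw [show (1 : ZMod 2) - (7 : ℕ) = 0 from rfl, lowNum_zero_even] at h
    push_cast at h
    norm_num at h
  · simp only [Finset.forall_mem_insert, Finset.mem_singleton, forall_eq]
    refine ⟨⟨by decide, by decide, ?_⟩, ⟨by decide, by decide, ?_⟩⟩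
    · rw [show (1 : ZMod 2) - (0 : ℕ) = 1 from rfl, lowNum_zero_odd]
      push_cast
      ring
    · rw [show (1 : ZMod 2) - (5 : ℕ) = 0 from rfl, lowNum_two_even]
      push_cast
      ring

/-- With `Λ = 2 lam`, the equations are `(Λ + 2) K = 3 (S² - 1)` for `0 → 5` and `(Λ + 8) K = S² -
1` for `7 → 10`. They agree at `Λ = -11`, where `S² = 1 - 3 K`; again `K` is chosen so that `S` is
an integer. -/
lemma uniqueUniserialPsi_neg_three_three_four :
    UniqueUniserialPsi.{u} (-11 / 2) [3, 3, 4] := by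
  refine uniqueUniserialPsi_of_lowNum (a := 3) (b := 3) (c := 4) (-8) 5 0
    {4, 7, 8, 9} {(0, 5), (7, 10)} (by decide) (by decide) (by decide)
    (by decide) (by decide) (by decide) ?_ ?_ ?_ ?_ ?_ ?_ ?_ ?_
  · exact two_mul_add_ne_zero_of_rat (c := -11) (by push_cast; ring) (by decide)
  · intro k hk h
    obtain rfl : k = 0 := by omega
    rw [IsGraded.mcFactor_even _ 0] at h
    push_cast at h
    norm_num at h
  · intro k hk h
    obtain rfl : k = 1 := by omega
    rw [IsGraded.mcFactor_odd _ 0] at h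
    push_cast at h
    norm_num at h
  · intro k hk h
    obtain rfl : k = 4 := by omega
    rw [IsGraded.mcFactor_even _ 2] at h
    push_cast at h
    norm_num at h
  · intro h
    rw [lowNum_zero_even] at h
    norm_num at h
  · intro h
    rw [show (0 : ZMod 2) - (3 : ℕ) = 1 from rfl, lowNum_zero_odd] at h
    push_cast at h
    norm_num at h
  · intro h
    rw [show (0 : ZMod 2) - (6 : ℕ) = 0 from rfl, lowNum_one_even] at h
    push_cast at h
    norm_num at h
  · simp only [Finset.forall_mem_insert, Finset.mem_singleton, forall_eq]
    refine ⟨⟨by decide, by decide, ?_⟩, ⟨by decide, by decide, ?_⟩⟩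
    · rw [show (0 : ZMod 2) - (0 : ℕ) = 0 from rfl, lowNum_two_even]
      push_cast
      ring
    · rw [show (0 : ZMod 2) - (7 : ℕ) = 1 from rfl, lowNum_zero_odd]
      push_cast
      ring

/-- From here on, most cases take `S = 0`, which kills all entries of length three with even symbol
index and of length five with odd index. Here these are `0 → 3` and `7 → 12`. The other two ask for
`(Λ + 2) K = -3` and `(Λ + 10) K = -1` with `Λ = 2 lam`, so `Λ = -14`. -/
lemma uniqueUniserialPsi_neg_four_four_four :
    UniqueUniserialPsi.{u} (-7) [4, 4, 4] := by
  refine uniqueUniserialPsi_of_lowNum (a := 4) (b := 4) (c := 4) (1 / 4) 0 0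
    {6, 7, 9, 10, 11} {(0, 3), (0, 5), (7, 12), (9, 12)} (by decide) (by decide) (by decide)
    (by decide) (by decide) (by decide) ?_ ?_ ?_ ?_ ?_ ?_ ?_ ?_
  · exact two_mul_add_ne_zero_of_rat (c := -14) (by push_cast; ring) (by decide)
  · intro k hk h
    obtain rfl : k = 2 := by omega
    rw [IsGraded.mcFactor_even _ 1] at h
    push_cast at h
    norm_num at h
  · intro k hk h
    obtain rfl : k = 2 := by omega
    rw [IsGraded.mcFactor_even _ 1] at h
    push_cast at h
    norm_num at h
  · intro k hk h
    obtain rfl : k = 6 := by omega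
    rw [IsGraded.mcFactor_even _ 3] at h
    push_cast at h
    norm_num at h
  · intro h
    rw [lowNum_one_even] at h
    norm_num at h
  · intro h
    rw [show (0 : ZMod 2) - (4 : ℕ) = 0 from rfl, lowNum_one_even] at h
    push_cast at h
    norm_num at h
  · intro h
    rw [show (0 : ZMod 2) - (8 : ℕ) = 0 from rfl, lowNum_one_even] at h
    push_cast at h
    norm_num at h
  · simp only [Finset.forall_mem_insert, Finset.mem_singleton, forall_eq]
    refine ⟨⟨by decide, by decide, ?_⟩, ⟨by decide, by decide, ?_⟩, ⟨by decide, by decide, ?_⟩,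
        ⟨by decide, by decide, ?_⟩⟩
    · rw [show (0 : ZMod 2) - (0 : ℕ) = 0 from rfl, lowNum_zero_even]
      push_cast
      ring
    · rw [show (0 : ZMod 2) - (0 : ℕ) = 0 from rfl, lowNum_two_even]
      push_cast
      ring
    · rw [show (0 : ZMod 2) - (7 : ℕ) = 1 from rfl, lowNum_two_odd]
      push_cast
      ring
    · rw [show (0 : ZMod 2) - (9 : ℕ) = 1 from rfl, lowNum_zero_odd]
      push_cast
      ring

/-- With `S = 0` and `Λ = 2 lam`, the conditions left are `(Λ + 1) K = -1` for `0 → 3` and `(Λ + 9)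
K = -3` for `7 → 12`, so `Λ = 3`. -/
lemma uniqueUniserialPsi_four_four_four :
    UniqueUniserialPsi.{u} (3 / 2) [4, 4, 4] := by
  refine uniqueUniserialPsi_of_lowNum (a := 4) (b := 4) (c := 4) (-1 / 4) 0 1
    {6, 7, 9, 10, 11} {(0, 3), (0, 5), (7, 12), (9, 12)} (by decide) (by decide) (by decide)
    (by decide) (by decide) (by decide) ?_ ?_ ?_ ?_ ?_ ?_ ?_ ?_
  · exact two_mul_add_ne_zero_of_rat (c := 3) (by push_cast; ring) (by decide)
  · intro k hk h
    obtain rfl : k = 2 := by omega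
    rw [IsGraded.mcFactor_even _ 1] at h
    push_cast at h
    norm_num at h
  · intro k hk h
    obtain rfl : k = 2 := by omega
    rw [IsGraded.mcFactor_even _ 1] at h
    push_cast at h
    norm_num at h
  · intro k hk h
    obtain rfl : k = 6 := by omega
    rw [IsGraded.mcFactor_even _ 3] at h
    push_cast at h
    norm_num at h
  · intro h
    rw [lowNum_one_odd] at h
    norm_num at h
  · intro h
    rw [show (1 : ZMod 2) - (4 : ℕ) = 1 from rfl, lowNum_one_odd] at h
    push_cast at h
    norm_num at h
  · intro h
    rw [show (1 : ZMod 2) - (8 : ℕ) = 1 from rfl, lowNum_one_odd] at h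
    push_cast at h
    norm_num at h
  · simp only [Finset.forall_mem_insert, Finset.mem_singleton, forall_eq]
    refine ⟨⟨by decide, by decide, ?_⟩, ⟨by decide, by decide, ?_⟩, ⟨by decide, by decide, ?_⟩,
        ⟨by decide, by decide, ?_⟩⟩
    · rw [show (1 : ZMod 2) - (0 : ℕ) = 1 from rfl, lowNum_zero_odd]
      push_cast
      ring
    · rw [show (1 : ZMod 2) - (0 : ℕ) = 1 from rfl, lowNum_two_odd]
      push_cast
      ring
    · rw [show (1 : ZMod 2) - (7 : ℕ) = 0 from rfl, lowNum_two_even]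
      push_cast
      ring
    · rw [show (1 : ZMod 2) - (9 : ℕ) = 0 from rfl, lowNum_zero_even]
      push_cast
      ring

/-- The general choice of parameters for `(3/2, 3/2, 3/2)` gives `S = 0` at `lam = 1/2`, and
adjacent coefficients vanish. Here `0 → 4` and `5 → 9` are made to vanish instead: `3 S² = 8 K + 8`
and `S² = 4 K + 16` give `K = -10`, `S² = -24`. -/
lemma uniqueUniserialPsi_half_three_three_three {t : ℂ} (ht : t ^ 2 = -24) :
    UniqueUniserialPsi.{u} (1 / 2) [3, 3, 3] := by
  refine uniqueUniserialPsi_of_lowNum (a := 3) (b := 3) (c := 3) (-10) t 0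
    {5, 7, 8} {(0, 4), (5, 9)} (by decide) (by decide) (by decide)
    (by decide) (by decide) (by decide) ?_ ?_ ?_ ?_ ?_ ?_ ?_ ?_
  · exact two_mul_add_ne_zero_of_rat (c := 1) (by push_cast; ring) (by decide)
  · intro k hk h
    obtain rfl : k = 0 := by omega
    rw [IsGraded.mcFactor_even _ 0] at h
    push_cast at h
    refine one_ne_zero (α := ℂ) ?_
    linear_combination (1 / 3) * h
  · intro k hk h
    obtain rfl : k = 0 := by omega
    rw [IsGraded.mcFactor_even _ 0] at h
    push_cast at h
    refine one_ne_zero (α := ℂ) ?_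
    linear_combination (1 / 18) * h
  · intro k hk h
    obtain rfl : k = 3 := by omega
    rw [IsGraded.mcFactor_odd _ 1] at h
    push_cast at h
    refine one_ne_zero (α := ℂ) ?_
    linear_combination (2 / 5) * h
  · intro h
    rw [lowNum_zero_even] at h
    refine one_ne_zero (α := ℂ) ?_
    linear_combination (-t / 3432) * h + (1 / 24) * ht
  · intro h
    rw [show (0 : ZMod 2) - (3 : ℕ) = 1 from rfl, lowNum_zero_odd] at h
    push_cast at h
    refine one_ne_zero (α := ℂ) ?_
    linear_combination (1 / 375) * h + (-1 / 25) * ht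
  · intro h
    rw [show (0 : ZMod 2) - (6 : ℕ) = 0 from rfl, lowNum_zero_even] at h
    push_cast at h
    refine one_ne_zero (α := ℂ) ?_
    linear_combination (-t / 7752) * h + (1 / 24) * ht
  · simp only [Finset.forall_mem_insert, Finset.mem_singleton, forall_eq]
    refine ⟨⟨by decide, by decide, ?_⟩, ⟨by decide, by decide, ?_⟩⟩
    · rw [show (0 : ZMod 2) - (0 : ℕ) = 0 from rfl, lowNum_one_even]
      push_cast
      linear_combination (-429) * ht
    · rw [show (0 : ZMod 2) - (5 : ℕ) = 1 from rfl, lowNum_one_odd]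
      push_cast
      linear_combination (-969) * ht

/-- With `S = 0` and `Λ = 2 lam`, the conditions left are `(Λ + 1) K = -1` for `0 → 3` and `2 K =
-(Λ + 8)` for `7 → 11`. Eliminating `K` gives `(Λ + 1) (Λ + 8) = 2`, of discriminant `57`. -/
lemma uniqueUniserialPsi_four_four_three {t : ℂ} (ht : t ^ 2 = 57) :
    UniqueUniserialPsi.{u} ((-9 + t) / 4) [4, 4, 3] := by
  refine uniqueUniserialPsi_of_lowNum (a := 4) (b := 4) (c := 3) ((-7 - t) / 4) 0 1
    {6, 7, 9, 10} {(0, 3), (0, 5), (6, 11), (7, 11)} (by decide) (by decide) (by decide)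
    (by decide) (by decide) (by decide) ?_ ?_ ?_ ?_ ?_ ?_ ?_ ?_
  · exact two_mul_add_ne_zero (c := -9) (d := 57) (by push_cast; ring) (by rw [ht]; norm_num) (by
      decide)
  · intro k hk h
    obtain rfl : k = 2 := by omega
    rw [IsGraded.mcFactor_even _ 1] at h
    push_cast at h
    refine one_ne_zero (α := ℂ) ?_
    -- Here and below, the factor of `h` is the inverse of the quantity assumed zero, modulo the
    -- quadratic equation of `t`. It therefore serves both square roots.
    linear_combination ((-7 - t) / 4) * h + ((3 + t) / 32) * ht
  · intro k hk h
    obtain rfl : k = 1 := by omega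
    rw [IsGraded.mcFactor_odd _ 0] at h
    push_cast at h
    refine one_ne_zero (α := ℂ) ?_
    linear_combination ((-5 + t) / 8) * h + (-1 / 32) * ht
  · intro k hk h
    obtain rfl : k = 5 := by omega
    rw [IsGraded.mcFactor_odd _ 2] at h
    push_cast at h
    refine one_ne_zero (α := ℂ) ?_
    linear_combination ((-1 + t) / 14) * h + (-1 / 56) * ht
  · intro h
    rw [lowNum_one_odd] at h
    refine one_ne_zero (α := ℂ) ?_
    linear_combination ((1395 + 167 * t) / 267264) * h + ((-26549 - 3978 * t + 1503 * t ^ 2) /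
        1425408) * ht
  · intro h
    rw [show (1 : ZMod 2) - (4 : ℕ) = 1 from rfl, lowNum_one_odd] at h
    push_cast at h
    refine one_ne_zero (α := ℂ) ?_
    linear_combination ((45 - 7 * t) / 4032) * h + ((-337 - 26 * t - 21 * t ^ 2) / 21504) * ht
  · intro h
    rw [show (1 : ZMod 2) - (8 : ℕ) = 1 from rfl, lowNum_zero_odd] at h
    push_cast at h
    refine one_ne_zero (α := ℂ) ?_
    linear_combination ((-173 + 23 * t) / 224) * h + ((-4299 - 1160 * t - 69 * t ^ 2) / 7168) * ht
  · simp only [Finset.forall_mem_insert, Finset.mem_singleton, forall_eq]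
    refine ⟨⟨by decide, by decide, ?_⟩, ⟨by decide, by decide, ?_⟩, ⟨by decide, by decide, ?_⟩,
        ⟨by decide, by decide, ?_⟩⟩
    · rw [show (1 : ZMod 2) - (0 : ℕ) = 1 from rfl, lowNum_zero_odd]
      push_cast
      linear_combination ((-7 + 3 * t) / 32) * ht
    · rw [show (1 : ZMod 2) - (0 : ℕ) = 1 from rfl, lowNum_two_odd]
      push_cast
      ring
    · rw [show (1 : ZMod 2) - (6 : ℕ) = 1 from rfl, lowNum_two_odd]
      push_cast
      ring
    · rw [show (1 : ZMod 2) - (7 : ℕ) = 0 from rfl, lowNum_one_even]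
      push_cast
      ring

/-- With `S = 0`: `2 K = -(Λ + 2)` for `0 → 4` and `(Λ + 9) K = -1` for `8 → 11`, hence `(Λ + 2) (Λ
+ 9) = 2`. -/
lemma uniqueUniserialPsi_three_four_four {t : ℂ} (ht : t ^ 2 = 57) :
    UniqueUniserialPsi.{u} ((-11 + t) / 4) [3, 4, 4] := by
  refine uniqueUniserialPsi_of_lowNum (a := 3) (b := 4) (c := 4) ((7 - t) / 4) 0 1
    {6, 8, 9, 10} {(0, 4), (0, 5), (6, 11), (8, 11)} (by decide) (by decide) (by decide)
    (by decide) (by decide) (by decide) ?_ ?_ ?_ ?_ ?_ ?_ ?_ ?_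
  · exact two_mul_add_ne_zero (c := -11) (d := 57) (by push_cast; ring) (by rw [ht]; norm_num) (by
      decide)
  · intro k hk h
    obtain rfl : k = 1 := by omega
    rw [IsGraded.mcFactor_odd _ 0] at h
    push_cast at h
    refine one_ne_zero (α := ℂ) ?_
    linear_combination ((5 + t) / 8) * h + (-1 / 32) * ht
  · intro k hk h
    obtain rfl : k = 2 := by omega
    rw [IsGraded.mcFactor_even _ 1] at h
    push_cast at h
    refine one_ne_zero (α := ℂ) ?_
    linear_combination ((-7 + t) / 4) * h + ((3 - t) / 32) * ht
  · intro k hk h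
    obtain rfl : k = 5 := by omega
    rw [IsGraded.mcFactor_odd _ 2] at h
    push_cast at h
    refine one_ne_zero (α := ℂ) ?_
    linear_combination ((1 + t) / 14) * h + (-1 / 56) * ht
  · intro h
    rw [lowNum_zero_odd] at h
    refine one_ne_zero (α := ℂ) ?_
    linear_combination ((173 + 23 * t) / 224) * h + ((-4299 + 1160 * t - 69 * t ^ 2) / 7168) * ht
  · intro h
    rw [show (1 : ZMod 2) - (3 : ℕ) = 0 from rfl, lowNum_one_even] at h
    push_cast at h
    refine one_ne_zero (α := ℂ) ?_
    linear_combination ((45 + 7 * t) / 4032) * h + ((-337 + 26 * t - 21 * t ^ 2) / 21504) * ht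
  · intro h
    rw [show (1 : ZMod 2) - (7 : ℕ) = 0 from rfl, lowNum_one_even] at h
    push_cast at h
    refine one_ne_zero (α := ℂ) ?_
    linear_combination ((1395 - 167 * t) / 267264) * h + ((-26549 + 3978 * t + 1503 * t ^ 2) /
        1425408) * ht
  · simp only [Finset.forall_mem_insert, Finset.mem_singleton, forall_eq]
    refine ⟨⟨by decide, by decide, ?_⟩, ⟨by decide, by decide, ?_⟩, ⟨by decide, by decide, ?_⟩,
        ⟨by decide, by decide, ?_⟩⟩
    · rw [show (1 : ZMod 2) - (0 : ℕ) = 1 from rfl, lowNum_one_odd]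
      push_cast
      ring
    · rw [show (1 : ZMod 2) - (0 : ℕ) = 1 from rfl, lowNum_two_odd]
      push_cast
      ring
    · rw [show (1 : ZMod 2) - (6 : ℕ) = 1 from rfl, lowNum_two_odd]
      push_cast
      ring
    · rw [show (1 : ZMod 2) - (8 : ℕ) = 1 from rfl, lowNum_zero_odd]
      push_cast
      linear_combination ((7 + 3 * t) / 32) * ht

/-- With `S = 0`: `2 K = -(Λ + 1)` for `0 → 4` and `(Λ + 10) K = -1` for `9 → 12`, hence `(Λ + 1) (Λ
+ 10) = 2`. -/
lemma uniqueUniserialPsi_five_three_four {t : ℂ} (ht : t ^ 2 = 89) :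
    UniqueUniserialPsi.{u} ((-11 + t) / 4) [5, 3, 4] := by
  refine uniqueUniserialPsi_of_lowNum (a := 5) (b := 3) (c := 4) ((9 - t) / 4) 0 0
    {6, 7, 9, 10, 11} {(0, 3), (0, 4), (7, 12), (9, 12)} (by decide) (by decide) (by decide)
    (by decide) (by decide) (by decide) ?_ ?_ ?_ ?_ ?_ ?_ ?_ ?_
  · exact two_mul_add_ne_zero (c := -11) (d := 89) (by push_cast; ring) (by rw [ht]; norm_num) (by
      decide)
  · intro k hk h
    obtain rfl : k = 2 := by omega
    rw [IsGraded.mcFactor_even _ 1] at h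
    push_cast at h
    refine one_ne_zero (α := ℂ) ?_
    linear_combination ((-9 - t) / 8) * h + ((1 + t) / 64) * ht
  · intro k hk h
    obtain rfl : k = 1 := by omega
    rw [IsGraded.mcFactor_odd _ 0] at h
    push_cast at h
    refine one_ne_zero (α := ℂ) ?_
    linear_combination ((-5 + t) / 16) * h + (-1 / 64) * ht
  · intro k hk h
    obtain rfl : k = 6 := by omega
    rw [IsGraded.mcFactor_even _ 3] at h
    push_cast at h
    refine one_ne_zero (α := ℂ) ?_
    linear_combination (1 / 5) * h + (-1 / 40) * ht
  · intro h
    rw [lowNum_two_even] at h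
    refine one_ne_zero (α := ℂ) ?_
    linear_combination ((19137 + 2029 * t) / 326400) * h + ((-30521555 + 21866886 * t - 5430536 *
        t ^ 2 + 539946 * t ^ 3 - 18261 * t ^ 4) / 55705600) * ht
  · intro h
    rw [show (0 : ZMod 2) - (5 : ℕ) = 1 from rfl, lowNum_zero_odd] at h
    push_cast at h
    refine one_ne_zero (α := ℂ) ?_
    linear_combination ((-165 - 17 * t) / 752) * h + ((-491 - 32 * t + 51 * t ^ 2) / 24064) * ht
  · intro h
    rw [show (0 : ZMod 2) - (8 : ℕ) = 0 from rfl, lowNum_one_even] at h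
    push_cast at h
    refine one_ne_zero (α := ℂ) ?_
    linear_combination ((193 - 19 * t) / 76800) * h + ((-1079 + 238 * t + 57 * t ^ 2) / 102400) * ht
  · simp only [Finset.forall_mem_insert, Finset.mem_singleton, forall_eq]
    refine ⟨⟨by decide, by decide, ?_⟩, ⟨by decide, by decide, ?_⟩, ⟨by decide, by decide, ?_⟩,
        ⟨by decide, by decide, ?_⟩⟩
    · rw [show (0 : ZMod 2) - (0 : ℕ) = 0 from rfl, lowNum_zero_even]
      push_cast
      ring
    · rw [show (0 : ZMod 2) - (0 : ℕ) = 0 from rfl, lowNum_one_even]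
      push_cast
      ring
    · rw [show (0 : ZMod 2) - (7 : ℕ) = 1 from rfl, lowNum_two_odd]
      push_cast
      ring
    · rw [show (0 : ZMod 2) - (9 : ℕ) = 1 from rfl, lowNum_zero_odd]
      push_cast
      linear_combination ((9 + 3 * t) / 32) * ht

/-- With `S = 0`: `(Λ + 1) K = -1` for `0 → 3` and `2 K = -(Λ + 10)` for `8 → 12`, which leads to
the same quadratic equation for `Λ` as the preceding case. -/
lemma uniqueUniserialPsi_four_three_five {t : ℂ} (ht : t ^ 2 = 89) :
    UniqueUniserialPsi.{u} ((-11 + t) / 4) [4, 3, 5] := by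
  refine uniqueUniserialPsi_of_lowNum (a := 4) (b := 3) (c := 5) ((-9 - t) / 4) 0 1
    {6, 8, 9, 10, 11} {(0, 3), (0, 5), (8, 12), (9, 12)} (by decide) (by decide) (by decide)
    (by decide) (by decide) (by decide) ?_ ?_ ?_ ?_ ?_ ?_ ?_ ?_
  · exact two_mul_add_ne_zero (c := -11) (d := 89) (by push_cast; ring) (by rw [ht]; norm_num) (by
      decide)
  · intro k hk h
    obtain rfl : k = 1 := by omega
    rw [IsGraded.mcFactor_odd _ 0] at h
    push_cast at h
    refine one_ne_zero (α := ℂ) ?_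
    linear_combination ((5 + t) / 16) * h + (-1 / 64) * ht
  · intro k hk h
    obtain rfl : k = 2 := by omega
    rw [IsGraded.mcFactor_even _ 1] at h
    push_cast at h
    refine one_ne_zero (α := ℂ) ?_
    linear_combination ((-9 + t) / 8) * h + ((1 - t) / 64) * ht
  · intro k hk h
    obtain rfl : k = 6 := by omega
    rw [IsGraded.mcFactor_even _ 3] at h
    push_cast at h
    refine one_ne_zero (α := ℂ) ?_
    linear_combination (1 / 5) * h + (-1 / 40) * ht
  · intro h
    rw [lowNum_one_odd] at h
    refine one_ne_zero (α := ℂ) ?_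
    linear_combination ((193 + 19 * t) / 76800) * h + ((-1079 - 238 * t + 57 * t ^ 2) / 102400) * ht
  · intro h
    rw [show (1 : ZMod 2) - (4 : ℕ) = 1 from rfl, lowNum_zero_odd] at h
    push_cast at h
    refine one_ne_zero (α := ℂ) ?_
    linear_combination ((165 - 17 * t) / 752) * h + ((-491 + 32 * t + 51 * t ^ 2) / 24064) * ht
  · intro h
    rw [show (1 : ZMod 2) - (7 : ℕ) = 0 from rfl, lowNum_two_even] at h
    push_cast at h
    refine one_ne_zero (α := ℂ) ?_
    linear_combination ((-19137 + 2029 * t) / 326400) * h + ((-30521555 - 21866886 * t - 5430536 *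
        t ^ 2 - 539946 * t ^ 3 - 18261 * t ^ 4) / 55705600) * ht
  · simp only [Finset.forall_mem_insert, Finset.mem_singleton, forall_eq]
    refine ⟨⟨by decide, by decide, ?_⟩, ⟨by decide, by decide, ?_⟩, ⟨by decide, by decide, ?_⟩,
        ⟨by decide, by decide, ?_⟩⟩
    · rw [show (1 : ZMod 2) - (0 : ℕ) = 1 from rfl, lowNum_zero_odd]
      push_cast
      linear_combination ((-9 + 3 * t) / 32) * ht
    · rw [show (1 : ZMod 2) - (0 : ℕ) = 1 from rfl, lowNum_two_odd]
      push_cast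
      ring
    · rw [show (1 : ZMod 2) - (8 : ℕ) = 1 from rfl, lowNum_one_odd]
      push_cast
      ring
    · rw [show (1 : ZMod 2) - (9 : ℕ) = 0 from rfl, lowNum_zero_even]
      push_cast
      ring

/-- With `S = 0`: `(Λ + 2) K = -3` for `0 → 5` and `2 K = -(Λ + 9)` for `8 → 12`, hence `(Λ + 2) (Λ
+ 9) = 6`. -/
lemma uniqueUniserialPsi_four_five_three {t : ℂ} (ht : t ^ 2 = 73) :
    UniqueUniserialPsi.{u} ((-11 + t) / 4) [4, 5, 3] := by
  refine uniqueUniserialPsi_of_lowNum (a := 4) (b := 5) (c := 3) ((-7 - t) / 4) 0 0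
    {7, 8, 10, 11} {(0, 3), (0, 5), (7, 12), (8, 12)} (by decide) (by decide) (by decide)
    (by decide) (by decide) (by decide) ?_ ?_ ?_ ?_ ?_ ?_ ?_ ?_
  · exact two_mul_add_ne_zero (c := -11) (d := 73) (by push_cast; ring) (by rw [ht]; norm_num) (by
      decide)
  · intro k hk h
    obtain rfl : k = 3 := by omega
    rw [IsGraded.mcFactor_odd _ 1] at h
    push_cast at h
    refine one_ne_zero (α := ℂ) ?_
    linear_combination ((3 + t) / 16) * h + (-1 / 64) * ht
  · intro k hk h
    obtain rfl : k = 2 := by omega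
    rw [IsGraded.mcFactor_even _ 1] at h
    push_cast at h
    refine one_ne_zero (α := ℂ) ?_
    linear_combination ((-7 + t) / 24) * h + ((-1 - t) / 192) * ht
  · intro k hk h
    obtain rfl : k = 6 := by omega
    rw [IsGraded.mcFactor_even _ 3] at h
    push_cast at h
    refine one_ne_zero (α := ℂ) ?_
    linear_combination (1 / 3) * h + (-1 / 24) * ht
  · intro h
    rw [lowNum_one_even] at h
    refine one_ne_zero (α := ℂ) ?_
    linear_combination ((-719 - 91 * t) / 262656) * h + ((-6521 + 1210 * t - 273 * t ^ 2) /
        350208) * ht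
  · intro h
    rw [show (0 : ZMod 2) - (4 : ℕ) = 0 from rfl, lowNum_two_even] at h
    push_cast at h
    refine one_ne_zero (α := ℂ) ?_
    linear_combination ((12847 - 1477 * t) / 2172672) * h + ((-5232069 - 446182 * t + 296 * t ^ 2
        + 110358 * t ^ 3 + 13293 * t ^ 4) / 370802688) * ht
  · intro h
    rw [show (0 : ZMod 2) - (9 : ℕ) = 1 from rfl, lowNum_zero_odd] at h
    push_cast at h
    refine one_ne_zero (α := ℂ) ?_
    linear_combination ((419 - 49 * t) / 144) * h + ((7829 + 2320 * t + 147 * t ^ 2) / 4608) * ht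
  · simp only [Finset.forall_mem_insert, Finset.mem_singleton, forall_eq]
    refine ⟨⟨by decide, by decide, ?_⟩, ⟨by decide, by decide, ?_⟩, ⟨by decide, by decide, ?_⟩,
        ⟨by decide, by decide, ?_⟩⟩
    · rw [show (0 : ZMod 2) - (0 : ℕ) = 0 from rfl, lowNum_zero_even]
      push_cast
      ring
    · rw [show (0 : ZMod 2) - (0 : ℕ) = 0 from rfl, lowNum_two_even]
      push_cast
      linear_combination ((105 + 249 * t - 189 * t ^ 2 + 27 * t ^ 3) / 512) * ht
    · rw [show (0 : ZMod 2) - (7 : ℕ) = 1 from rfl, lowNum_two_odd]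
      push_cast
      ring
    · rw [show (0 : ZMod 2) - (8 : ℕ) = 0 from rfl, lowNum_one_even]
      push_cast
      ring

/-- With `S = 0`: `2 K = -(Λ + 2)` for `0 → 4` and `(Λ + 9) K = -3` for `7 → 12`, with the same
equation for `Λ` as the preceding case. -/
lemma uniqueUniserialPsi_three_five_four {t : ℂ} (ht : t ^ 2 = 73) :
    UniqueUniserialPsi.{u} ((-11 + t) / 4) [3, 5, 4] := by
  refine uniqueUniserialPsi_of_lowNum (a := 3) (b := 5) (c := 4) ((7 - t) / 4) 0 1
    {6, 7, 9, 10, 11} {(0, 4), (0, 5), (7, 12), (9, 12)} (by decide) (by decide) (by decide)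
    (by decide) (by decide) (by decide) ?_ ?_ ?_ ?_ ?_ ?_ ?_ ?_
  · exact two_mul_add_ne_zero (c := -11) (d := 73) (by push_cast; ring) (by rw [ht]; norm_num) (by
      decide)
  · intro k hk h
    obtain rfl : k = 2 := by omega
    rw [IsGraded.mcFactor_even _ 1] at h
    push_cast at h
    refine one_ne_zero (α := ℂ) ?_
    linear_combination ((-7 - t) / 24) * h + ((-1 + t) / 192) * ht
  · intro k hk h
    obtain rfl : k = 3 := by omega
    rw [IsGraded.mcFactor_odd _ 1] at h
    push_cast at h
    refine one_ne_zero (α := ℂ) ?_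
    linear_combination ((-3 + t) / 16) * h + (-1 / 64) * ht
  · intro k hk h
    obtain rfl : k = 6 := by omega
    rw [IsGraded.mcFactor_even _ 3] at h
    push_cast at h
    refine one_ne_zero (α := ℂ) ?_
    linear_combination (1 / 3) * h + (-1 / 24) * ht
  · intro h
    rw [lowNum_zero_odd] at h
    refine one_ne_zero (α := ℂ) ?_
    linear_combination ((-419 - 49 * t) / 144) * h + ((7829 - 2320 * t + 147 * t ^ 2) / 4608) * ht
  · intro h
    rw [show (1 : ZMod 2) - (3 : ℕ) = 0 from rfl, lowNum_two_even] at h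
    push_cast at h
    refine one_ne_zero (α := ℂ) ?_
    linear_combination ((-12847 - 1477 * t) / 2172672) * h + ((-5232069 + 446182 * t + 296 * t ^ 2
        - 110358 * t ^ 3 + 13293 * t ^ 4) / 370802688) * ht
  · intro h
    rw [show (1 : ZMod 2) - (8 : ℕ) = 1 from rfl, lowNum_one_odd] at h
    push_cast at h
    refine one_ne_zero (α := ℂ) ?_
    linear_combination ((-719 + 91 * t) / 262656) * h + ((-6521 - 1210 * t - 273 * t ^ 2) /
        350208) * ht
  · simp only [Finset.forall_mem_insert, Finset.mem_singleton, forall_eq]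
    refine ⟨⟨by decide, by decide, ?_⟩, ⟨by decide, by decide, ?_⟩, ⟨by decide, by decide, ?_⟩,
        ⟨by decide, by decide, ?_⟩⟩
    · rw [show (1 : ZMod 2) - (0 : ℕ) = 1 from rfl, lowNum_one_odd]
      push_cast
      ring
    · rw [show (1 : ZMod 2) - (0 : ℕ) = 1 from rfl, lowNum_two_odd]
      push_cast
      ring
    · rw [show (1 : ZMod 2) - (7 : ℕ) = 0 from rfl, lowNum_two_even]
      push_cast
      linear_combination ((-105 + 249 * t + 189 * t ^ 2 + 27 * t ^ 3) / 512) * ht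
    · rw [show (1 : ZMod 2) - (9 : ℕ) = 0 from rfl, lowNum_zero_even]
      push_cast
      ring

/-- With `S = 0`: `2 K = -(Λ + 1)` for `0 → 4` and `(Λ + 10) K = -3` for `8 → 13`, hence `(Λ + 1) (Λ
+ 10) = 6`. -/
lemma uniqueUniserialPsi_five_four_four {t : ℂ} (ht : t ^ 2 = 105) :
    UniqueUniserialPsi.{u} ((-11 + t) / 4) [5, 4, 4] := by
  refine uniqueUniserialPsi_of_lowNum (a := 5) (b := 4) (c := 4) ((9 - t) / 4) 0 0
    {7, 8, 10, 11, 12} {(0, 3), (0, 4), (8, 13), (10, 13)} (by decide) (by decide) (by decide)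
    (by decide) (by decide) (by decide) ?_ ?_ ?_ ?_ ?_ ?_ ?_ ?_
  · exact two_mul_add_ne_zero (c := -11) (d := 105) (by push_cast; ring) (by rw [ht]; norm_num)
      (by decide)
  · intro k hk h
    obtain rfl : k = 3 := by omega
    rw [IsGraded.mcFactor_odd _ 1] at h
    push_cast at h
    refine one_ne_zero (α := ℂ) ?_
    linear_combination ((3 + t) / 24) * h + (-1 / 96) * ht
  · intro k hk h
    obtain rfl : k = 2 := by omega
    rw [IsGraded.mcFactor_even _ 1] at h
    push_cast at h
    refine one_ne_zero (α := ℂ) ?_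
    linear_combination ((-9 + t) / 36) * h + ((-3 - t) / 288) * ht
  · intro k hk h
    obtain rfl : k = 7 := by omega
    rw [IsGraded.mcFactor_odd _ 3] at h
    push_cast at h
    refine one_ne_zero (α := ℂ) ?_
    linear_combination ((-1 + t) / 26) * h + (-1 / 104) * ht
  · intro h
    rw [lowNum_two_even] at h
    refine one_ne_zero (α := ℂ) ?_
    linear_combination ((60855 + 5939 * t) / 149760) * h + ((-80824133 + 59619474 * t - 15051904 *
        t ^ 2 + 1536894 * t ^ 3 - 53451 * t ^ 4) / 25559040) * ht
  · intro h
    rw [show (0 : ZMod 2) - (5 : ℕ) = 1 from rfl, lowNum_one_odd] at h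
    push_cast at h
    refine one_ne_zero (α := ℂ) ?_
    linear_combination ((707 + 239 * t) / 4123392) * h + ((-209395 + 90 * t - 2151 * t ^ 2) /
        21991424) * ht
  · intro h
    rw [show (0 : ZMod 2) - (9 : ℕ) = 1 from rfl, lowNum_one_odd] at h
    push_cast at h
    refine one_ne_zero (α := ℂ) ?_
    linear_combination ((-1323 + 137 * t) / 826560) * h + ((-12895 - 2470 * t - 411 * t ^ 2) /
        881664) * ht
  · simp only [Finset.forall_mem_insert, Finset.mem_singleton, forall_eq]
    refine ⟨⟨by decide, by decide, ?_⟩, ⟨by decide, by decide, ?_⟩, ⟨by decide, by decide, ?_⟩,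
        ⟨by decide, by decide, ?_⟩⟩
    · rw [show (0 : ZMod 2) - (0 : ℕ) = 0 from rfl, lowNum_zero_even]
      push_cast
      ring
    · rw [show (0 : ZMod 2) - (0 : ℕ) = 0 from rfl, lowNum_one_even]
      push_cast
      ring
    · rw [show (0 : ZMod 2) - (8 : ℕ) = 0 from rfl, lowNum_two_even]
      push_cast
      linear_combination ((153 + 537 * t + 243 * t ^ 2 + 27 * t ^ 3) / 512) * ht
    · rw [show (0 : ZMod 2) - (10 : ℕ) = 0 from rfl, lowNum_zero_even]
      push_cast
      ring

/-- With `S = 0`: `(Λ + 2) K = -3` for `0 → 5` and `2 K = -(Λ + 11)` for `9 → 13`, hence `(Λ + 2) (Λ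
+ 11) = 6`. -/
lemma uniqueUniserialPsi_four_four_five {t : ℂ} (ht : t ^ 2 = 105) :
    UniqueUniserialPsi.{u} ((-13 + t) / 4) [4, 4, 5] := by
  refine uniqueUniserialPsi_of_lowNum (a := 4) (b := 4) (c := 5) ((-9 - t) / 4) 0 0
    {7, 9, 10, 11, 12} {(0, 3), (0, 5), (9, 13), (10, 13)} (by decide) (by decide) (by decide)
    (by decide) (by decide) (by decide) ?_ ?_ ?_ ?_ ?_ ?_ ?_ ?_
  · exact two_mul_add_ne_zero (c := -13) (d := 105) (by push_cast; ring) (by rw [ht]; norm_num)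
      (by decide)
  · intro k hk h
    obtain rfl : k = 2 := by omega
    rw [IsGraded.mcFactor_even _ 1] at h
    push_cast at h
    refine one_ne_zero (α := ℂ) ?_
    linear_combination ((-9 - t) / 36) * h + ((-3 + t) / 288) * ht
  · intro k hk h
    obtain rfl : k = 3 := by omega
    rw [IsGraded.mcFactor_odd _ 1] at h
    push_cast at h
    refine one_ne_zero (α := ℂ) ?_
    linear_combination ((-3 + t) / 24) * h + (-1 / 96) * ht
  · intro k hk h
    obtain rfl : k = 7 := by omega
    rw [IsGraded.mcFactor_odd _ 3] at h
    push_cast at h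
    refine one_ne_zero (α := ℂ) ?_
    linear_combination ((1 + t) / 26) * h + (-1 / 104) * ht
  · intro h
    rw [lowNum_one_even] at h
    refine one_ne_zero (α := ℂ) ?_
    linear_combination ((-1323 - 137 * t) / 826560) * h + ((-12895 + 2470 * t - 411 * t ^ 2) /
        881664) * ht
  · intro h
    rw [show (0 : ZMod 2) - (4 : ℕ) = 0 from rfl, lowNum_one_even] at h
    push_cast at h
    refine one_ne_zero (α := ℂ) ?_
    linear_combination ((707 - 239 * t) / 4123392) * h + ((-209395 - 90 * t - 2151 * t ^ 2) /
        21991424) * ht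
  · intro h
    rw [show (0 : ZMod 2) - (8 : ℕ) = 0 from rfl, lowNum_two_even] at h
    push_cast at h
    refine one_ne_zero (α := ℂ) ?_
    linear_combination ((-60855 + 5939 * t) / 149760) * h + ((-80824133 - 59619474 * t - 15051904
        * t ^ 2 - 1536894 * t ^ 3 - 53451 * t ^ 4) / 25559040) * ht
  · simp only [Finset.forall_mem_insert, Finset.mem_singleton, forall_eq]
    refine ⟨⟨by decide, by decide, ?_⟩, ⟨by decide, by decide, ?_⟩, ⟨by decide, by decide, ?_⟩,
        ⟨by decide, by decide, ?_⟩⟩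
    · rw [show (0 : ZMod 2) - (0 : ℕ) = 0 from rfl, lowNum_zero_even]
      push_cast
      ring
    · rw [show (0 : ZMod 2) - (0 : ℕ) = 0 from rfl, lowNum_two_even]
      push_cast
      linear_combination ((-153 + 537 * t - 243 * t ^ 2 + 27 * t ^ 3) / 512) * ht
    · rw [show (0 : ZMod 2) - (9 : ℕ) = 1 from rfl, lowNum_one_odd]
      push_cast
      ring
    · rw [show (0 : ZMod 2) - (10 : ℕ) = 0 from rfl, lowNum_zero_even]
      push_cast
      ring

/-- Dividing out components `7` and `8` requires only that `0 → 4` and `0 → 5` vanish. These are two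
equations for the two unknowns `K` and `S²`, solved for every `lam` by `K = -2 lam` and the value of
`S²` below; hence a whole family of weights. -/
lemma uniqueUniserialPsi_three_three_three {lam : ℂ}
    (hreg : ∀ n : ℕ, n < 9 → 2 * lam + n ≠ 0) : UniqueUniserialPsi.{u} lam [3, 3, 3] := by
  -- The value of `S²` below vanishes when `(2 lam + 3) (2 lam - 1) = 0`. The first factor is
  -- non-zero by regularity; the second is the exception treated here.
  by_cases hlam : 2 * lam = 1
  · obtain ⟨t, ht⟩ := IsAlgClosed.exists_pow_nat_eq (-24 : ℂ) two_pos
    rw [show lam = 1 / 2 by linear_combination hlam / 2]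
    exact uniqueUniserialPsi_half_three_three_three ht
  obtain ⟨S, hS⟩ := IsAlgClosed.exists_pow_nat_eq (1 - 2 * lam * (2 * lam + 2) / 3) two_pos
  have hr : ∀ n : ℕ, n < 9 → ∀ c : ℂ, c = n → 2 * lam + c ≠ 0 := fun n hn c hc => hc ▸ hreg n hn
  have r0 := hreg 0 (by omega)
  have r1 := hr 1 (by omega) 1 (by norm_num)
  have r2 := hr 2 (by omega) 2 (by norm_num)
  have r3 := hr 3 (by omega) 3 (by norm_num)
  have r4 := hr 4 (by omega) 4 (by norm_num)
  have r5 := hr 5 (by omega) 5 (by norm_num)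
  have r8 := hr 8 (by omega) 8 (by norm_num)
  rw [Nat.cast_zero, add_zero] at r0
  have hS0 : S ≠ 0 := by
    rintro rfl
    refine mul_ne_zero r3 (sub_ne_zero.2 hlam) ?_
    linear_combination 3 * hS
  refine uniqueUniserialPsi_of_lowNum (a := 3) (b := 3) (c := 3) (-2 * lam) S 0
    {7, 8} {(0, 4), (0, 5)} (by decide) (by decide) (by decide)
    (by decide) (by decide) (by decide) hreg ?_ ?_ ?_ ?_ ?_ ?_ ?_
  · intro k hk h
    obtain rfl : k = 0 := by omega
    rw [IsGraded.mcFactor_even _ 0] at h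
    push_cast at h
    exact mul_ne_zero r0 r5 (by linear_combination 2 * h)
  · intro k hk h
    obtain rfl : k = 0 := by omega
    rw [IsGraded.mcFactor_even _ 0] at h
    push_cast at h
    exact mul_ne_zero r3 r8 (by linear_combination 2 * h)
  · intro k hk h
    obtain rfl : k = 3 := by omega
    rw [IsGraded.mcFactor_odd _ 1] at h
    push_cast at h
    exact r4 (by linear_combination 2 * h)
  · intro h
    rw [lowNum_zero_even] at h
    exact mul_ne_zero (mul_ne_zero r0 r1) hS0 (by linear_combination h / 4)
  · intro h
    rw [show (0 : ZMod 2) - (3 : ℕ) = 1 from rfl, lowNum_zero_odd] at h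
    push_cast at h
    refine mul_ne_zero (mul_ne_zero r2 r0) r5 ?_
    linear_combination 3 / 4 * h - 3 / 2 * (2 * lam + 2) * hS
  · intro h
    rw [show (0 : ZMod 2) - (6 : ℕ) = 0 from rfl, lowNum_zero_even] at h
    push_cast at h
    exact mul_ne_zero (mul_ne_zero r3 r4) hS0 (by linear_combination h / 4)
  · simp only [Finset.forall_mem_insert, Finset.mem_singleton, forall_eq]
    refine ⟨⟨by decide, by decide, ?_⟩, ⟨by decide, by decide, ?_⟩⟩
    · rw [show (0 : ZMod 2) - (0 : ℕ) = 0 from rfl, lowNum_one_even]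
      push_cast
      linear_combination -3 * (-4 * lam) * (-4 * lam - 2) * hS
    · rw [show (0 : ZMod 2) - (0 : ℕ) = 0 from rfl, lowNum_two_even]
      push_cast
      linear_combination -3 * (-4 * lam) * (-4 * lam - 2) * (-4 * lam - 4) * hS

end Cases

end SuperLine

end

/-- The lists hold the doubles `2 p₁, 2 p₂, 2 p₃`.  In parts (c), (d), (e) and (g), `t` runs over
both square roots of the given number. -/
theorem proposition6p8 :
    -- (a) `(lam; 3/2, 3/2, 3/2)` for `-2 lam ∉ {0, 1, …, 8}`
    (∀ lam : ℂ, (∀ n : ℕ, n ≤ 8 → -2 * lam ≠ n) →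
      SuperLine.UniqueUniserialPsi.{u} lam [3, 3, 3]) ∧
    -- (b) `(1; 2, 3/2, 3/2)` and `(-11/2; 3/2, 3/2, 2)`
    (SuperLine.UniqueUniserialPsi.{u} 1 [4, 3, 3] ∧
      SuperLine.UniqueUniserialPsi.{u} (-11 / 2) [3, 3, 4]) ∧
    -- (c) `((-9 ± √57)/4; 2, 2, 3/2)` and `((-11 ± √57)/4; 3/2, 2, 2)`
    (∀ t : ℂ, t ^ 2 = 57 →
      SuperLine.UniqueUniserialPsi.{u} ((-9 + t) / 4) [4, 4, 3] ∧
      SuperLine.UniqueUniserialPsi.{u} ((-11 + t) / 4) [3, 4, 4]) ∧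
    -- (d) `((-11 ± √89)/4; 5/2, 3/2, 2)` and `((-11 ± √89)/4; 2, 3/2, 5/2)`
    (∀ t : ℂ, t ^ 2 = 89 →
      SuperLine.UniqueUniserialPsi.{u} ((-11 + t) / 4) [5, 3, 4] ∧
      SuperLine.UniqueUniserialPsi.{u} ((-11 + t) / 4) [4, 3, 5]) ∧
    -- (e) `((-11 ± √73)/4; 2, 5/2, 3/2)` and `((-11 ± √73)/4; 3/2, 5/2, 2)`
    (∀ t : ℂ, t ^ 2 = 73 →
      SuperLine.UniqueUniserialPsi.{u} ((-11 + t) / 4) [4, 5, 3] ∧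
      SuperLine.UniqueUniserialPsi.{u} ((-11 + t) / 4) [3, 5, 4]) ∧
    -- (f) `(-7; 2, 2, 2)` and `(3/2; 2, 2, 2)`
    (SuperLine.UniqueUniserialPsi.{u} (-7) [4, 4, 4] ∧
      SuperLine.UniqueUniserialPsi.{u} (3 / 2) [4, 4, 4]) ∧
    -- (g) `((-11 ± √105)/4; 5/2, 2, 2)` and `((-13 ± √105)/4; 2, 2, 5/2)`
    (∀ t : ℂ, t ^ 2 = 105 →
      SuperLine.UniqueUniserialPsi.{u} ((-11 + t) / 4) [5, 4, 4] ∧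
      SuperLine.UniqueUniserialPsi.{u} ((-13 + t) / 4) [4, 4, 5]) := by
  open SuperLine in
  refine ⟨fun lam h => uniqueUniserialPsi_three_three_three fun n hn h' => ?_,
    ⟨uniqueUniserialPsi_one_four_three_three, uniqueUniserialPsi_neg_three_three_four⟩,
    fun t ht => ⟨uniqueUniserialPsi_four_four_three ht, uniqueUniserialPsi_three_four_four ht⟩,
    fun t ht => ⟨uniqueUniserialPsi_five_three_four ht, uniqueUniserialPsi_four_three_five ht⟩,
    fun t ht => ⟨uniqueUniserialPsi_four_five_three ht, uniqueUniserialPsi_three_five_four ht⟩,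
    ⟨uniqueUniserialPsi_neg_four_four_four, uniqueUniserialPsi_four_four_four⟩,
    fun t ht => ⟨uniqueUniserialPsi_five_four_four ht, uniqueUniserialPsi_four_four_five ht⟩⟩
  exact h n (by omega) (by linear_combination -h')
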